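/- All vector spaces, algebras and tensor products are over $\mathbf C$, and $(\alpha,\beta)$ denotes the tensor product of two linear maps $\alpha,\beta$. A \emph{basic quantum $\operatorname{SL}(3)$ datum} (BQD) $\mathcal L$ consists of two $3$-dimensional vector spaces $V,W$, linear maps $$A:V\otimes V\to W,\quad B:W\otimes W\to V,\quad C:W\otimes V\to\mathbf C,\quad D:V\otimes W\to\mathbf C,$$ $$a:W\to V\otimes V,\quad b:V\to W\otimes W,\quad c:\mathbf C\to V\otimes W,\quad d:\mathbf C\to W\otimes V,$$ a constant $q\neq0$ such that $q^2\ne-1$ and either $q^2=1$ or $q^2$ is not a root of unity, and $\omega\in\mathbf C$ with $\omega^3=1$, such that, with $\kappa=q^{-2}+1+q^2$, $\rho=(q+q^{-1})^{-2}$, $F:=(A,1_V)(1_V,a):V\otimes W\to W\otimes V$ and $G:=(1_V,A)(a,1_V):W\otimes V\to V\otimes W$, $$(1_V,C)(c,1_V)=1_V,\quad (D,1_V)(1_V,d)=1_V,\quad Aa=1_W,$$ $$C(A,1_V)=\omega\,D(1_V,A),\quad (1_V,a)c=\omega\,(a,1_V)d,$$ $$(1_V,D)(a,1_W)=B=\omega\,(C,1_V)(1_W,a),\quad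 \omega^2(1_W,A)(d,1_V)=b=(A,1_W)(1_V,c),$$ $$Dc=\kappa\,1_{\mathbf C},\quad Cd=\kappa\,1_{\mathbf C},\quad GF=\rho\,(1_{V\otimes W}+cD),\quad FG=\rho\,(1_{W\otimes V}+dC).$$ The BQD $\mathcal L$ is called \emph{elliptic} if there are bases $x_1,x_2,x_3$ of $V$ and $y_1,y_2,y_3$ of $W$, with dual bases $x^i$, $y^i$, such that $c=\sum_i x_i\otimes y_i$, $d=\sum_i y_i\otimes x_i$, $C=\sum_i y^i\otimes x^i$, $D=\sum_i x^i\otimes y^i$, and (writing $x_{ijk}=x_i\otimes x_j\otimes x_k$, $x^{ijk}=x^i\otimes x^j\otimes x^k$) $$(1_V,a)c=\alpha(x_{123}+x_{231}+x_{312})+\beta(x_{132}+x_{213}+x_{321})+\gamma(x_{111}+x_{222}+x_{333}),$$ $$C(A,1_V)=\alpha'(x^{123}+x^{231}+x^{312})+\beta'(x^{132}+x^{213}+x^{321})+\gamma'(x^{111}+x^{222}+x^{333}),$$ where the scalars satisfy $\gamma\ne0$, $\gamma'\ne0$, $\gamma^3+(\alpha+\beta)^3\ne0$, $\gamma'^3+(\alpha'+\beta')^3\ne0$,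 $\alpha\ne\beta$, $\alpha'\ne\beta'$, $\alpha\alpha'+\beta\beta'+\gamma\gamma'\ne0$ and $$\alpha^2\alpha'^2+\beta^2\beta'^2+\gamma^2\gamma'^2-2\alpha\alpha'\beta\beta'-2\alpha\alpha'\gamma\gamma'-2\beta\beta'\gamma\gamma'=0,$$ $$\alpha^2\beta'\gamma'+\beta^2\alpha'\gamma'+\gamma^2\alpha'\beta'=0,\qquad \alpha'^2\beta\gamma+\beta'^2\alpha\gamma+\gamma'^2\alpha\beta=0.$$ The \emph{shape algebra} of $\mathcal L$ is $\mathcal M_{\mathcal L}=T(V\oplus W)/I$, where $I$ is the two-sided ideal generated by $\operatorname{Im}a$, $\operatorname{Im}b$, $\operatorname{Im}c$ and all $w\otimes v+(q+q^{-1})\,G(w\otimes v)$ ($v\in V$, $w\in W$). The \emph{dual shape algebra} is $\mathcal N_{\mathcal L}=T(V^*\oplus W^*)/J$, where $J$ is the two-sided ideal generated by the images of the transposes ${}^\tau\!A$, ${}^\tau\!B$, ${}^\tau\!D$ and all $\eta\otimes\xi+(q+q^{-1})\,{}^\tau\!F(\eta\otimes\xi)$ ($\xi\in V^*$, $\eta\in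 W^*$), with the identifications $(X\otimes Y)^*=X^*\otimes Y^*$. The $\mathbf N^2$-gradings of the tensor algebras with $V$, $V^*$ in degree $(1,0)$ and $W$, $W^*$ in degree $(0,1)$ induce gradings $\mathcal M_{\mathcal L}=\bigoplus V_{(k,\ell)}$ and $\mathcal N_{\mathcal L}=\bigoplus V^{(k,\ell)}$. \textbf{Statement.} If $\mathcal L$ is a BQD that is not elliptic, then for all $k,\ell\in\mathbf N$ $$\dim V_{(k,\ell)}=\dim V^{(k,\ell)}=\frac{(k+1)(\ell+1)(k+\ell+2)}2 .$$ -/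

import Mathlib

open scoped TensorProduct

noncomputable section

namespace QuantumSL3

section Data

variable {V W : Type*} [AddCommGroup V] [Module ℂ V] [AddCommGroup W] [Module ℂ W]

/-- `F = (A, 1_V)(1_V, a) : V ⊗ W → W ⊗ V`. -/
def mapF (A : V ⊗[ℂ] V →ₗ[ℂ] W) (a : W →ₗ[ℂ] V ⊗[ℂ] V) : V ⊗[ℂ] W →ₗ[ℂ] W ⊗[ℂ] V :=
  A.rTensor V ∘ₗ (TensorProduct.assoc ℂ V V V).symm.toLinearMap ∘ₗ a.lTensor V

/-- `G = (1_V, A)(a, 1_V) : W ⊗ V → V ⊗ W`. -/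
def mapG (A : V ⊗[ℂ] V →ₗ[ℂ] W) (a : W →ₗ[ℂ] V ⊗[ℂ] V) : W ⊗[ℂ] V →ₗ[ℂ] V ⊗[ℂ] W :=
  A.lTensor V ∘ₗ (TensorProduct.assoc ℂ V V V).toLinearMap ∘ₗ a.rTensor V

end Data

/-- A basic quantum `SL(3)` datum (BQD) on the vector spaces `V` and `W`. All the coherence
relations are written with explicit associators and unitors of the tensor product. -/
structure BQD (V W : Type*) [AddCommGroup V] [Module ℂ V] [AddCommGroup W] [Module ℂ W] where
  A : V ⊗[ℂ] V →ₗ[ℂ] W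
  a : W →ₗ[ℂ] V ⊗[ℂ] V
  B : W ⊗[ℂ] W →ₗ[ℂ] V
  b : V →ₗ[ℂ] W ⊗[ℂ] W
  C : W ⊗[ℂ] V →ₗ[ℂ] ℂ
  c : ℂ →ₗ[ℂ] V ⊗[ℂ] W
  D : V ⊗[ℂ] W →ₗ[ℂ] ℂ
  d : ℂ →ₗ[ℂ] W ⊗[ℂ] V
  q : ℂ
  ω : ℂ
  finrank_V : Module.finrank ℂ V = 3
  finrank_W : Module.finrank ℂ W = 3
  q_ne_zero : q ≠ 0
  q_sq_ne : q ^ 2 ≠ -1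
  q_sq : q ^ 2 = 1 ∨ ∀ n : ℕ, 1 ≤ n → (q ^ 2) ^ n ≠ 1
  ω_cube : ω ^ 3 = 1
  /-- `(1_V, C)(c, 1_V) = 1_V` -/
  zigzag_cC :
    (TensorProduct.rid ℂ V).toLinearMap ∘ₗ C.lTensor V ∘ₗ
      (TensorProduct.assoc ℂ V W V).toLinearMap ∘ₗ c.rTensor V ∘ₗ
      (TensorProduct.lid ℂ V).symm.toLinearMap = LinearMap.id
  /-- `(D, 1_V)(1_V, d) = 1_V` -/
  zigzag_dD :
    (TensorProduct.lid ℂ V).toLinearMap ∘ₗ D.rTensor V ∘ₗ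
      (TensorProduct.assoc ℂ V W V).symm.toLinearMap ∘ₗ d.lTensor V ∘ₗ
      (TensorProduct.rid ℂ V).symm.toLinearMap = LinearMap.id
  /-- `A a = 1_W` -/
  A_comp_a : A ∘ₗ a = LinearMap.id
  /-- `C (A, 1_V) = ω D (1_V, A)` -/
  C_A : C ∘ₗ A.rTensor V =
    ω • (D ∘ₗ A.lTensor V ∘ₗ (TensorProduct.assoc ℂ V V V).toLinearMap)
  /-- `(1_V, a) c = ω (a, 1_V) d` -/
  a_c : a.lTensor V ∘ₗ c =
    ω • ((TensorProduct.assoc ℂ V V V).toLinearMap ∘ₗ a.rTensor V ∘ₗ d)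
  /-- `(1_V, D)(a, 1_W) = B` -/
  D_a : (TensorProduct.rid ℂ V).toLinearMap ∘ₗ D.lTensor V ∘ₗ
    (TensorProduct.assoc ℂ V V W).toLinearMap ∘ₗ a.rTensor W = B
  /-- `ω² (1_W, A)(d, 1_V) = b` -/
  A_d : ω ^ 2 • (A.lTensor W ∘ₗ (TensorProduct.assoc ℂ W V V).toLinearMap ∘ₗ d.rTensor V ∘ₗ
    (TensorProduct.lid ℂ V).symm.toLinearMap) = b
  /-- `ω (C, 1_V)(1_W, a) = B` -/
  C_a : ω • ((TensorProduct.lid ℂ V).toLinearMap ∘ₗ C.rTensor V ∘ₗ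
    (TensorProduct.assoc ℂ W V V).symm.toLinearMap ∘ₗ a.lTensor W) = B
  /-- `(A, 1_W)(1_V, c) = b` -/
  A_c : A.rTensor W ∘ₗ (TensorProduct.assoc ℂ V V W).symm.toLinearMap ∘ₗ c.lTensor V ∘ₗ
    (TensorProduct.rid ℂ V).symm.toLinearMap = b
  /-- `D c = κ 1_ℂ` with `κ = q⁻² + 1 + q²` -/
  D_comp_c : D ∘ₗ c = ((q ^ 2)⁻¹ + 1 + q ^ 2) • LinearMap.id
  /-- `C d = κ 1_ℂ` with `κ = q⁻² + 1 + q²` -/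
  C_comp_d : C ∘ₗ d = ((q ^ 2)⁻¹ + 1 + q ^ 2) • LinearMap.id
  /-- `G F = ρ (1 + c D)` with `ρ = (q + q⁻¹)⁻²` -/
  G_comp_F : mapG A a ∘ₗ mapF A a = ((q + q⁻¹) ^ 2)⁻¹ • (LinearMap.id + c ∘ₗ D)
  /-- `F G = ρ (1 + d C)` with `ρ = (q + q⁻¹)⁻²` -/
  F_comp_G : mapF A a ∘ₗ mapG A a = ((q + q⁻¹) ^ 2)⁻¹ • (LinearMap.id + d ∘ₗ C)

/-- The coefficients of the cyclically invariant tensor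
`α (x₁₂₃ + x₂₃₁ + x₃₁₂) + β (x₁₃₂ + x₂₁₃ + x₃₂₁) + γ (x₁₁₁ + x₂₂₂ + x₃₃₃)`
(indices in `Fin 3`, with addition modulo `3`). -/
def cyclicCoeff (α β γ : ℂ) (i j k : Fin 3) : ℂ :=
  if i = j ∧ j = k then γ
  else if j = i + 1 ∧ k = j + 1 then α
  else if i = j + 1 ∧ j = k + 1 then β
  else 0


section Shape

variable (V W : Type*) [AddCommGroup V] [Module ℂ V] [AddCommGroup W] [Module ℂ W]

/-- The inclusion of `V` in the tensor algebra of `V ⊕ W`. -/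
def genV : V →ₗ[ℂ] TensorAlgebra ℂ (V × W) :=
  TensorAlgebra.ι ℂ ∘ₗ LinearMap.inl ℂ V W

/-- The inclusion of `W` in the tensor algebra of `V ⊕ W`. -/
def genW : W →ₗ[ℂ] TensorAlgebra ℂ (V × W) :=
  TensorAlgebra.ι ℂ ∘ₗ LinearMap.inr ℂ V W

/-- The component of bidegree `(k, ℓ)` of the tensor algebra of `V ⊕ W`: it is spanned by the
products (in any order) of `k` elements of `V` and `ℓ` elements of `W`. -/
def tensorPiece (k ℓ : ℕ) : Submodule ℂ (TensorAlgebra ℂ (V × W)) :=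
  Submodule.span ℂ {t | ∃ l : List (V ⊕ W),
    l.countP Sum.isLeft = k ∧ l.countP Sum.isRight = ℓ ∧
      t = (l.map (Sum.elim (genV V W) (genW V W))).prod}

variable {V W}

/-- Multiplication `X ⊗ Y → T` obtained from linear maps of `X` and `Y` to an algebra `T`. -/
def mulMap {X Y T : Type*} [AddCommGroup X] [Module ℂ X] [AddCommGroup Y] [Module ℂ Y]
    [Ring T] [Algebra ℂ T] (f : X →ₗ[ℂ] T) (g : Y →ₗ[ℂ] T) : X ⊗[ℂ] Y →ₗ[ℂ] T :=
  LinearMap.mul' ℂ T ∘ₗ TensorProduct.map f g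

/-- The two-sided ideal of the tensor algebra of `V ⊕ W` generated by subspaces `RVV`, `RWW`,
`RVW` of `V ⊗ V`, `W ⊗ W`, `V ⊗ W` and by all elements `w ⊗ v + T (w ⊗ v)`. -/
def quadraticIdeal (RVV : Submodule ℂ (V ⊗[ℂ] V)) (RWW : Submodule ℂ (W ⊗[ℂ] W))
    (RVW : Submodule ℂ (V ⊗[ℂ] W)) (T : W ⊗[ℂ] V →ₗ[ℂ] V ⊗[ℂ] W) :
    TwoSidedIdeal (TensorAlgebra ℂ (V × W)) :=
  TwoSidedIdeal.span
    (mulMap (genV V W) (genV V W) '' RVV ∪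
      mulMap (genW V W) (genW V W) '' RWW ∪
      mulMap (genV V W) (genW V W) '' RVW ∪
      {t | ∃ (w : W) (v : V),
        t = genW V W w * genV V W v + mulMap (genV V W) (genW V W) (T (w ⊗ₜ[ℂ] v))})

/-- The component of bidegree `(k, ℓ)` of the quotient of the tensor algebra of `V ⊕ W` by a
two-sided ideal `I`, namely the image of the component of bidegree `(k, ℓ)` of the tensor
algebra. -/
def quotientPiece (I : TwoSidedIdeal (TensorAlgebra ℂ (V × W))) (k ℓ : ℕ) :
    Submodule ℂ I.ringCon.Quotient :=
  (tensorPiece V W k ℓ).map (RingCon.mkₐ ℂ I.ringCon).toLinearMap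

/-- The transpose of `f : X ⊗ Y → Z`, as a map `Z* → X* ⊗ Y*`. -/
def transposeTo {X Y Z : Type*} [AddCommGroup X] [Module ℂ X] [AddCommGroup Y] [Module ℂ Y]
    [AddCommGroup Z] [Module ℂ Z] [FiniteDimensional ℂ X] [FiniteDimensional ℂ Y]
    (f : X ⊗[ℂ] Y →ₗ[ℂ] Z) : Module.Dual ℂ Z →ₗ[ℂ] Module.Dual ℂ X ⊗[ℂ] Module.Dual ℂ Y :=
  (TensorProduct.dualDistribEquiv ℂ X Y).symm.toLinearMap ∘ₗ f.dualMap

end Shape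

namespace BQD

variable {V W : Type*} [AddCommGroup V] [Module ℂ V] [AddCommGroup W] [Module ℂ W]

/-- `F : V ⊗ W → W ⊗ V`. -/
def F (L : BQD V W) : V ⊗[ℂ] W →ₗ[ℂ] W ⊗[ℂ] V := mapF L.A L.a

/-- `G : W ⊗ V → V ⊗ W`. -/
def G (L : BQD V W) : W ⊗[ℂ] V →ₗ[ℂ] V ⊗[ℂ] W := mapG L.A L.a

/-- The tensor `e = (1_V, a) c ∈ V ⊗ V ⊗ V`. -/
def e (L : BQD V W) : V ⊗[ℂ] (V ⊗[ℂ] V) := L.a.lTensor V (L.c 1)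

/-- The trilinear form `E = C (A, 1_V)` on `V ⊗ V ⊗ V`. -/
def E (L : BQD V W) : (V ⊗[ℂ] V) ⊗[ℂ] V →ₗ[ℂ] ℂ := L.C ∘ₗ L.A.rTensor V

/-- A BQD is elliptic when, in suitable bases of `V` and `W`, the maps `c, C, d, D` are the
standard pairings and copairings, and `e` and `E` are the two cyclic tensors with coefficients
`(α, β, γ)` and `(α', β', γ')` (the corresponding plane cubics being smooth) subject to the
conditions below. -/
def IsElliptic (L : BQD V W) : Prop :=
  ∃ (x : Module.Basis (Fin 3) ℂ V) (y : Module.Basis (Fin 3) ℂ W) (α β γ α' β' γ' : ℂ),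
    L.c 1 = ∑ i, x i ⊗ₜ[ℂ] y i ∧
    L.d 1 = ∑ i, y i ⊗ₜ[ℂ] x i ∧
    (∀ i j, L.C (y i ⊗ₜ[ℂ] x j) = if i = j then 1 else 0) ∧
    (∀ i j, L.D (x i ⊗ₜ[ℂ] y j) = if i = j then 1 else 0) ∧
    L.e = ∑ i, ∑ j, ∑ k, cyclicCoeff α β γ i j k • (x i ⊗ₜ[ℂ] (x j ⊗ₜ[ℂ] x k)) ∧
    (∀ i j k, L.E ((x i ⊗ₜ[ℂ] x j) ⊗ₜ[ℂ] x k) = cyclicCoeff α' β' γ' i j k) ∧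
    γ ≠ 0 ∧ γ' ≠ 0 ∧
    γ ^ 3 + (α + β) ^ 3 ≠ 0 ∧ γ' ^ 3 + (α' + β') ^ 3 ≠ 0 ∧
    α ≠ β ∧ α' ≠ β' ∧
    α * α' + β * β' + γ * γ' ≠ 0 ∧
    α ^ 2 * α' ^ 2 + β ^ 2 * β' ^ 2 + γ ^ 2 * γ' ^ 2
      - 2 * (α * α') * (β * β') - 2 * (α * α') * (γ * γ') - 2 * (β * β') * (γ * γ') = 0 ∧
    α ^ 2 * β' * γ' + β ^ 2 * α' * γ' + γ ^ 2 * α' * β' = 0 ∧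
    α' ^ 2 * β * γ + β' ^ 2 * α * γ + γ' ^ 2 * α * β = 0

/-- The ideal of relations of the shape algebra, in the tensor algebra of `V ⊕ W`: it is
generated by the images of `a`, `b`, `c` and by the elements
`w ⊗ v + (q + q⁻¹) G (w ⊗ v)`. -/
def shapeIdeal (L : BQD V W) : TwoSidedIdeal (TensorAlgebra ℂ (V × W)) :=
  quadraticIdeal (LinearMap.range L.a) (LinearMap.range L.b) (LinearMap.range L.c)
    ((L.q + L.q⁻¹) • L.G)

/-- The shape algebra of a BQD. -/
abbrev ShapeAlgebra (L : BQD V W) : Type _ := L.shapeIdeal.ringCon.Quotient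

/-- The graded piece `V_{(k, ℓ)}` of the shape algebra. -/
def shapePiece (L : BQD V W) (k ℓ : ℕ) : Submodule ℂ L.ShapeAlgebra :=
  quotientPiece L.shapeIdeal k ℓ

section Dual

variable [FiniteDimensional ℂ V] [FiniteDimensional ℂ W]

/-- The transpose of `F`, as a map `W* ⊗ V* → V* ⊗ W*`. -/
def transposeF (L : BQD V W) : Module.Dual ℂ W ⊗[ℂ] Module.Dual ℂ V →ₗ[ℂ]
    Module.Dual ℂ V ⊗[ℂ] Module.Dual ℂ W :=
  transposeTo L.F ∘ₗ (TensorProduct.dualDistribEquiv ℂ W V).toLinearMap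

/-- The ideal of relations of the dual shape algebra, in the tensor algebra of `V* ⊕ W*`: it is
generated by the images of the transposes of `A`, `B`, `D` and by the elements
`η ⊗ ξ + (q + q⁻¹) ᵗF (η ⊗ ξ)`. -/
def dualShapeIdeal (L : BQD V W) :
    TwoSidedIdeal (TensorAlgebra ℂ (Module.Dual ℂ V × Module.Dual ℂ W)) :=
  quadraticIdeal (LinearMap.range (transposeTo L.A)) (LinearMap.range (transposeTo L.B))
    (LinearMap.range (transposeTo L.D)) ((L.q + L.q⁻¹) • L.transposeF)

/-- The dual shape algebra of a BQD. -/
abbrev DualShapeAlgebra (L : BQD V W) : Type _ := L.dualShapeIdeal.ringCon.Quotient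

/-- The graded piece `V^{(k, ℓ)}` of the dual shape algebra. -/
def dualShapePiece (L : BQD V W) (k ℓ : ℕ) : Submodule ℂ L.DualShapeAlgebra :=
  quotientPiece L.dualShapeIdeal k ℓ

end Dual

end BQD

end QuantumSL3

end

open scoped TensorProduct

noncomputable section

namespace QuantumSL3

/-! Put `s = q ^ 2`, let `[n]` be the `s`-integer, and let `S(V)`, `S(W)` be the quadratic algebras
with relations `Im a`, `Im b`. The shape algebra in bidegree `(k, l)` turns out to be `S_k(V) ⊗
S_l(W)` modulo the elements with a copy of `c` inserted in the middle. The insertion is injective,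
so the dimension is a difference of two products of triangular numbers.

Each quadratic algebra has the Hilbert series of a polynomial ring in three variables. Its Koszul
complex `0 → S_{n-3} → S_{n-2} ⊗ W → S_{n-1} ⊗ V → S_n → 0` is exact because a braided derivation `Δ
: S_n → S_{n-1} ⊗ V` with `m Δ = [n]` yields a homotopy. The relation `G F = ρ (1 + c D)` makes its
composites nonzero multiples of the identity (`htpy_diff_mul`, `htpy₂_diff₂_mul`), whence
`finrank_T`.

For the insertion `ins` and the contraction `con` built from the derivations, `con ∘ ins = [k+l+3]/s
+ s • ins ∘ con` (`con_ins`). As with raising and lowering operators, iterating this produces only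
nonzero scalars, so `ins` is injective (`ker_ins`) and its cokernel `Q k l` has the required
dimension.

The rule `w v ↦ -(q + q⁻¹) G (w v)` for reordering may be changed by multiples of `c`, since `c = 0`
in the algebra. The choice `τ = -(q + q⁻¹) G + ω² q c C` respects the relations of `S(V)` and `S(W)`
(`exch_a`, `exch_b`) and commutes with `c` up to a scalar modulo these relations. Ordered monomials
then span (`exists_monomials`), which bounds the dimension above. The spaces `Q k l` carry a right
action of the shape algebra (`rels_op`), generated by one vector, which bounds it below
(`Presents.finrank_quotientPiece`).

Interchanging `A` and `a` up to `ω²` and transposing `D` gives structure constants of the same kind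
(`SpiderCoeffs.dual`). This one symmetry supplies both `S(W)` and the dual shape algebra. -/

/-! ### The `s`-integers. -/

/-- The `s`-integer `1 + s + ⋯ + s ^ (n - 1)`. -/
def sNat (s : ℂ) (n : ℕ) : ℂ := ∑ i ∈ Finset.range n, s ^ i

lemma sNat_zero (s : ℂ) : sNat s 0 = 0 := by simp [sNat]

lemma sNat_one (s : ℂ) : sNat s 1 = 1 := by simp [sNat]

lemma sNat_succ (s : ℂ) (n : ℕ) : sNat s (n + 1) = 1 + s * sNat s n := by
  simp only [sNat, Finset.sum_range_succ', pow_zero, pow_succ, Finset.mul_sum]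
  rw [add_comm]
  congr 1
  exact Finset.sum_congr rfl fun i _ => mul_comm _ _

lemma sNat_mul_sub_one (s : ℂ) (n : ℕ) : sNat s n * (s - 1) = s ^ n - 1 :=
  geom_sum_mul s n

lemma sNat_ne_zero {s : ℂ} (hs : s = 1 ∨ ∀ n : ℕ, 1 ≤ n → s ^ n ≠ 1) (n : ℕ) :
    sNat s (n + 1) ≠ 0 := by
  rcases hs with rfl | hs
  · simp only [sNat, one_pow, Finset.sum_const, Finset.card_range, nsmul_eq_mul, mul_one]
    exact Nat.cast_ne_zero.2 n.succ_ne_zero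
  · intro h
    have := sNat_mul_sub_one s (n + 1)
    rw [h, zero_mul] at this
    exact hs (n + 1) (by omega) (sub_eq_zero.1 this.symm)

/-! ### Tensor calculus in coordinates. -/

section Strict

variable {ι : Type} {X Y : Type*} [AddCommGroup X] [Module ℂ X] [AddCommGroup Y] [Module ℂ Y]

variable (ι) in
/-- Tensoring on the right with `ℂ ^ ι` is the functor `X ↦ (ι → X)`; this is its action on
linear maps. In iterated tensor products, the outermost index is the rightmost factor. -/
abbrev mp (g : X →ₗ[ℂ] Y) : (ι → X) →ₗ[ℂ] (ι → Y) := g.compLeft ι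

lemma mp_apply (g : X →ₗ[ℂ] Y) (u : ι → X) (i : ι) : mp ι g u i = g (u i) := rfl

variable (X) in
/-- `1_X ⊗ c` for the tensor with coefficients `c i p`. -/
def cup (c : ι → ι → ℂ) : X →ₗ[ℂ] (ι → ι → X) where
  toFun x p i := c i p • x
  map_add' u v := by ext p; simp
  map_smul' r u := by ext p; simp [smul_comm r]

lemma cup_map (c : ι → ι → ℂ) (g : X →ₗ[ℂ] Y) (u : X) :
    cup Y c (g u) = mp ι (mp ι g) (cup X c u) := by
  ext p; simp [cup]

lemma cup_smul (c : ι → ι → ℂ) (f : ι → ℂ) (x : X) :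
    cup (ι → X) c (fun i => f i • x) = fun p j i => (c j p * f i) • x := by
  ext p; simp [cup, smul_smul]

variable [Fintype ι]

variable (X) in
/-- `1_X ⊗ A` for the linear map `A : ℂ ^ ι ⊗ ℂ ^ ι → ℂ ^ ι` with coefficients `A i j p`. -/
def fuse (A : ι → ι → ι → ℂ) : (ι → ι → X) →ₗ[ℂ] (ι → X) where
  toFun u p := ∑ j, ∑ i, A i j p • u j i
  map_add' u v := by ext p; simp [Finset.sum_add_distrib]
  map_smul' r u := by ext p; simp [Finset.smul_sum, smul_comm r]

variable (X) in
/-- `1_X ⊗ a` for the linear map `a : ℂ ^ ι → ℂ ^ ι ⊗ ℂ ^ ι` with coefficients `a p i j`. -/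
def split (a : ι → ι → ι → ℂ) : (ι → X) →ₗ[ℂ] (ι → ι → X) where
  toFun u j i := ∑ p, a p i j • u p
  map_add' u v := by ext p; simp [Finset.sum_add_distrib]
  map_smul' r u := by ext p; simp [Finset.smul_sum, smul_comm r]

variable (X) in
/-- `1_X ⊗ D` for the bilinear form with coefficients `D i p`. -/
def cap (D : ι → ι → ℂ) : (ι → ι → X) →ₗ[ℂ] X where
  toFun u := ∑ p, ∑ i, D i p • u p i
  map_add' u v := by simp [Finset.sum_add_distrib]
  map_smul' r u := by simp [Finset.smul_sum, smul_comm r]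

lemma fuse_mp (A : ι → ι → ι → ℂ) (g : X →ₗ[ℂ] Y) (u : ι → ι → X) :
    fuse Y A (mp ι (mp ι g) u) = mp ι g (fuse X A u) := by
  ext p; simp [fuse]

lemma split_mp (a : ι → ι → ι → ℂ) (g : X →ₗ[ℂ] Y) (u : ι → X) :
    split Y a (mp ι g u) = mp ι (mp ι g) (split X a u) := by
  ext p; simp [split]

lemma cap_mp (D : ι → ι → ℂ) (g : X →ₗ[ℂ] Y) (u : ι → ι → X) :
    cap Y D (mp ι (mp ι g) u) = g (cap X D u) := by
  simp [cap]


lemma fuse_smul (A : ι → ι → ι → ℂ) (f : ι → ι → ℂ) (x : X) :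
    fuse X A (fun j i => f j i • x) = fun p => (∑ j, ∑ i, A i j p * f j i) • x := by
  ext p; simp [fuse, smul_smul, Finset.sum_smul]

lemma fuse_smul₂ (A : ι → ι → ι → ℂ) (f : ι → ι → ι → ℂ) (x : X) :
    fuse (ι → X) A (fun j i h => f j i h • x) = fun p h => (∑ j, ∑ i, A i j p * f j i h) • x := by
  ext p h
  simp only [fuse, LinearMap.coe_mk, AddHom.coe_mk, Finset.sum_apply, Pi.smul_apply, smul_smul,
    Finset.sum_smul]

lemma split_smul (a : ι → ι → ι → ℂ) (f : ι → ℂ) (x : X) :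
    split X a (fun p => f p • x) = fun j i => (∑ p, a p i j * f p) • x := by
  ext p; simp [split, smul_smul, Finset.sum_smul]

lemma cap_smul (D : ι → ι → ℂ) (f : ι → ι → ℂ) (x : X) :
    cap X D (fun p i => f p i • x) = (∑ p, ∑ i, D i p * f p i) • x := by
  simp [cap, smul_smul, Finset.sum_smul]

variable [DecidableEq ι]

/-- Testing on families of scalars times a fixed vector keeps every intermediate value in the form
handled by the `_smul` lemmas, so an identity of maps becomes an identity of coefficients. -/
lemma linearMap_ext_smul {f g : (ι → X) →ₗ[ℂ] Y}
    (h : ∀ i x, f (fun i' => (if i = i' then (1 : ℂ) else 0) • x) =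
      g (fun i' => (if i = i' then (1 : ℂ) else 0) • x)) : f = g := by
  refine LinearMap.pi_ext' fun i => LinearMap.ext fun x => ?_
  have : (Pi.single i x : ι → X) = fun i' => (if i = i' then (1 : ℂ) else 0) • x := by
    ext i'; simp [Pi.single_apply, eq_comm]
  simpa [this] using h i x

lemma linearMap_ext_smul₂ {f g : (ι → ι → X) →ₗ[ℂ] Y}
    (h : ∀ p i x, f (fun p' i' => (if p = p' ∧ i = i' then (1 : ℂ) else 0) • x) =
      g (fun p' i' => (if p = p' ∧ i = i' then (1 : ℂ) else 0) • x)) : f = g := by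
  refine LinearMap.pi_ext' fun p => LinearMap.pi_ext' fun i => LinearMap.ext fun x => ?_
  have : (Pi.single p (Pi.single i x) : ι → ι → X) =
      fun p' i' => (if p = p' ∧ i = i' then (1 : ℂ) else 0) • x := by
    ext p' i'
    by_cases hp : p = p'
    · subst hp; simp [Pi.single_apply, eq_comm]
    · have : p' ≠ p := fun h => hp h.symm
      simp [this, hp]
  simpa [this] using h p i x

end Strict

/-! ### Koszul complex of a quadratic algebra and its homotopy. -/

/-- Coefficients of linear maps `A`, `a`, `c`, `D` (and of an auxiliary tensor `d`) on `ℂ ^ ι`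
satisfying the relations that make the Koszul complex of the quadratic algebra with relations
`Im a` exact. -/
structure KoszulData (ι : Type) [Fintype ι] [DecidableEq ι] (s : ℂ) where
  A : ι → ι → ι → ℂ
  a : ι → ι → ι → ℂ
  c : ι → ι → ℂ
  D : ι → ι → ℂ
  d : ι → ι → ℂ
  s_ne_zero : s ≠ 0
  one_add_s : 1 + s ≠ 0
  sNat_ne_zero : ∀ n, sNat s (n + 1) ≠ 0
  A_a : ∀ p p', ∑ j, ∑ i, A i j p' * a p i j = if p = p' then 1 else 0
  G_F : ∀ i p i' p', ∑ j, ∑ q, (∑ k, A i k q * a p k j) * (∑ k, a q i' k * A k j p') =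
    s / (1 + s) ^ 2 * ((if p = p' ∧ i = i' then 1 else 0) + D i p * c i' p')
  D_c : ∑ p, ∑ i, D i p * c i p = (1 + s + s ^ 2) / s
  B_b : ∀ i i', ∑ q, ∑ p, (∑ k, A i k p * c k q) * (∑ j, a p i' j * D j q) =
    if i = i' then 1 else 0
  a_c : ∀ i j k, ∑ p, c i p * a p j k = ∑ p, d p k * a p i j

namespace KoszulData

variable {ι : Type} [Fintype ι] [DecidableEq ι] {s : ℂ} (K : KoszulData ι s)
variable {X Y : Type} [AddCommGroup X] [Module ℂ X] [AddCommGroup Y] [Module ℂ Y]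

lemma fuse_split (u : ι → X) : fuse X K.A (split X K.a u) = u := by
  suffices h : fuse X K.A ∘ₗ split X K.a = (LinearMap.id : (ι → X) →ₗ[ℂ] _) from
    LinearMap.congr_fun h u
  refine linearMap_ext_smul fun p x => ?_
  rw [LinearMap.comp_apply, split_smul, fuse_smul]
  ext p'
  simp [K.A_a]

lemma cap_cup (x : X) : cap X K.D (cup X K.c x) = ((1 + s + s ^ 2) / s) • x := by
  simp only [cap, cup, LinearMap.coe_mk, AddHom.coe_mk, smul_smul, ← Finset.sum_smul, K.D_c]

lemma G_F_apply (u : ι → ι → X) :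
    fuse (ι → X) K.A (mp ι (split X K.a) (mp ι (fuse X K.A) (split (ι → X) K.a u))) =
      (s / (1 + s) ^ 2) • (u + cup X K.c (cap X K.D u)) := by
  suffices h : fuse (ι → X) K.A ∘ₗ mp ι (split X K.a) ∘ₗ mp ι (fuse X K.A) ∘ₗ split (ι → X) K.a =
    (s / (1 + s) ^ 2) • ((LinearMap.id : (ι → ι → X) →ₗ[ℂ] _) + cup X K.c ∘ₗ cap X K.D) from
    LinearMap.congr_fun h u
  refine linearMap_ext_smul₂ fun p i x => ?_
  have h1 : split (ι → X) K.a (fun p' i' => (if p = p' ∧ i = i' then (1 : ℂ) else 0) • x) =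
      fun j k i' => (if i = i' then K.a p k j else 0) • x := by
    ext j k i'
    by_cases h : i = i' <;> simp [split, h]
  have h2 : mp ι (fuse X K.A) (fun j k i' => (if i = i' then K.a p k j else 0) • x) =
      fun j q => (∑ k, A K i k q * K.a p k j) • x := by
    ext j : 1
    rw [mp_apply, fuse_smul]
    ext q; simp
  have h3 : mp ι (split X K.a) (fun j q => (∑ k, A K i k q * K.a p k j) • x) =
      fun j k' i' => (∑ q, K.a q i' k' * (∑ k, A K i k q * K.a p k j)) • x := by
    ext j : 1
    rw [mp_apply, split_smul]
  simp only [LinearMap.comp_apply, LinearMap.smul_apply, LinearMap.add_apply, LinearMap.id_apply]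
  have e : ∑ p', ∑ i', K.D i' p' * (if p = p' ∧ i = i' then 1 else 0) = K.D i p := by
    simp [ite_and]
  rw [h1, h2, h3, cap_smul, fuse_smul₂, e]
  ext p' i'
  have e2 : cup X K.c (K.D i p • x) p' i' = (K.D i p * K.c i' p') • x := by
    simp [cup, smul_smul, mul_comm]
  simp only [Pi.smul_apply, Pi.add_apply, e2]
  rw [← add_smul, smul_smul, ← K.G_F i p i' p']
  congr 1
  refine Finset.sum_congr rfl fun j _ => ?_
  simp only [Finset.mul_sum, Finset.sum_mul]
  rw [Finset.sum_comm]
  refine Finset.sum_congr rfl fun q _ => ?_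
  refine Finset.sum_congr rfl fun k _ => Finset.sum_congr rfl fun k' _ => by ring

lemma B_b_apply (u : ι → X) :
    cap (ι → X) K.D (mp ι (split X K.a) (mp ι (fuse X K.A) (cup (ι → X) K.c u))) = u := by
  suffices h : cap (ι → X) K.D ∘ₗ mp ι (split X K.a) ∘ₗ mp ι (fuse X K.A) ∘ₗ cup (ι → X) K.c =
    (LinearMap.id : (ι → X) →ₗ[ℂ] _) from
    LinearMap.congr_fun h u
  refine linearMap_ext_smul fun i x => ?_
  have h2 : mp ι (fuse X K.A) (fun q k i' => (K.c k q * if i = i' then 1 else 0) • x) =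
      fun q p => (∑ k, A K i k p * K.c k q) • x := by
    ext q : 1
    rw [mp_apply, fuse_smul]
    ext p; simp
  have h3 : mp ι (split X K.a) (fun q p => (∑ k, A K i k p * K.c k q) • x) =
      fun q j i' => (∑ p, K.a p i' j * (∑ k, A K i k p * K.c k q)) • x := by
    ext j : 1
    rw [mp_apply, split_smul]
  simp only [LinearMap.comp_apply, LinearMap.id_apply]
  rw [cup_smul, h2, h3]
  ext i'
  rw [← K.B_b i i']
  simp only [cap, LinearMap.coe_mk, AddHom.coe_mk, Finset.sum_apply, Pi.smul_apply,
    smul_smul, ← Finset.sum_smul]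
  congr 1
  refine Finset.sum_congr rfl fun q _ => ?_
  simp only [Finset.mul_sum, Finset.sum_mul]
  rw [Finset.sum_comm]
  refine Finset.sum_congr rfl fun p _ => ?_
  refine Finset.sum_congr rfl fun j _ => Finset.sum_congr rfl fun k _ => by ring

lemma a_c_apply (x : X) :
    split (ι → X) K.a (cup X K.c x) = mp ι (split X K.a) (fun i p => K.d p i • x) := by
  ext k j i
  simp only [split, cup, LinearMap.coe_mk, AddHom.coe_mk, mp_apply, Finset.sum_apply,
    Pi.smul_apply, smul_smul, ← Finset.sum_smul]
  simp only [mul_comm (K.a _ _ _), K.a_c i j k]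

variable (m : (ι → X) →ₗ[ℂ] Y) (Δ : Y →ₗ[ℂ] (ι → X))

/-- The Koszul differential `X ⊗ W → Y ⊗ V` attached to a multiplication `m : X ⊗ V → Y`. -/
def diff : (ι → X) →ₗ[ℂ] (ι → Y) := mp ι m ∘ₗ split X K.a

/-- The Koszul differential `X → Y ⊗ W` attached to a multiplication `m : X ⊗ V → Y`. -/
def diff₂ : X →ₗ[ℂ] (ι → Y) := mp ι m ∘ₗ cup X K.c

/-- The homotopy `Y ⊗ V → X ⊗ W` attached to a derivation `Δ : Y → X ⊗ V`. -/
def htpy : (ι → Y) →ₗ[ℂ] (ι → X) := fuse X K.A ∘ₗ mp ι Δ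

/-- The homotopy `Y ⊗ W → X` attached to a derivation `Δ : Y → X ⊗ V`. -/
def htpy₂ : (ι → Y) →ₗ[ℂ] X := cap X K.D ∘ₗ mp ι Δ

/-- By `a_c`, inserting `c` and splitting its `W` leg is the same as inserting `d` and splitting the
other one; there the composite contains `m'` applied to a relation. -/
lemma diff_diff₂ {Z : Type} [AddCommGroup Z] [Module ℂ Z] (m' : (ι → Y) →ₗ[ℂ] Z)
    (h : ∀ w, m' (K.diff m w) = 0) (x : X) : K.diff m' (K.diff₂ m x) = 0 := by
  simp only [diff, diff₂, LinearMap.comp_apply] at h ⊢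
  rw [split_mp, K.a_c_apply]
  ext i
  exact h _

variable {Z : Type} [AddCommGroup Z] [Module ℂ Z] {m Δ}
  {m' : (ι → Y) →ₗ[ℂ] Z} {Δ' : Z →ₗ[ℂ] (ι → Y)}

/-- Expanding `Δ'` by `h`, the first term simplifies by `A a = 1`. The second is `G F` placed
between `Δ` and `m`: in `G F = s/(1+s)² (1 + c D)` the identity yields `m Δ = e`, and `c D` yields
`diff₂ ∘ htpy₂`. -/
lemma htpy_diff {r e : ℂ} (euler : ∀ y, m (Δ y) = e • y)
    (h : ∀ u, Δ' (m' u) = r • u - (1 + s) • K.diff m (K.htpy Δ u)) (w : ι → Y) :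
    K.htpy Δ' (K.diff m' w) =
      (r - s / (1 + s) * e) • w - (s / (1 + s)) • K.diff₂ m (K.htpy₂ Δ w) := by
  have hm : ∀ v : ι → ι → Y, mp ι Δ' (mp ι m' v) =
      r • v - (1 + s) • mp ι (K.diff m) (mp ι (K.htpy Δ) v) := by
    intro v; ext1 i; exact h (v i)
  simp only [htpy, diff, LinearMap.comp_apply] at hm ⊢
  rw [hm, map_sub, map_smul, map_smul, K.fuse_split]
  have e1 : mp ι (mp ι m ∘ₗ split X K.a) (mp ι (fuse X K.A ∘ₗ mp ι Δ) (split Y K.a w)) =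
      mp ι (mp ι m) (mp ι (split X K.a) (mp ι (fuse X K.A) (split (ι → X) K.a (mp ι Δ w)))) := by
    rw [split_mp]; rfl
  have e2 : mp ι m (mp ι Δ w) = e • w := by ext1 i; exact euler (w i)
  rw [e1, fuse_mp, K.G_F_apply, map_smul, map_add, e2]
  simp only [diff₂, htpy₂, LinearMap.comp_apply]
  have := K.one_add_s
  match_scalars <;> field_simp

/-- The two terms of `Δ'` are evaluated by `D c = (1 + s + s²)/s` and by `B b = 1`, the latter
leaving `m Δ = e`. -/
lemma htpy₂_diff₂ {r e : ℂ} (euler : ∀ y, m (Δ y) = e • y)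
    (h : ∀ u, Δ' (m' u) = r • u - (1 + s) • K.diff m (K.htpy Δ u)) (y : Y) :
    K.htpy₂ Δ' (K.diff₂ m' y) = (r * ((1 + s + s ^ 2) / s) - (1 + s) * e) • y := by
  have hm : ∀ v : ι → ι → Y, mp ι Δ' (mp ι m' v) =
      r • v - (1 + s) • mp ι (K.diff m) (mp ι (K.htpy Δ) v) := by
    intro v; ext1 i; exact h (v i)
  simp only [htpy₂, diff₂, LinearMap.comp_apply, htpy, diff] at hm ⊢
  rw [hm, map_sub, map_smul, map_smul, K.cap_cup]
  have e1 : mp ι (mp ι m ∘ₗ split X K.a) (mp ι (fuse X K.A ∘ₗ mp ι Δ) (cup Y K.c y)) =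
      mp ι (mp ι m) (mp ι (split X K.a) (mp ι (fuse X K.A) (cup (ι → X) K.c (Δ y)))) := by
    rw [cup_map]; rfl
  rw [e1, cap_mp, K.B_b_apply, euler]
  module

/-- Two consecutive graded pieces `X`, `Y` of the quadratic algebra, of degrees `n - 1` and `n`,
with the multiplication `m : X ⊗ V → Y` and the braided derivation `Δ : Y → X ⊗ V`. -/
structure Stage where
  X : Type
  Y : Type
  [instX : AddCommGroup X]
  [modX : Module ℂ X]
  [instY : AddCommGroup Y]
  [modY : Module ℂ Y]
  m : (ι → X) →ₗ[ℂ] Y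
  Δ : Y →ₗ[ℂ] (ι → X)
  n : ℕ
  euler : ∀ y, m (Δ y) = sNat s n • y
  -- This is what lets the derivation of the next degree descend to the quotient by the relations.
  close : ∀ w, sNat s (n + 1) • K.diff m w - (1 + s) • K.diff m (K.htpy Δ (K.diff m w)) = 0

attribute [instance] Stage.instX Stage.modX Stage.instY Stage.modY

namespace Stage

variable {K} (S : K.Stage)

/-- The next graded piece. -/
abbrev Next : Type := (ι → S.Y) ⧸ LinearMap.range (K.diff S.m)

/-- The multiplication to the next graded piece. -/
def mul : (ι → S.Y) →ₗ[ℂ] S.Next := Submodule.mkQ _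

/-- The derivation on the next graded piece. -/
def der : S.Next →ₗ[ℂ] (ι → S.Y) :=
  Submodule.liftQ _
    -- A braided Leibniz rule. When `s = 1` and `a A` is the antisymmetrizer, `2 a A = 1 - flip` and
    -- `m Δ = n` turn it into `y x ↦ y ⊗ x` plus the derivative of `y` multiplied by `x`.
    (sNat s (S.n + 1) • LinearMap.id - (1 + s) • (K.diff S.m ∘ₗ K.htpy S.Δ)) <| by
    rintro _ ⟨w, rfl⟩
    simpa using S.close w

lemma der_mul (u : ι → S.Y) :
    S.der (S.mul u) = sNat s (S.n + 1) • u - (1 + s) • K.diff S.m (K.htpy S.Δ u) := by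
  simp [der, mul]

lemma mul_diff (w : ι → S.X) : S.mul (K.diff S.m w) = 0 := by
  simp [mul]

/-- The next stage. -/
def next : K.Stage where
  X := S.Y
  Y := S.Next
  m := S.mul
  Δ := S.der
  n := S.n + 1
  euler z := by
    obtain ⟨u, rfl⟩ := Submodule.mkQ_surjective _ z
    change S.mul (S.der (S.mul u)) = _
    rw [der_mul, map_sub, map_smul, map_smul, mul_diff, smul_zero, sub_zero]
    rfl
  close w := by
    -- The `diff₂` term of the homotopy formula is killed by the next differential; what is left
    -- vanishes by `[n+2] = (1+s) [n+1] - s [n]`.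
    rw [K.htpy_diff S.euler S.der_mul, map_sub, map_smul, map_smul, K.diff_diff₂ _ _ S.mul_diff,
      smul_zero, sub_zero, smul_smul, ← sub_smul]
    have := K.one_add_s
    rw [sNat_succ s (S.n + 1), sNat_succ s S.n]
    convert zero_smul ℂ _
    field_simp
    ring

end Stage

/-- The initial stage, with pieces `0` and `ℂ`. -/
def initial : K.Stage where
  -- A zero piece in degree `-1` lets the recursion start without a special case; it is the source
  -- of the index shift in `T`.
  X := PUnit
  Y := ℂ
  m := 0
  Δ := 0
  n := 0
  euler y := by simp [sNat_zero]
  close w := by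
    have : K.diff (0 : (ι → PUnit) →ₗ[ℂ] ℂ) w = 0 := by ext; rfl
    rw [this]; simp

/-- The sequence of stages. -/
def stage : ℕ → K.Stage
  | 0 => K.initial
  | n + 1 => (stage n).next

lemma stage_n (n : ℕ) : (K.stage n).n = n := by
  induction n with
  | zero => rfl
  | succ n ih => exact congrArg (· + 1) ih

/-- The graded piece of degree `n - 1` of the quadratic algebra with relations `Im a`. -/
def T (n : ℕ) : Type := (K.stage n).X

instance (n : ℕ) : AddCommGroup (K.T n) := (K.stage n).instX

instance (n : ℕ) : Module ℂ (K.T n) := (K.stage n).modX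

instance : Subsingleton (K.T 0) := inferInstanceAs (Subsingleton PUnit)

/-- The piece of degree `0` is `ℂ`. -/
def one : ℂ ≃ₗ[ℂ] K.T 1 := LinearEquiv.refl ℂ ℂ

/-- The multiplication by elements of `V = ℂ ^ ι`. -/
def mul (n : ℕ) : (ι → K.T n) →ₗ[ℂ] K.T (n + 1) := (K.stage n).m

/-- The braided derivation. -/
def der (n : ℕ) : K.T (n + 1) →ₗ[ℂ] (ι → K.T n) := (K.stage n).Δ

lemma mul_der (n : ℕ) (y : K.T (n + 1)) : K.mul n (K.der n y) = sNat s n • y := by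
  have := (K.stage n).euler y
  rw [K.stage_n n] at this
  exact this

lemma der_mul (n : ℕ) (u : ι → K.T (n + 1)) :
    K.der (n + 1) (K.mul (n + 1) u) =
      sNat s (n + 1) • u - (1 + s) • K.diff (K.mul n) (K.htpy (K.der n) u) := by
  have := (K.stage n).der_mul u
  rw [K.stage_n n] at this
  exact this

lemma mul_diff (n : ℕ) (w : ι → K.T n) : K.mul (n + 1) (K.diff (K.mul n) w) = 0 :=
  (K.stage n).mul_diff w

lemma mul_surjective (n : ℕ) : Function.Surjective (K.mul (n + 1)) :=
  Submodule.mkQ_surjective _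

lemma ker_mul (n : ℕ) :
    LinearMap.ker (K.mul (n + 1)) = LinearMap.range (K.diff (K.mul n)) :=
  Submodule.ker_mkQ _

instance (n : ℕ) : FiniteDimensional ℂ (K.T n) := by
  induction n with
  | zero => exact inferInstanceAs (FiniteDimensional ℂ PUnit)
  | succ n ih =>
    cases n with
    | zero => exact inferInstanceAs (FiniteDimensional ℂ ℂ)
    | succ n => exact FiniteDimensional.of_surjective (K.mul (n + 1)) (K.mul_surjective n)

lemma htpy_diff_mul (n : ℕ) (w : ι → K.T (n + 1)) :
    K.htpy (K.der (n + 1)) (K.diff (K.mul (n + 1)) w) =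
      (sNat s (n + 2) / (1 + s)) • w -
        (s / (1 + s)) • K.diff₂ (K.mul n) (K.htpy₂ (K.der n) w) := by
  rw [K.htpy_diff (K.mul_der n) (K.der_mul n)]
  congr 2
  have := K.one_add_s
  rw [sNat_succ s (n + 1), sNat_succ s n]
  field_simp
  ring

lemma htpy₂_diff₂_mul (n : ℕ) (y : K.T (n + 1)) :
    K.htpy₂ (K.der (n + 1)) (K.diff₂ (K.mul (n + 1)) y) = (sNat s (n + 3) / s) • y := by
  rw [K.htpy₂_diff₂ (K.mul_der n) (K.der_mul n)]
  congr 1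
  have := K.s_ne_zero
  rw [sNat_succ s (n + 2), sNat_succ s (n + 1), sNat_succ s n]
  field_simp
  ring

/-- On the kernel, `htpy_diff_mul` expresses a nonzero multiple of `w` as a value of `diff₂`. -/
lemma ker_diff_mul (n : ℕ) :
    LinearMap.ker (K.diff (K.mul (n + 1))) = LinearMap.range (K.diff₂ (K.mul n)) := by
  apply le_antisymm
  · intro w hw
    have h := K.htpy_diff_mul n w
    rw [LinearMap.mem_ker.1 hw, map_zero, eq_comm, sub_eq_zero] at h
    have h0 : sNat s (n + 2) / (1 + s) ≠ 0 := div_ne_zero (K.sNat_ne_zero _) K.one_add_s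
    rw [← inv_smul_smul₀ h0 w, h]
    exact Submodule.smul_mem _ _ (Submodule.smul_mem _ _ ⟨_, rfl⟩)
  · rintro _ ⟨x, rfl⟩
    exact K.diff_diff₂ _ _ (K.mul_diff n) x

lemma ker_diff₂_mul (n : ℕ) : LinearMap.ker (K.diff₂ (K.mul n)) = ⊥ := by
  cases n with
  | zero => exact Submodule.eq_bot_of_subsingleton
  | succ n =>
    refine (Submodule.eq_bot_iff _).2 fun x hx => ?_
    have h := K.htpy₂_diff₂_mul n x
    rw [LinearMap.mem_ker.1 hx, map_zero, eq_comm] at h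
    exact (smul_eq_zero.1 h).resolve_left (div_ne_zero (K.sNat_ne_zero _) K.s_ne_zero)

/-- Euler characteristic of the exact Koszul complex, whose middle terms are three copies of a piece
each. -/
lemma finrank_T_rec (hι : Fintype.card ι = 3) (n : ℕ) :
    Module.finrank ℂ (K.T (n + 3)) + 3 * Module.finrank ℂ (K.T (n + 1)) =
      3 * Module.finrank ℂ (K.T (n + 2)) + Module.finrank ℂ (K.T n) := by
  have h1 := (K.mul (n + 2)).finrank_range_add_finrank_ker
  have h2 := (K.diff (K.mul (n + 1))).finrank_range_add_finrank_ker
  have h3 := (K.diff₂ (K.mul n)).finrank_range_add_finrank_ker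
  rw [LinearMap.range_eq_top.2 (K.mul_surjective (n + 1)), finrank_top, K.ker_mul] at h1
  rw [K.ker_diff_mul] at h2
  rw [K.ker_diff₂_mul, finrank_bot] at h3
  simp only [Module.finrank_pi_fintype, Finset.sum_const, Finset.card_univ, hι, smul_eq_mul]
    at h1 h2 h3
  have h1' : Module.finrank ℂ (K.T (n + 3)) +
    Module.finrank ℂ (LinearMap.range (K.diff (K.mul (n + 1)))) =
      3 * Module.finrank ℂ (K.T (n + 2)) := h1
  have h2' : Module.finrank ℂ (LinearMap.range (K.diff (K.mul (n + 1)))) +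
    Module.finrank ℂ (LinearMap.range (K.diff₂ (K.mul n))) =
      3 * Module.finrank ℂ (K.T (n + 1)) := h2
  omega

lemma finrank_T (hι : Fintype.card ι = 3) (n : ℕ) :
    2 * Module.finrank ℂ (K.T n) = n * (n + 1) := by
  suffices h : 2 * Module.finrank ℂ (K.T n) = n * (n + 1) ∧
      2 * Module.finrank ℂ (K.T (n + 1)) = (n + 1) * (n + 2) ∧
      2 * Module.finrank ℂ (K.T (n + 2)) = (n + 2) * (n + 3) from h.1
  induction n with
  | zero =>
    have h0 : Module.finrank ℂ (K.T 0) = 0 := Module.finrank_zero_of_subsingleton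
    have h1 : Module.finrank ℂ (K.T 1) = 1 := by
      rw [← K.one.finrank_eq, Module.finrank_self]
    have h2 := (K.mul 1).finrank_range_add_finrank_ker
    have : LinearMap.range (K.diff (K.mul 0)) = ⊥ := by
      rw [LinearMap.range_eq_bot]
      exact LinearMap.ext fun w => by rw [Subsingleton.elim w 0, map_zero, map_zero]
    rw [LinearMap.range_eq_top.2 (K.mul_surjective 0), finrank_top, K.ker_mul, this,
      finrank_bot] at h2
    simp only [Module.finrank_pi_fintype, Finset.sum_const, Finset.card_univ, hι, smul_eq_mul]
      at h2
    zify at *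
    simp only [zero_add]
    refine ⟨?_, ?_, ?_⟩ <;> linarith
  | succ n ih =>
    obtain ⟨i1, i2, i3⟩ := ih
    refine ⟨i2, i3, ?_⟩
    have := K.finrank_T_rec hι n
    zify at *
    linarith

end KoszulData

/-! ### Identities for `s`-integers and rearrangement of finite sums. -/

lemma sNat_add (s : ℂ) (m n : ℕ) : sNat s (m + n) = sNat s m + s ^ m * sNat s n := by
  simp [sNat, Finset.sum_range_add, pow_add, Finset.mul_sum]

/-- The scalar part of `con_ins`: one term from `D c`, two mixed terms, and one from the product of
the exchange terms. -/
lemma sNat_clebsch {s : ℂ} (hs : s ≠ 0) (k l : ℕ) :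
    sNat s (k + 1) * sNat s (l + 1) * ((1 + s + s ^ 2) / s) - (1 + s) * sNat s (k + 1) * sNat s l -
      (1 + s) * sNat s (l + 1) * sNat s k + s * sNat s k * sNat s l = sNat s (k + l + 3) / s := by
  have h1 : s ^ k = sNat s k * (s - 1) + 1 := by rw [sNat_mul_sub_one]; ring
  rw [sNat_succ s (k + l + 2), sNat_succ s (k + l + 1), sNat_succ s (k + l), sNat_add s k l,
    sNat_succ s k, sNat_succ s l, h1]
  field_simp
  ring

/-- Passes from the scalar at stage `j` to the one at stage `j + 1` in `ins_aux`. -/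
lemma sNat_mul_sNat (s : ℂ) (n j : ℕ) :
    sNat s n * s ^ j + sNat s j * sNat s (n + j + 1) = sNat s (j + 1) * sNat s (n + j) := by
  have h1 := sNat_add s (n + j) 1
  have h2 := sNat_add s j 1
  have h3 := sNat_add s n j
  rw [sNat_one] at h1 h2
  rw [h1, h2, h3]
  ring

lemma map_ite_zero {M M' : Type*} [AddCommGroup M] [Module ℂ M] [AddCommGroup M'] [Module ℂ M']
    (f : M →ₗ[ℂ] M') (P : Prop) [Decidable P] (u : M) :
    f (if P then u else 0) = if P then f u else 0 := by
  split_ifs <;> simp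

lemma _root_.TensorProduct.eq_zero_of_left {M M' : Type*} [AddCommGroup M] [Module ℂ M]
    [AddCommGroup M'] [Module ℂ M'] [Subsingleton M] (x : M ⊗[ℂ] M') : x = 0 :=
  x.induction_on rfl (fun u v => by rw [Subsingleton.elim u 0, TensorProduct.zero_tmul])
    fun a b ha hb => by rw [ha, hb, add_zero]

lemma _root_.TensorProduct.eq_zero_of_right {M M' : Type*} [AddCommGroup M] [Module ℂ M]
    [AddCommGroup M'] [Module ℂ M'] [Subsingleton M'] (x : M ⊗[ℂ] M') : x = 0 :=
  x.induction_on rfl (fun u v => by rw [Subsingleton.elim v 0, TensorProduct.tmul_zero])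
    fun a b ha hb => by rw [ha, hb, add_zero]

section SumSwap

variable {α β γ δ M : Type*} [Fintype α] [Fintype β] [Fintype γ] [Fintype δ] [AddCommMonoid M]

lemma sum_swap₁ {f : α → β → M} : ∑ a, ∑ b, f a b = ∑ b, ∑ a, f a b := Finset.sum_comm

lemma sum_swap₂ {f : α → β → γ → M} : ∑ a, ∑ b, ∑ c, f a b c = ∑ a, ∑ c, ∑ b, f a b c :=
  Finset.sum_congr rfl fun _ _ => Finset.sum_comm

lemma sum_swap₃ {f : α → β → γ → δ → M} :
    ∑ a, ∑ b, ∑ c, ∑ d, f a b c d = ∑ a, ∑ b, ∑ d, ∑ c, f a b c d :=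
  Finset.sum_congr rfl fun _ _ => sum_swap₂

lemma sum_front₃ {f : α → β → γ → δ → M} :
    ∑ a, ∑ b, ∑ c, ∑ d, f a b c d = ∑ d, ∑ a, ∑ b, ∑ c, f a b c d :=
  sum_swap₃.trans (sum_swap₂.trans sum_swap₁)

lemma sum_block₃ {ε ζ : Type*} [Fintype ε] [Fintype ζ] {f : α → β → γ → δ → ε → ζ → M} :
    ∑ a, ∑ b, ∑ c, ∑ d, ∑ e, ∑ g, f a b c d e g =
      ∑ d, ∑ e, ∑ g, ∑ a, ∑ b, ∑ c, f a b c d e g :=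
  sum_front₃.trans (Finset.sum_congr rfl fun _ _ =>
    sum_front₃.trans (Finset.sum_congr rfl fun _ _ => sum_front₃))

lemma sum_block₂ {f : α → β → γ → δ → M} :
    ∑ a, ∑ b, ∑ c, ∑ d, f a b c d = ∑ c, ∑ d, ∑ a, ∑ b, f a b c d :=
  sum_swap₂.trans (sum_swap₁.trans (sum_swap₃.trans sum_swap₂))

lemma sum_congr₂ {f g : α → β → M} (h : ∀ a b, f a b = g a b) :
    ∑ a, ∑ b, f a b = ∑ a, ∑ b, g a b :=
  Finset.sum_congr rfl fun a _ => Finset.sum_congr rfl fun b _ => h a b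

lemma sum_congr₃ {f g : α → β → γ → M} (h : ∀ a b c, f a b c = g a b c) :
    ∑ a, ∑ b, ∑ c, f a b c = ∑ a, ∑ b, ∑ c, g a b c :=
  Finset.sum_congr rfl fun a _ => sum_congr₂ (h a)

lemma sum_congr₄ {f g : α → β → γ → δ → M} (h : ∀ a b c d, f a b c d = g a b c d) :
    ∑ a, ∑ b, ∑ c, ∑ d, f a b c d = ∑ a, ∑ b, ∑ c, ∑ d, g a b c d :=
  Finset.sum_congr rfl fun a _ => sum_congr₃ (h a)

end SumSwap

lemma sum_smul_bilin {α β γ E E' M : Type*} [Fintype α] [Fintype β] [Fintype γ]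
    [AddCommGroup E] [Module ℂ E] [AddCommGroup E'] [Module ℂ E'] [AddCommGroup M] [Module ℂ M]
    (B : E →ₗ[ℂ] E' →ₗ[ℂ] M) (f : α → ℂ) (g : α → β → ℂ) (g' : α → γ → ℂ) (U : β → E)
    (U' : γ → E') :
    ∑ z, f z • B (∑ w, g z w • U w) (∑ w', g' z w' • U' w') =
      ∑ w, ∑ w', (∑ z, f z * (g z w * g' z w')) • B (U w) (U' w') := by
  simp only [map_sum, LinearMap.sum_apply, map_smul, LinearMap.smul_apply, Finset.smul_sum,
    smul_smul, Finset.sum_smul]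
  refine sum_swap₂.trans (sum_swap₁.trans (sum_swap₂.trans (sum_congr₃ fun w w' z => ?_)))
  congr 1
  ring

/-! ### Multiplications and derivations in coordinates. -/

namespace KoszulData

variable {ι : Type} [Fintype ι] [DecidableEq ι] {s : ℂ} (K : KoszulData ι s)

/-- The coefficients of `a ∘ A`. -/
def P (l j h i : ι) : ℂ := ∑ r, K.A l j r * K.a r h i

/-- The multiplication by a basis vector. -/
def X (n : ℕ) (i : ι) : K.T n →ₗ[ℂ] K.T (n + 1) := K.mul n ∘ₗ LinearMap.single ℂ (fun _ => K.T n) i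

/-- The component of the braided derivation along a basis vector. -/
def pd (n : ℕ) (i : ι) : K.T (n + 1) →ₗ[ℂ] K.T n := LinearMap.proj i ∘ₗ K.der n

lemma mul_eq_sum (n : ℕ) (u : ι → K.T n) : K.mul n u = ∑ i, K.X n i (u i) := by
  conv_lhs => rw [← Finset.univ_sum_single u, map_sum]
  rfl

lemma sum_X_pd (n : ℕ) : ∑ i, K.X n i ∘ₗ K.pd n i = sNat s n • LinearMap.id := by
  ext y
  rw [LinearMap.sum_apply, LinearMap.smul_apply, LinearMap.id_apply, ← K.mul_der n y, mul_eq_sum]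
  rfl

/-- The braided Leibniz rule in coordinates: a Weyl-type commutation relation whose exchange
coefficients are those of `a A`. -/
lemma pd_X (n : ℕ) (i j : ι) :
    K.pd (n + 1) i ∘ₗ K.X (n + 1) j = (if i = j then sNat s (n + 1) else 0) • LinearMap.id -
      (1 + s) • ∑ w : ι × ι, K.P w.2 j w.1 i • (K.X n w.1 ∘ₗ K.pd n w.2) := by
  ext y
  have h := congrFun (K.der_mul n (Pi.single j y)) i
  have h2 : K.htpy (K.der n) (Pi.single j y) = fun r => ∑ l, K.A l j r • K.pd n l y := by
    ext r
    simp only [htpy, fuse, LinearMap.comp_apply, LinearMap.coe_mk, AddHom.coe_mk, mp_apply]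
    rw [Finset.sum_eq_single j]
    · simp [pd]
    · intro b _ hb
      simp [Pi.single_apply, hb]
    · simp
  have h3 : K.diff (K.mul n) (fun r => ∑ l, K.A l j r • K.pd n l y) i =
      ∑ w : ι × ι, K.P w.2 j w.1 i • (K.X n w.1 (K.pd n w.2 y)) := by
    simp only [diff, LinearMap.comp_apply, mp_apply, mul_eq_sum, split, LinearMap.coe_mk,
      AddHom.coe_mk, map_sum, map_smul, Finset.smul_sum, Fintype.sum_prod_type, smul_smul, P,
      Finset.sum_smul]
    refine Finset.sum_congr rfl fun h _ => ?_
    rw [Finset.sum_comm]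
    refine Finset.sum_congr rfl fun l _ => Finset.sum_congr rfl fun r _ => ?_
    rw [mul_comm]
  rw [h2] at h
  simp only [Pi.sub_apply, Pi.smul_apply, h3] at h
  simp only [pd, X, LinearMap.comp_apply, LinearMap.coe_single, LinearMap.proj_apply,
    LinearMap.sub_apply, LinearMap.smul_apply, LinearMap.sum_apply, LinearMap.id_apply] at h ⊢
  rw [h]
  by_cases hij : i = j <;> simp [Pi.single_apply, hij]

end KoszulData

/-! ### Insertion and contraction of the copairing. -/

/-- A pair of Koszul data, for a right quadratic algebra generated by `V` and a left quadratic
algebra generated by `W`, such that the copairing `c` and the pairing `D` are compatible. -/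
structure KoszulPair (ι : Type) [Fintype ι] [DecidableEq ι] (s : ℂ) where
  K : KoszulData ι s
  K' : KoszulData ι s
  c_eq : ∀ i p, K'.c p i = K.c i p
  D_eq : ∀ i p, K'.D p i = K.D i p
  contract : ∀ l h l' h',
    ∑ i, ∑ p, ∑ j, ∑ q, K.D i p * K.c j q * (K.P l j h i * K'.P l' q h' p) =
      s / (1 + s) ^ 2 * ((if l = h ∧ l' = h' then 1 else 0) + K.D l l' * K.c h h')

namespace KoszulPair

variable {ι : Type} [Fintype ι] [DecidableEq ι] {s : ℂ} (N : KoszulPair ι s)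

/-- The insertion of the copairing in the middle. -/
def ins (k l : ℕ) : N.K.T k ⊗[ℂ] N.K'.T l →ₗ[ℂ] N.K.T (k + 1) ⊗[ℂ] N.K'.T (l + 1) :=
  ∑ i, ∑ p, N.K.c i p • TensorProduct.map (N.K.X k i) (N.K'.X l p)

/-- The contraction in the middle. -/
def con (k l : ℕ) : N.K.T (k + 1) ⊗[ℂ] N.K'.T (l + 1) →ₗ[ℂ] N.K.T k ⊗[ℂ] N.K'.T l :=
  ∑ i, ∑ p, N.K.D i p • TensorProduct.map (N.K.pd k i) (N.K'.pd l p)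

/-- On each factor `∂ x` is a scalar minus terms `x ∂`, so the tensor product of the two expansions
has four kinds of terms. The scalars contribute `D c`. The mixed terms reduce by `B b = 1` and
Euler's identity `∑ x ∂ = [n]`. The terms with both factors exchanged reduce by `contract` to `s`
times a product of Euler operators plus `s • ins ∘ con`. -/
lemma con_ins (k l : ℕ) : N.con (k + 1) (l + 1) ∘ₗ N.ins (k + 1) (l + 1) =
    (sNat s (k + l + 3) / s) • LinearMap.id + s • (N.ins k l ∘ₗ N.con k l) := by
  set E := Module.End ℂ (N.K.T (k + 1))
  set E' := Module.End ℂ (N.K'.T (l + 1))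
  let B : E →ₗ[ℂ] E' →ₗ[ℂ] Module.End ℂ (N.K.T (k + 1) ⊗[ℂ] N.K'.T (l + 1)) :=
    TensorProduct.mapBilinear (RingHom.id ℂ) _ _ _ _
  -- Here `none` labels the scalar term of `pd_X` and `some (h, t)` labels the exchange term `x_h
  -- ∂_t`.
  let U : Option (ι × ι) → E := fun w => w.elim LinearMap.id fun w => N.K.X k w.1 ∘ₗ N.K.pd k w.2
  let U' : Option (ι × ι) → E' :=
    fun w => w.elim LinearMap.id fun w => N.K'.X l w.1 ∘ₗ N.K'.pd l w.2
  let g : ι × ι × ι × ι → Option (ι × ι) → ℂ := fun z w =>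
    w.elim (if z.1 = z.2.2.1 then sNat s (k + 1) else 0)
      fun w => -(1 + s) * N.K.P w.2 z.2.2.1 w.1 z.1
  let g' : ι × ι × ι × ι → Option (ι × ι) → ℂ := fun z w =>
    w.elim (if z.2.1 = z.2.2.2 then sNat s (l + 1) else 0)
      fun w => -(1 + s) * N.K'.P w.2 z.2.2.2 w.1 z.2.1
  have key := sum_smul_bilin B (fun z : ι × ι × ι × ι => N.K.D z.1 z.2.1 * N.K.c z.2.2.1 z.2.2.2)
    g g' U U'
  have hg : ∀ z, ∑ w, g z w • U w = N.K.pd (k + 1) z.1 ∘ₗ N.K.X (k + 1) z.2.2.1 := by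
    intro z
    rw [N.K.pd_X, Fintype.sum_option, Finset.smul_sum, sub_eq_add_neg, ← Finset.sum_neg_distrib]
    simp only [g, U, smul_smul, ← neg_smul, neg_mul, Option.elim]
  have hg' : ∀ z, ∑ w, g' z w • U' w = N.K'.pd (l + 1) z.2.1 ∘ₗ N.K'.X (l + 1) z.2.2.2 := by
    intro z
    rw [N.K'.pd_X, Fintype.sum_option, Finset.smul_sum, sub_eq_add_neg, ← Finset.sum_neg_distrib]
    simp only [g', U', smul_smul, ← neg_smul, neg_mul, Option.elim]
  simp only [hg, hg'] at key
  have hL : N.con (k + 1) (l + 1) ∘ₗ N.ins (k + 1) (l + 1) =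
      ∑ z : ι × ι × ι × ι, (N.K.D z.1 z.2.1 * N.K.c z.2.2.1 z.2.2.2) •
        B (N.K.pd (k + 1) z.1 ∘ₗ N.K.X (k + 1) z.2.2.1)
          (N.K'.pd (l + 1) z.2.1 ∘ₗ N.K'.X (l + 1) z.2.2.2) := by
    refine TensorProduct.ext' fun u v => ?_
    simp only [con, ins, Fintype.sum_prod_type, LinearMap.sum_apply, LinearMap.comp_apply, map_sum,
      map_smul, LinearMap.smul_apply, Finset.smul_sum, smul_smul, TensorProduct.map_tmul, B,
      TensorProduct.mapBilinear_apply]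
    refine sum_swap₂.trans (sum_swap₁.trans (sum_swap₃.trans (sum_swap₂.trans
      (sum_congr₄ fun i p j q => ?_))))
    rw [mul_comm]
    rfl
  have hR : N.ins k l ∘ₗ N.con k l = ∑ w : ι × ι, ∑ w' : ι × ι,
      (N.K.D w.2 w'.2 * N.K.c w.1 w'.1) •
        B (N.K.X k w.1 ∘ₗ N.K.pd k w.2) (N.K'.X l w'.1 ∘ₗ N.K'.pd l w'.2) := by
    refine TensorProduct.ext' fun u v => ?_
    simp only [con, ins, Fintype.sum_prod_type, LinearMap.sum_apply, LinearMap.comp_apply, map_sum,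
      map_smul, LinearMap.smul_apply, Finset.smul_sum, smul_smul, TensorProduct.map_tmul, B,
      TensorProduct.mapBilinear_apply]
    refine sum_swap₂.trans (sum_swap₁.trans (sum_swap₃.trans (sum_congr₄ fun i p j q => ?_)))
    rfl
  have c1 : ∑ z, (fun z : ι × ι × ι × ι => N.K.D z.1 z.2.1 * N.K.c z.2.2.1 z.2.2.2) z *
      (g z none * g' z none) = sNat s (k + 1) * sNat s (l + 1) * ((1 + s + s ^ 2) / s) := by
    rw [← N.K.D_c, Finset.sum_comm]
    simp only [Fintype.sum_prod_type, g, g', Option.elim, mul_ite, ite_mul, mul_zero, zero_mul,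
      Finset.sum_ite_eq, Finset.mem_univ, if_true, Finset.mul_sum]
    refine Finset.sum_congr rfl fun i _ => Finset.sum_congr rfl fun p _ => ?_
    ring
  have c2 : ∀ h t , ∑ z, (fun z : ι × ι × ι × ι => N.K.D z.1 z.2.1 * N.K.c z.2.2.1 z.2.2.2) z *
      (g z (some (h, t)) * g' z none) =
        -(1 + s) * sNat s (l + 1) * if t = h then 1 else 0 := by
    intro h t
    rw [← N.K.B_b t h]
    simp only [Fintype.sum_prod_type, g, g', Option.elim, mul_ite, ite_mul, mul_zero, zero_mul,
      Finset.sum_ite_eq, Finset.mem_univ, if_true, Finset.mul_sum, KoszulData.P, Finset.sum_mul]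
    refine sum_swap₁.trans (sum_swap₃.trans (sum_swap₂.trans (sum_congr₄ fun i p j q => ?_)))
    ring
  have c3 : ∀ h t , ∑ z, (fun z : ι × ι × ι × ι => N.K.D z.1 z.2.1 * N.K.c z.2.2.1 z.2.2.2) z *
      (g z none * g' z (some (h, t))) =
        -(1 + s) * sNat s (k + 1) * if t = h then 1 else 0 := by
    intro h t
    rw [← N.K'.B_b t h]
    simp only [Fintype.sum_prod_type, g, g', Option.elim, mul_ite, ite_mul, mul_zero, zero_mul,
      Finset.sum_ite_eq, Finset.mem_univ, if_true, Finset.mul_sum, KoszulData.P, Finset.sum_mul]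
    refine Finset.sum_congr rfl fun i _ => ?_
    have : ∀ p, (∑ j, ∑ q, ∑ r, if i = j then N.K.D i p * N.K.c j q *
        (sNat s (k + 1) * (-(1 + s) * (N.K'.A t q r * N.K'.a r h p))) else 0) =
        ∑ q, ∑ r, N.K'.D p i * N.K'.c q i *
          (sNat s (k + 1) * (-(1 + s) * (N.K'.A t q r * N.K'.a r h p))) := by
      intro p
      rw [Finset.sum_eq_single i]
      · simp [N.c_eq, N.D_eq]
      · intro b _ hb
        simp [hb.symm]
      · simp
    simp only [this]
    refine sum_swap₂.trans (sum_swap₁.trans (sum_congr₃ fun i p j => ?_))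
    ring
  have c4 : ∀ h t h' t' , ∑ z,
      (fun z : ι × ι × ι × ι => N.K.D z.1 z.2.1 * N.K.c z.2.2.1 z.2.2.2) z *
      (g z (some (h, t)) * g' z (some (h', t'))) =
        s * ((if t = h ∧ t' = h' then 1 else 0) + N.K.D t t' * N.K.c h h') := by
    intro h t h' t'
    have hs := N.K.one_add_s
    have e : s * ((if t = h ∧ t' = h' then 1 else 0) + N.K.D t t' * N.K.c h h') = (1 + s) ^ 2 *
      (s / (1 + s) ^ 2 * ((if t = h ∧ t' = h' then 1 else 0) + N.K.D t t' * N.K.c h h')) := by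
      field_simp
    rw [e, ← N.contract]
    simp only [Fintype.sum_prod_type, g, g', Option.elim, Finset.mul_sum]
    refine Finset.sum_congr rfl fun i _ => Finset.sum_congr rfl fun p _ =>
      Finset.sum_congr rfl fun j _ => Finset.sum_congr rfl fun q _ => ?_
    ring
  have e4 : ∑ w : ι × ι, ∑ w' : ι × ι, s • ((if w.2 = w.1 ∧ w'.2 = w'.1 then (1 : ℂ) else 0) •
      B (N.K.X k w.1 ∘ₗ N.K.pd k w.2) (N.K'.X l w'.1 ∘ₗ N.K'.pd l w'.2)) =
      s • (sNat s k * sNat s l) • B LinearMap.id LinearMap.id := by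
    simp only [← Finset.smul_sum]
    congr 1
    have h1 := N.K.sum_X_pd k
    have h2 := N.K'.sum_X_pd l
    rw [mul_smul, ← map_smul, ← LinearMap.smul_apply, ← map_smul, ← h1, ← h2]
    simp only [Fintype.sum_prod_type, ite_and, ite_smul, one_smul, zero_smul, map_sum,
      LinearMap.sum_apply, Finset.sum_ite_eq', Finset.mem_univ, if_true]
    simpa using Finset.sum_comm
  have e2 : ∑ w : ι × ι, (if w.2 = w.1 then (1 : ℂ) else 0) •
      B (N.K.X k w.1 ∘ₗ N.K.pd k w.2) LinearMap.id = sNat s k • B LinearMap.id LinearMap.id := by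
    have h1 := N.K.sum_X_pd k
    rw [← LinearMap.smul_apply, ← map_smul, ← h1]
    simp [Fintype.sum_prod_type, ite_smul]
  have e3 : ∑ w : ι × ι, (if w.2 = w.1 then (1 : ℂ) else 0) •
      B LinearMap.id (N.K'.X l w.1 ∘ₗ N.K'.pd l w.2) = sNat s l • B LinearMap.id LinearMap.id := by
    have h1 := N.K'.sum_X_pd l
    rw [← map_smul, ← h1]
    simp [Fintype.sum_prod_type, ite_smul]
  rw [hL, key, hR]
  simp only [Fintype.sum_option, c1, c2, c3, c4]
  have hU : U none = LinearMap.id := rfl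
  have hU' : U' none = LinearMap.id := rfl
  have hV : ∀ w, U (some w) = N.K.X k w.1 ∘ₗ N.K.pd k w.2 := fun _ => rfl
  have hV' : ∀ w, U' (some w) = N.K'.X l w.1 ∘ₗ N.K'.pd l w.2 := fun _ => rfl
  have hB : B LinearMap.id LinearMap.id = LinearMap.id := TensorProduct.map_id
  simp only [hU, hU', hV, hV', mul_smul, smul_add, add_smul, Finset.sum_add_distrib] at e4 ⊢
  simp only [← Finset.smul_sum, e2, e3] at e4 ⊢
  rw [e4, hB]
  rw [← sNat_clebsch N.K.s_ne_zero]
  module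

/-- Descent along the diagonal. By `con_ins` the hypothesis makes `x` an eigenvector of `ins ∘ con`
with a nonzero eigenvalue; applying `con` shows that `con x` satisfies the hypothesis one bidegree
lower with `j + 1` for `j`. Hence `con x = 0` by induction, and then `x = 0`. The case `j = 0` is
the injectivity of `ins`. -/
lemma ins_aux (k l j : ℕ) (x : N.K.T k ⊗[ℂ] N.K'.T l)
    (h : N.con k l (N.ins k l x) =
      -(s⁻¹ ^ (j + 1) * (sNat s j * sNat s (k + l + j + 2))) • x) : x = 0 := by
  induction k generalizing l j with
  | zero => exact TensorProduct.eq_zero_of_left x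
  | succ k ih =>
    cases l with
    | zero => exact TensorProduct.eq_zero_of_right x
    | succ l =>
      have hs := N.K.s_ne_zero
      have e := LinearMap.congr_fun (N.con_ins k l) x
      simp only [LinearMap.comp_apply, LinearMap.add_apply, LinearMap.smul_apply,
        LinearMap.id_apply] at e
      have key := sNat_mul_sNat s (k + l + 3) j
      have hc : N.ins k l (N.con k l x) = -(s⁻¹ ^ (j + 2) *
          (sNat s (j + 1) * sNat s (k + l + 3 + j))) • x := by
        have e2 : s • N.ins k l (N.con k l x) =
            -(sNat s (k + l + 3) / s + s⁻¹ ^ (j + 1) *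
              (sNat s j * sNat s (k + l + 3 + j + 1))) • x := by
          rw [h, add_comm ((sNat s (k + l + 3) / s) • x), ← sub_eq_iff_eq_add, ← sub_smul] at e
          rw [← e, show k + 1 + (l + 1) + j + 2 = k + l + 3 + j + 1 by ring]
          congr 1
          ring
        rw [← inv_smul_smul₀ hs (N.ins k l (N.con k l x)), e2, smul_smul, ← key]
        congr 1
        simp only [pow_succ, inv_pow]
        field_simp
      have hz : N.con k l x = 0 := by
        refine ih l (j + 1) (N.con k l x) ?_
        rw [hc, map_smul]
        congr 5
        ring
      rw [hz, map_zero, eq_comm] at hc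
      refine (smul_eq_zero.1 hc).resolve_left (neg_ne_zero.2 (mul_ne_zero ?_ (mul_ne_zero ?_ ?_)))
      · exact pow_ne_zero _ (inv_ne_zero hs)
      · exact N.K.sNat_ne_zero _
      · rw [show k + l + 3 + j = k + l + 2 + j + 1 by ring]
        exact N.K.sNat_ne_zero _

lemma ker_ins (k l : ℕ) : LinearMap.ker (N.ins k l) = ⊥ := by
  refine (Submodule.eq_bot_iff _).2 fun x hx => N.ins_aux k l 0 x ?_
  rw [LinearMap.mem_ker.1 hx, map_zero, sNat_zero]
  simp

/-- The quotient of the tensor product of the two quadratic algebras by the copairing, in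
bidegree `(k, l)`. -/
abbrev Q (k l : ℕ) : Type :=
  (N.K.T (k + 1) ⊗[ℂ] N.K'.T (l + 1)) ⧸ LinearMap.range (N.ins k l)

lemma finrank_Q (hι : Fintype.card ι = 3) (k l : ℕ) :
    2 * Module.finrank ℂ (N.Q k l) = (k + 1) * (l + 1) * (k + l + 2) := by
  have h1 := Submodule.finrank_quotient_add_finrank (LinearMap.range (N.ins k l))
  have h2 := (N.ins k l).finrank_range_add_finrank_ker
  rw [N.ker_ins, finrank_bot, add_zero, Module.finrank_tensorProduct] at h2
  rw [h2, Module.finrank_tensorProduct] at h1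
  have a1 := N.K.finrank_T hι k
  have a2 := N.K.finrank_T hι (k + 1)
  have b1 := N.K'.finrank_T hι l
  have b2 := N.K'.finrank_T hι (l + 1)
  zify at *
  have h3 := congrArg (4 * ·) h1
  simp only [mul_add] at h3
  have e1 : (4 : ℤ) * (Module.finrank ℂ (N.K.T k) * Module.finrank ℂ (N.K'.T l)) =
    (k * (k + 1)) * (l * (l + 1)) := by rw [← a1, ← b1]; ring
  have e2 : (4 : ℤ) * (Module.finrank ℂ (N.K.T (k + 1)) * Module.finrank ℂ (N.K'.T (l + 1))) =
    ((k + 1) * (k + 1 + 1)) * ((l + 1) * (l + 1 + 1)) := by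
    rw [← a2, ← b2]; ring
  rw [e1, e2] at h3
  change (2 : ℤ) * (Module.finrank ℂ (N.Q k l) : ℤ) = _
  linarith

end KoszulPair

/-! ### Universal property of the quadratic algebra. -/

namespace KoszulData

variable {ι : Type} [Fintype ι] [DecidableEq ι] {s : ℂ} (K : KoszulData ι s)

lemma sum_a_X_X (n : ℕ) (r : ι) (u : K.T n) :
    ∑ h, ∑ i, K.a r h i • K.X (n + 1) i (K.X n h u) = 0 := by
  have e := K.mul_diff n (Pi.single r u)
  have e2 : K.diff (K.mul n) (Pi.single r u) = fun i => ∑ h, K.a r h i • K.X n h u := by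
    ext i
    simp only [diff, LinearMap.comp_apply, mp_apply, mul_eq_sum, split, LinearMap.coe_mk,
      AddHom.coe_mk]
    refine Finset.sum_congr rfl fun h _ => ?_
    rw [Finset.sum_eq_single r]
    · simp
    · intro b _ hb
      simp [hb]
    · simp
  rw [e2, mul_eq_sum] at e
  simp only [map_sum, map_smul] at e
  rw [Finset.sum_comm]
  exact e

lemma T_induction {C : ∀ n, K.T (n + 1) → Prop} (one : C 0 (K.one 1))
    (zero : ∀ n, C n 0)
    (add : ∀ n u v, C n u → C n v → C n (u + v)) (smul : ∀ n (r : ℂ) u, C n u → C n (r • u))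
    (X : ∀ n i u, C n u → C (n + 1) (K.X (n + 1) i u)) (n : ℕ) (u : K.T (n + 1)) : C n u := by
  induction n with
  | zero =>
    obtain ⟨r, rfl⟩ := K.one.surjective u
    rw [← mul_one r, ← smul_eq_mul, map_smul]
    exact smul _ _ _ one
  | succ n ih =>
    obtain ⟨w, rfl⟩ := K.mul_surjective n u
    rw [mul_eq_sum]
    exact Finset.sum_induction _ (C (n + 1)) (add _) (zero _) fun i _ => X _ _ _ (ih _)

/-- The universal property of the sequence of graded pieces. -/
lemma exists_lift {Z : ℕ → Type*} [∀ n, AddCommGroup (Z n)] [∀ n, Module ℂ (Z n)]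
    (μ : ∀ n, ι → Z n →ₗ[ℂ] Z (n + 1))
    (hμ : ∀ n r z, ∑ h, ∑ i, K.a r h i • μ (n + 1) i (μ n h z) = 0) (z : Z 1) :
    ∃ f : ∀ n, K.T n →ₗ[ℂ] Z n, f 1 (K.one 1) = z ∧
      ∀ n i u, f (n + 1) (K.X n i u) = μ n i (f n u) := by
  -- Extending to the next degree needs the compatibility between the last two degrees, so
  -- consecutive pairs of maps are built together.
  let P : ℕ → Type _ := fun n => {p : (K.T n →ₗ[ℂ] Z n) × (K.T (n + 1) →ₗ[ℂ] Z (n + 1)) //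
    ∀ i u, p.2 (K.X n i u) = μ n i (p.1 u)}
  have step : ∀ n (p : P n), ∃ g : K.T (n + 2) →ₗ[ℂ] Z (n + 2),
      ∀ i u, g (K.X (n + 1) i u) = μ (n + 1) i (p.1.2 u) := by
    rintro n ⟨⟨f, f'⟩, h⟩
    let F : (ι → K.T (n + 1)) →ₗ[ℂ] Z (n + 2) :=
      ∑ i, μ (n + 1) i ∘ₗ f' ∘ₗ LinearMap.proj i
    have hF : LinearMap.ker (K.mul (n + 1)) ≤ LinearMap.ker F := by
      rw [K.ker_mul]
      rintro _ ⟨w, rfl⟩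
      rw [LinearMap.mem_ker]
      simp only [F, LinearMap.sum_apply, LinearMap.comp_apply, LinearMap.proj_apply, diff, mp_apply,
        mul_eq_sum, split, LinearMap.coe_mk, AddHom.coe_mk, map_sum, map_smul]
      simp only at h
      simp only [h]
      refine sum_swap₁.trans (sum_swap₂.trans (sum_swap₁.trans (sum_swap₂.trans
        (Finset.sum_eq_zero fun r _ => ?_))))
      rw [Finset.sum_comm]
      simpa using hμ n r (f (w r))
    refine ⟨(LinearMap.ker (K.mul (n + 1))).liftQ F hF ∘ₗ
      ((K.mul (n + 1)).quotKerEquivOfSurjective (K.mul_surjective n)).symm.toLinearMap, ?_⟩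
    intro i u
    have e : ((K.mul (n + 1)).quotKerEquivOfSurjective (K.mul_surjective n)).symm
        (K.X (n + 1) i u) = Submodule.Quotient.mk (Pi.single i u) := by
      rw [LinearEquiv.symm_apply_eq]
      rfl
    rw [LinearMap.comp_apply, LinearEquiv.coe_coe, e, Submodule.liftQ_apply]
    simp only [F, LinearMap.sum_apply, LinearMap.comp_apply, LinearMap.proj_apply]
    rw [Finset.sum_eq_single i]
    · simp
    · intro b _ hb
      simp [hb]
    · simp
  choose g hg using step
  let start : P 0 := ⟨⟨0, LinearMap.toSpanSingleton ℂ _ z ∘ₗ K.one.symm.toLinearMap⟩, by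
    intro i u
    rw [Subsingleton.elim u 0]
    simp⟩
  let seq : ∀ n, P n := fun n => Nat.rec start (fun n p => ⟨⟨p.1.2, g n p⟩, hg n p⟩) n
  refine ⟨fun n => (seq n).1.1, ?_, fun n i u => (seq n).2 i u⟩
  change (LinearMap.toSpanSingleton ℂ _ z ∘ₗ K.one.symm.toLinearMap) (K.one 1) = z
  simp

end KoszulData

/-! ### Exchange of the two quadratic algebras. -/

/-- A Koszul pair with an exchange map `τ : W ⊗ V → V ⊗ W` compatible with the relations. -/
structure BraidedPair (ι : Type) [Fintype ι] [DecidableEq ι] (s : ℂ) extends KoszulPair ι s where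
  τ : ι → ι → ι → ι → ℂ
  x : ℂ
  M₁ : ι → ι → ι → ι → ℂ
  M₂ : ι → ι → ι → ι → ℂ
  M₃ : ι → ι → ι → ℂ
  M₄ : ι → ι → ι → ℂ
  -- With the rule `y_p x_j ↦ ∑ τ p j h q x_h y_q`, carrying `x_j` leftwards through a relation
  -- among the `y`'s leaves a combination of such relations.
  τ_b : ∀ r j i q' q, ∑ p, ∑ p', ∑ h, K'.a r p p' * (τ p' h i q * τ p j h q') =
    ∑ t, M₁ r j i t * K'.a t q' q
  -- Likewise for a relation among the `x`'s carried through `y_p`.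
  τ_a : ∀ p t h k q', ∑ h', ∑ k', ∑ q, K.a t h' k' * (τ p h' h q * τ q k' k q') =
    ∑ r, K.a r h k * M₂ p t r q'
  -- In the algebra this reads `c x_k = x • x_k c`, the `M₃` terms being relations among the `x`'s.
  c_τ : ∀ h k i q, ∑ p, K.c h p * τ p k i q =
    (if h = k then x * K.c i q else 0) + ∑ r, K.a r h i * M₃ k q r
  -- In the algebra this reads `y_r c = x • c y_r`, the `M₄` terms being relations among the `y`'s.
  τ_c : ∀ r h q p, ∑ i, K.c i p * τ r i h q =
    (if p = r then x * K.c h q else 0) + ∑ t, M₄ r h t * K'.a t p q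

namespace BraidedPair

variable {ι : Type} [Fintype ι] [DecidableEq ι] {s : ℂ} (N : BraidedPair ι s)

/-- Right multiplication commutes with the left multiplications, so it is the lift of the latter
with initial value `y_p`. -/
lemma exists_right (p : ι) : ∃ f : ∀ n, N.K'.T n →ₗ[ℂ] N.K'.T (n + 1),
    f 1 (N.K'.one 1) = N.K'.X 1 p (N.K'.one 1) ∧
      ∀ n i u, f (n + 1) (N.K'.X n i u) = N.K'.X (n + 1) i (f n u) :=
  N.K'.exists_lift (Z := fun n => N.K'.T (n + 1)) (fun n i => N.K'.X (n + 1) i)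
    (fun n r z => N.K'.sum_a_X_X (n + 1) r z) _

/-- The right multiplication by `y_p` in the left quadratic algebra. -/
def R (n : ℕ) (p : ι) : N.K'.T n →ₗ[ℂ] N.K'.T (n + 1) := (N.exists_right p).choose n

lemma R_one (p : ι) : N.R 1 p (N.K'.one 1) = N.K'.X 1 p (N.K'.one 1) :=
  (N.exists_right p).choose_spec.1

lemma R_X (n : ℕ) (p i : ι) (u) : N.R (n + 1) p (N.K'.X n i u) = N.K'.X (n + 1) i (N.R n p u) :=
  (N.exists_right p).choose_spec.2 n i u

/-- The `i`-th component of the image of `u` is the coefficient of `x_i` when `u x_j` is rewritten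
with the `x`'s on the left. The relation `τ_b` makes this well defined. -/
lemma exists_exchange (j : ι) : ∃ f : ∀ n, N.K'.T n →ₗ[ℂ] (ι → N.K'.T n),
    f 1 (N.K'.one 1) = Pi.single j (N.K'.one 1) ∧
      ∀ n p u, f (n + 1) (N.K'.X n p u) =
        fun i => ∑ h, ∑ q, N.τ p h i q • N.K'.X n q (f n u h) := by
  let μ : ∀ n, ι → (ι → N.K'.T n) →ₗ[ℂ] (ι → N.K'.T (n + 1)) := fun n p =>
    LinearMap.pi fun i => ∑ h, ∑ q, N.τ p h i q • (N.K'.X n q ∘ₗ LinearMap.proj h)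
  have hμ' : ∀ n p v i, μ n p v i = ∑ h, ∑ q, N.τ p h i q • N.K'.X n q (v h) := by
    intro n p v i
    simp [μ, LinearMap.sum_apply]
  have hμ : ∀ n r z, ∑ h, ∑ i, N.K'.a r h i • μ (n + 1) i (μ n h z) = 0 := by
    intro n r z
    ext i
    simp only [Finset.sum_apply, Pi.smul_apply, hμ', map_sum, map_smul, Finset.smul_sum, smul_smul]
    refine (sum_block₃.trans (sum_congr₃
      (g := fun q j q' => ∑ t, (N.M₁ r j i t * N.K'.a t q' q) •
        N.K'.X (n + 1) q (N.K'.X n q' (z j))) fun q j q' => ?_)).trans ?_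
    · simp only [← Finset.sum_smul, N.τ_b]
    · refine sum_swap₁.trans (sum_swap₃.trans (sum_swap₂.trans (sum_swap₃.trans
        (Finset.sum_eq_zero fun j _ => Finset.sum_eq_zero fun t _ => ?_))))
      simp only [mul_smul, ← Finset.smul_sum, N.K'.sum_a_X_X, smul_zero]
  obtain ⟨f, h1, h2⟩ := N.K'.exists_lift μ hμ (Pi.single j (N.K'.one 1))
  refine ⟨f, h1, fun n p u => ?_⟩
  rw [h2]
  ext i
  exact hμ' _ _ _ _

/-- The components of the passage of `x_j` through the left quadratic algebra. -/
def Φ (n : ℕ) (j i : ι) : N.K'.T n →ₗ[ℂ] N.K'.T n :=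
  LinearMap.proj i ∘ₗ (N.exists_exchange j).choose n

lemma Φ_one (j i : ι) : N.Φ 1 j i (N.K'.one 1) = if j = i then N.K'.one 1 else 0 := by
  have := congrFun (N.exists_exchange j).choose_spec.1 i
  refine this.trans ?_
  simp [Pi.single_apply, eq_comm]

lemma Φ_X (n : ℕ) (j i p : ι) (u) : N.Φ (n + 1) j i (N.K'.X n p u) =
    ∑ h, ∑ q, N.τ p h i q • N.K'.X n q (N.Φ n j h u) :=
  congrFun ((N.exists_exchange j).choose_spec.2 n p u) i

lemma R_surj (n : ℕ) (u : N.K'.T (n + 2)) : ∃ v : ι → N.K'.T (n + 1), u = ∑ p, N.R (n + 1) p (v p) := by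
  obtain ⟨w, rfl⟩ := N.K'.mul_surjective n u
  rw [N.K'.mul_eq_sum]
  induction n with
  | zero =>
    refine ⟨w, Finset.sum_congr rfl fun p _ => ?_⟩
    obtain ⟨r, hr⟩ := N.K'.one.surjective (w p)
    rw [← hr, ← mul_one r, ← smul_eq_mul, map_smul, map_smul, map_smul, R_one]
  | succ n ih =>
    have : ∀ i, ∃ v : ι → N.K'.T (n + 1), w i = ∑ p, N.R (n + 1) p (v p) := by
      intro i
      obtain ⟨w', hw'⟩ := N.K'.mul_surjective n (w i)
      rw [← hw', N.K'.mul_eq_sum]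
      exact ih w'
    choose v hv using this
    refine ⟨fun p => ∑ i, N.K'.X (n + 1) i (v i p), ?_⟩
    simp only [hv, map_sum, R_X]
    exact Finset.sum_comm

lemma sum_a_R_R (n : ℕ) (r : ι) (u : N.K'.T (n + 1)) :
    ∑ p, ∑ q, N.K'.a r q p • N.R (n + 2) q (N.R (n + 1) p u) = 0 := by
  refine N.K'.T_induction (C := fun n u =>
    ∑ p, ∑ q, N.K'.a r q p • N.R (n + 2) q (N.R (n + 1) p u) = 0) ?_ ?_ ?_ ?_ ?_ n u
  · change ∑ p, ∑ q, N.K'.a r q p • N.R 2 q (N.R 1 p (N.K'.one 1)) = 0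
    simp only [R_one, R_X]
    exact Finset.sum_comm.trans (N.K'.sum_a_X_X 1 r (N.K'.one 1))
  · simp
  · intro n u v hu hv
    simp only [map_add, smul_add, Finset.sum_add_distrib, hu, hv, add_zero]
  · intro n c u hu
    simp only [map_smul, smul_comm _ c, ← Finset.smul_sum, hu, smul_zero]
  · intro n i u hu
    rw [← map_zero (N.K'.X (n + 3) i), ← hu]
    simp only [map_sum, map_smul, R_X]

/-- The coefficient of `x_h` in `u c = x ^ n • c u`, for `u` of degree `n`: each generator of `u`
crosses `c` by `τ_c` and contributes one factor `x`. -/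
lemma sum_c_R_Φ (n : ℕ) (h : ι) (u : N.K'.T (n + 1)) :
    ∑ i, ∑ p, N.K.c i p • N.R (n + 1) p (N.Φ (n + 1) i h u) =
      N.x ^ n • ∑ q, N.K.c h q • N.K'.X (n + 1) q u := by
  refine N.K'.T_induction (C := fun n u => ∀ h,
    ∑ i, ∑ p, N.K.c i p • N.R (n + 1) p (N.Φ (n + 1) i h u) =
      N.x ^ n • ∑ q, N.K.c h q • N.K'.X (n + 1) q u) ?_ ?_ ?_ ?_ ?_ n u h
  · intro h
    rw [Finset.sum_eq_single h]
    · simp [Φ_one, R_one]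
    · intro b _ hb
      simp [Φ_one, hb]
    · simp
  · simp
  · intro n u v hu hv h
    simp only [map_add, smul_add, Finset.sum_add_distrib, hu, hv]
  · intro n c u hu h
    simp only [map_smul, smul_comm _ c, ← Finset.smul_sum, hu]
  · intro n r u hu h
    simp only [Φ_X, map_sum, map_smul, R_X, Finset.smul_sum, smul_smul]
    have e : ∀ k q, ∑ i, ∑ p, (N.K.c i p * N.τ r k h q) •
        N.K'.X (n + 2) q (N.R (n + 1) p (N.Φ (n + 1) i k u)) =
        ∑ p, (N.x ^ n * (N.K.c k p * N.τ r k h q)) • N.K'.X (n + 2) q (N.K'.X (n + 1) p u) := by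
      intro k q
      have := congrArg (fun v => N.τ r k h q • N.K'.X (n + 2) q v) (hu k)
      simp only [map_sum, map_smul, Finset.smul_sum, smul_smul] at this
      refine Eq.trans ?_ (this.trans ?_)
      · exact sum_congr₂ fun i p => by rw [mul_comm]
      · exact Finset.sum_congr rfl fun p _ => by congr 1; ring
    refine sum_block₂.trans ((sum_congr₂ e).trans (sum_swap₁.trans (sum_swap₂.trans ?_)))
    simp only [← Finset.sum_smul, ← Finset.mul_sum, N.τ_c, mul_add, add_smul,
      Finset.sum_add_distrib]
    have e2 : ∑ q, ∑ p, (N.x ^ n * ∑ t, N.M₄ r h t * N.K'.a t p q) •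
        N.K'.X (n + 2) q (N.K'.X (n + 1) p u) = 0 := by
      simp only [Finset.mul_sum, Finset.sum_smul]
      refine sum_swap₂.trans (sum_swap₁.trans (Finset.sum_eq_zero fun t _ => ?_))
      rw [Finset.sum_comm]
      simp only [← mul_assoc, mul_smul _ (N.K'.a t _ _), ← Finset.smul_sum, N.K'.sum_a_X_X,
        smul_zero]
    refine (congrArg₂ _ ?_ e2).trans (add_zero _)
    refine Finset.sum_congr rfl fun q _ => ?_
    rw [Finset.sum_eq_single r]
    · rw [if_pos rfl, pow_succ, mul_assoc]
    · intro b _ hb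
      simp [hb]
    · simp

/-- `Φ` is defined by peeling generators off on the left; this peels one off on the right, as the
action of `x_j` after `y_p` requires. -/
lemma Φ_R (n : ℕ) (p j i : ι) (u : N.K'.T (n + 1)) :
    N.Φ (n + 2) j i (N.R (n + 1) p u) =
      ∑ h, ∑ q, N.τ p j h q • N.R (n + 1) q (N.Φ (n + 1) h i u) := by
  refine N.K'.T_induction (C := fun n u => ∀ i, N.Φ (n + 2) j i (N.R (n + 1) p u) =
      ∑ h, ∑ q, N.τ p j h q • N.R (n + 1) q (N.Φ (n + 1) h i u)) ?_ ?_ ?_ ?_ ?_ n u i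
  · intro i
    change N.Φ 2 j i (N.R 1 p (N.K'.one 1)) =
      ∑ h, ∑ q, N.τ p j h q • N.R 1 q (N.Φ 1 h i (N.K'.one 1))
    rw [R_one, Φ_X]
    simp [Φ_one, map_ite_zero, R_one]
  · simp
  · intro n u v hu hv h
    simp only [map_add, smul_add, Finset.sum_add_distrib, hu, hv]
  · intro n c u hu h
    simp only [map_smul, smul_comm _ c, ← Finset.smul_sum, hu]
  · intro n r u hu i
    simp only [R_X, Φ_X, hu, map_sum, map_smul, Finset.smul_sum, smul_smul]
    refine sum_swap₂.trans (sum_swap₁.trans (sum_swap₃.trans (sum_swap₂.trans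
      (sum_congr₄ fun h q h' q' => ?_))))
    rw [mul_comm]

/-- A relation among the `x`'s carried through `u` remains a combination of relations, by repeated
use of `τ_a`; `v` collects the coefficients, which the action needs only to exist. -/
lemma sum_a_Φ_Φ (n : ℕ) (r : ι) (u : N.K'.T (n + 1)) :
    ∃ v : ι → N.K'.T (n + 1), ∀ h k,
      ∑ i, ∑ j, N.K.a r i j • N.Φ (n + 1) j k (N.Φ (n + 1) i h u) =
        ∑ t, N.K.a t h k • v t := by
  refine N.K'.T_induction (C := fun n u => ∃ v : ι → N.K'.T (n + 1), ∀ h k,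
      ∑ i, ∑ j, N.K.a r i j • N.Φ (n + 1) j k (N.Φ (n + 1) i h u) =
        ∑ t, N.K.a t h k • v t) ?_ ?_ ?_ ?_ ?_ n u
  · refine ⟨Pi.single r (N.K'.one 1), fun h k => ?_⟩
    rw [Finset.sum_eq_single h, Finset.sum_eq_single k, Finset.sum_eq_single r]
    · simp [Φ_one]
    · intro b _ hb
      simp [hb]
    · simp
    · intro b _ hb
      simp [Φ_one, hb]
    · simp
    · intro b _ hb
      simp [Φ_one, hb]
    · simp
  · exact fun n => ⟨0, by simp⟩
  · rintro n u u' ⟨v, hv⟩ ⟨v', hv'⟩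
    refine ⟨v + v', fun h k => ?_⟩
    simp only [map_add, smul_add, Finset.sum_add_distrib, hv, hv', Pi.add_apply]
  · rintro n c u ⟨v, hv⟩
    refine ⟨c • v, fun h k => ?_⟩
    simp only [map_smul, smul_comm _ c, ← Finset.smul_sum, hv, Pi.smul_apply]
  · rintro n p u ⟨v, hv⟩
    refine ⟨fun t => ∑ t', ∑ q', N.M₂ p t' t q' • N.K'.X (n + 1) q' (v t'), fun h k => ?_⟩
    simp only [Φ_X, map_sum, map_smul, Finset.smul_sum, smul_smul]
    have e : ∀ h' q k' q', ∑ i, ∑ j, (N.K.a r i j * (N.τ p h' h q * N.τ q k' k q')) •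
        N.K'.X (n + 1) q' (N.Φ (n + 1) j k' (N.Φ (n + 1) i h' u)) =
        ∑ t, (N.K.a t h' k' * (N.τ p h' h q * N.τ q k' k q')) • N.K'.X (n + 1) q' (v t) := by
      intro h' q k' q'
      have := congrArg (fun v => (N.τ p h' h q * N.τ q k' k q') • N.K'.X (n + 1) q' v) (hv h' k')
      simp only [map_sum, map_smul, Finset.smul_sum, smul_smul] at this
      refine Eq.trans ?_ (this.trans ?_)
      · exact sum_congr₂ fun i p => by rw [mul_comm]
      · exact Finset.sum_congr rfl fun p _ => by rw [mul_comm]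
    refine sum_block₂.trans ((sum_congr₂ fun h' q => sum_block₂.trans
      (sum_congr₂ fun k' q' => e h' q k' q')).trans (sum_swap₂.trans (sum_front₃.trans ?_)))
    refine (Finset.sum_congr rfl fun q' _ => sum_front₃).trans ?_
    simp only [← Finset.sum_smul, N.τ_a]
    simp only [Finset.sum_smul]
    exact sum_swap₂.trans (sum_swap₁.trans sum_swap₂)

end BraidedPair

/-! ### Right action of the generators on the quotients `Q k l`. -/

namespace BraidedPair

variable {ι : Type} [Fintype ι] [DecidableEq ι] {s : ℂ} (N : BraidedPair ι s)

/-- The right action of `x_j` on the tensor product of the two quadratic algebras. -/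
def preX (k l : ℕ) (j : ι) :
    N.K.T k ⊗[ℂ] N.K'.T l →ₗ[ℂ] N.K.T (k + 1) ⊗[ℂ] N.K'.T l :=
  ∑ i, TensorProduct.map (N.K.X k i) (N.Φ l j i)

/-- The right action of `y_p` on the tensor product of the two quadratic algebras. -/
def preY (k l : ℕ) (p : ι) :
    N.K.T k ⊗[ℂ] N.K'.T l →ₗ[ℂ] N.K.T k ⊗[ℂ] N.K'.T (l + 1) :=
  TensorProduct.map LinearMap.id (N.R l p)

lemma preX_tmul (k l : ℕ) (j : ι) (u v) :
    N.preX k l j (u ⊗ₜ v) = ∑ i, N.K.X k i u ⊗ₜ N.Φ l j i v := by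
  simp [preX, LinearMap.sum_apply]

lemma preY_tmul (k l : ℕ) (p : ι) (u v) : N.preY k l p (u ⊗ₜ v) = u ⊗ₜ N.R l p v := rfl

lemma ins_tmul (k l : ℕ) (u v) :
    N.ins k l (u ⊗ₜ v) = ∑ i, ∑ p, N.K.c i p • (N.K.X k i u ⊗ₜ[ℂ] N.K'.X l p v) := by
  simp [KoszulPair.ins, LinearMap.sum_apply]

/-- This is `c x_j = x • x_j c` modulo the relations among the `x`'s; the `M₃` terms die in the
right quadratic algebra. -/
lemma preX_ins (k' l : ℕ) (j : ι) :
    N.preX (k' + 1) (l + 1) j ∘ₗ N.ins k' l = N.x • (N.ins (k' + 1) l ∘ₗ N.preX k' l j) := by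
  refine TensorProduct.ext' fun u v => ?_
  simp only [LinearMap.comp_apply, LinearMap.smul_apply, ins_tmul, preX_tmul, map_sum, map_smul,
    Φ_X, Finset.smul_sum, smul_smul, TensorProduct.tmul_sum, TensorProduct.tmul_smul]
  refine (sum_swap₂.trans (sum_swap₃.trans (sum_congr₃
    (g := fun h i k => ∑ q, (∑ p, N.K.c h p * N.τ p k i q) •
      N.K.X (k' + 1) i (N.K.X k' h u) ⊗ₜ[ℂ] N.K'.X l q (N.Φ l j k v)) fun h i k => ?_))).trans ?_
  · rw [Finset.sum_comm]
    simp only [Finset.sum_smul]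
  simp only [N.c_τ, add_smul, Finset.sum_add_distrib]
  have e2 : ∑ h, ∑ i, ∑ k, ∑ q, (∑ r, N.K.a r h i * N.M₃ k q r) •
      N.K.X (k' + 1) i (N.K.X k' h u) ⊗ₜ[ℂ] N.K'.X l q (N.Φ l j k v) = 0 := by
    simp only [Finset.sum_smul]
    refine sum_block₂.trans (Finset.sum_eq_zero fun k _ => Finset.sum_eq_zero fun q _ =>
      sum_swap₂.trans (sum_swap₁.trans (Finset.sum_eq_zero fun r _ => ?_)))
    simp only [mul_comm (N.K.a _ _ _), mul_smul, ← Finset.smul_sum, TensorProduct.smul_tmul',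
      ← TensorProduct.sum_tmul, N.K.sum_a_X_X, TensorProduct.zero_tmul, smul_zero]
  refine (congrArg₂ _ ?_ e2).trans (add_zero _)
  refine sum_congr₂ fun h i => ?_
  rw [Finset.sum_eq_single h]
  · simp
  · intro b _ hb
    simp [hb.symm]
  · simp

lemma preY_ins (k l : ℕ) (p : ι) :
    N.preY (k + 1) (l + 1) p ∘ₗ N.ins k l = N.ins k (l + 1) ∘ₗ N.preY k l p := by
  refine TensorProduct.ext' fun u v => ?_
  simp only [LinearMap.comp_apply, ins_tmul, preY_tmul, map_sum, map_smul, R_X]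

/-- The right action of `x_j` on the spaces `Q k l`. -/
def opX (k l : ℕ) (j : ι) : N.Q k l →ₗ[ℂ] N.Q (k + 1) l :=
  Submodule.mapQ _ _ (N.preX (k + 1) (l + 1) j) <| by
    rintro _ ⟨z, rfl⟩
    exact ⟨N.x • N.preX k l j z, by
      rw [map_smul]; exact (LinearMap.congr_fun (N.preX_ins k l j) z).symm⟩

/-- The right action of `y_p` on the spaces `Q k l`. -/
def opY (k l : ℕ) (p : ι) : N.Q k l →ₗ[ℂ] N.Q k (l + 1) :=
  Submodule.mapQ _ _ (N.preY (k + 1) (l + 1) p) <| by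
    rintro _ ⟨z, rfl⟩
    exact ⟨N.preY k l p z, (LinearMap.congr_fun (N.preY_ins k l p) z).symm⟩

/-- The class of an element of the tensor product. -/
abbrev mkQ (k l : ℕ) : N.K.T (k + 1) ⊗[ℂ] N.K'.T (l + 1) →ₗ[ℂ] N.Q k l := Submodule.mkQ _

lemma opX_mk (k l : ℕ) (j : ι) (z) :
    N.opX k l j (N.mkQ k l z) = N.mkQ (k + 1) l (N.preX (k + 1) (l + 1) j z) := rfl

lemma opY_mk (k l : ℕ) (p : ι) (z) :
    N.opY k l p (N.mkQ k l z) = N.mkQ k (l + 1) (N.preY (k + 1) (l + 1) p z) := rfl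

lemma mk_ins (k l : ℕ) (z) : N.mkQ k l (N.ins k l z) = 0 := by
  simp [mkQ]

lemma hom_ext_Q {k l : ℕ} {M : Type*} [AddCommGroup M] [Module ℂ M] {f g : N.Q k l →ₗ[ℂ] M}
    (h : ∀ u v, f (N.mkQ k l (u ⊗ₜ v)) = g (N.mkQ k l (u ⊗ₜ v))) : f = g :=
  Submodule.linearMap_qext _ (TensorProduct.ext' h)

lemma sum_a_opX_opX (k l : ℕ) (r : ι) (z : N.Q k l) :
    ∑ i, ∑ j, N.K.a r i j • N.opX (k + 1) l j (N.opX k l i z) = 0 := by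
  suffices h : ∑ i, ∑ j, N.K.a r i j • (N.opX (k + 1) l j ∘ₗ N.opX k l i) = 0 by
    simpa [LinearMap.sum_apply] using LinearMap.congr_fun h z
  refine N.hom_ext_Q fun u v => ?_
  obtain ⟨w, hw⟩ := N.sum_a_Φ_Φ l r v
  simp only [LinearMap.sum_apply, LinearMap.smul_apply, LinearMap.comp_apply, opX_mk, preX_tmul,
    map_sum, LinearMap.zero_apply]
  simp only [← map_sum (N.mkQ _ _), ← map_smul (N.mkQ _ _)]
  refine (congrArg (N.mkQ _ _) ?_).trans (map_zero _)
  simp only [Finset.smul_sum, ← TensorProduct.tmul_smul]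
  refine sum_block₂.trans ?_
  simp only [← TensorProduct.tmul_sum, hw]
  simp only [TensorProduct.tmul_sum, TensorProduct.tmul_smul]
  refine sum_swap₂.trans (sum_swap₁.trans (Finset.sum_eq_zero fun t _ => ?_))
  have := N.K.sum_a_X_X (k + 1) t u
  have e := congrArg (fun z => z ⊗ₜ[ℂ] w t) this
  simpa only [TensorProduct.sum_tmul, TensorProduct.smul_tmul', TensorProduct.zero_tmul] using e

lemma sum_b_opY_opY (k l : ℕ) (r : ι) (z : N.Q k l) :
    ∑ p, ∑ q, N.K'.a r q p • N.opY k (l + 1) q (N.opY k l p z) = 0 := by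
  suffices h : ∑ p, ∑ q, N.K'.a r q p • (N.opY k (l + 1) q ∘ₗ N.opY k l p) = 0 by
    simpa [LinearMap.sum_apply] using LinearMap.congr_fun h z
  refine N.hom_ext_Q fun u v => ?_
  simp only [LinearMap.sum_apply, LinearMap.smul_apply, LinearMap.comp_apply, opY_mk, preY_tmul,
    LinearMap.zero_apply]
  simp only [← map_sum (N.mkQ _ _), ← map_smul (N.mkQ _ _), ← TensorProduct.tmul_smul,
    ← TensorProduct.tmul_sum, N.sum_a_R_R, TensorProduct.tmul_zero, map_zero]

/-- By `sum_c_R_Φ`, acting by `c` on `u ⊗ v` amounts to inserting `x ^ l • c` between `u` and `v`,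
which is zero in the quotient. -/
lemma sum_c_opY_opX (k l : ℕ) (z : N.Q k l) :
    ∑ i, ∑ p, N.K.c i p • N.opY (k + 1) l p (N.opX k l i z) = 0 := by
  suffices h : ∑ i, ∑ p, N.K.c i p • (N.opY (k + 1) l p ∘ₗ N.opX k l i) = 0 by
    simpa [LinearMap.sum_apply] using LinearMap.congr_fun h z
  refine N.hom_ext_Q fun u v => ?_
  simp only [LinearMap.sum_apply, LinearMap.smul_apply, LinearMap.comp_apply, opX_mk, opY_mk,
    preX_tmul, preY_tmul, map_sum, LinearMap.zero_apply]
  simp only [← map_sum (N.mkQ _ _), ← map_smul (N.mkQ _ _)]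
  refine Eq.trans ?_ (N.mk_ins (k + 1) (l + 1) (N.x ^ l • (u ⊗ₜ v)))
  rw [map_smul, ins_tmul]
  congr 1
  simp only [Finset.smul_sum, ← TensorProduct.tmul_smul]
  refine sum_swap₂.trans (sum_swap₁.trans (Finset.sum_congr rfl fun h _ => ?_))
  simp only [← TensorProduct.tmul_sum, N.sum_c_R_Φ, Finset.smul_sum]

lemma opX_opY (k l : ℕ) (p j : ι) (z : N.Q k l) :
    N.opX k (l + 1) j (N.opY k l p z) =
      ∑ h, ∑ q, N.τ p j h q • N.opY (k + 1) l q (N.opX k l h z) := by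
  suffices H : N.opX k (l + 1) j ∘ₗ N.opY k l p =
      ∑ h, ∑ q, N.τ p j h q • (N.opY (k + 1) l q ∘ₗ N.opX k l h) by
    simpa [LinearMap.sum_apply] using LinearMap.congr_fun H z
  refine N.hom_ext_Q fun u v => ?_
  simp only [LinearMap.sum_apply, LinearMap.smul_apply, LinearMap.comp_apply, opX_mk, opY_mk,
    preX_tmul, preY_tmul, map_sum, Φ_R]
  simp only [← map_sum (N.mkQ _ _), ← map_smul (N.mkQ _ _)]
  congr 1
  simp only [Finset.smul_sum, ← TensorProduct.tmul_smul, TensorProduct.tmul_sum]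
  exact sum_swap₁.trans sum_swap₂

end BraidedPair

/-! ### Spanning by ordered monomials, and the total representation. -/

namespace BraidedPair

variable {ι : Type} [Fintype ι] [DecidableEq ι] {s : ℂ} (N : BraidedPair ι s)

/-- The defining relations, satisfied by two families of elements of an algebra. -/
structure Rels {E : Type*} [Ring E] [Algebra ℂ E] (X Y : ι → E) : Prop where
  XX : ∀ r, ∑ i, ∑ j, N.K.a r i j • (X i * X j) = 0
  YY : ∀ r, ∑ p, ∑ q, N.K'.a r q p • (Y p * Y q) = 0
  XY : ∑ i, ∑ p, N.K.c i p • (X i * Y p) = 0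
  YX : ∀ p j, Y p * X j = ∑ h, ∑ q, N.τ p j h q • (X h * Y q)

section Upper

variable {E : Type*} [Ring E] [Algebra ℂ E]

/-- The products `f u * g v` kill the inserted copairing, hence factor through `Q k l`. Their spans
are stable under right multiplication by `X j`, because `g v * X j` can be reordered as in `g_Φ`,
and by `Y p` through `R`. Starting from `1`, they therefore contain every monomial. -/
lemma exists_monomials {X Y : ι → E} (hR : N.Rels X Y) :
    ∃ S : ∀ k l, N.Q k l →ₗ[ℂ] E, (1 : E) ∈ LinearMap.range (S 0 0) ∧
      (∀ k l j z, z ∈ LinearMap.range (S k l) → z * X j ∈ LinearMap.range (S (k + 1) l)) ∧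
      ∀ k l p z, z ∈ LinearMap.range (S k l) → z * Y p ∈ LinearMap.range (S k (l + 1)) := by
  obtain ⟨f, f_one, f_X⟩ := N.K.exists_lift (Z := fun _ : ℕ => E)
    (fun _ i => LinearMap.mulRight ℂ (X i)) (fun n r z => by
      refine Eq.trans ?_ ((congrArg (z * ·) (hR.XX r)).trans (mul_zero z))
      simp only [LinearMap.mulRight_apply, mul_assoc, mul_smul_comm, Finset.mul_sum]) 1
  obtain ⟨g, g_one, g_X⟩ := N.K'.exists_lift (Z := fun _ : ℕ => E)
    (fun _ p => LinearMap.mulLeft ℂ (Y p)) (fun n r z => by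
      refine Eq.trans ?_ ((congrArg (· * z) (hR.YY r)).trans (zero_mul z))
      rw [Finset.sum_comm]
      simp only [LinearMap.mulLeft_apply, mul_assoc, smul_mul_assoc, Finset.sum_mul]) 1
  simp only [LinearMap.mulRight_apply] at f_X
  simp only [LinearMap.mulLeft_apply] at g_X
  have g_R : ∀ n p (v : N.K'.T (n + 1)), g (n + 2) (N.R (n + 1) p v) = g (n + 1) v * Y p := by
    intro n p v
    refine N.K'.T_induction
      (C := fun n v => g (n + 2) (N.R (n + 1) p v) = g (n + 1) v * Y p) ?_ ?_ ?_ ?_ ?_ n v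
    · change g 2 (N.R 1 p (N.K'.one 1)) = g 1 (N.K'.one 1) * Y p
      rw [R_one, g_X, g_one, mul_one, one_mul]
    · simp
    · intro n u v hu hv
      simp only [map_add, hu, hv, add_mul]
    · intro n c u hu
      simp only [map_smul, hu, smul_mul_assoc]
    · intro n i u hu
      simp only [R_X, g_X, hu, mul_assoc]
  have g_Φ : ∀ n j (v : N.K'.T (n + 1)), g (n + 1) v * X j = ∑ i, X i * g (n + 1) (N.Φ (n + 1) j i v) := by
    intro n j v
    refine N.K'.T_induction
      (C := fun n v => g (n + 1) v * X j = ∑ i, X i * g (n + 1) (N.Φ (n + 1) j i v))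
      ?_ ?_ ?_ ?_ ?_ n v
    · change g 1 (N.K'.one 1) * X j = ∑ i, X i * g 1 (N.Φ 1 j i (N.K'.one 1))
      simp [Φ_one, map_ite_zero, g_one]
    · simp
    · intro n u v hu hv
      simp only [map_add, hu, hv, add_mul, mul_add, Finset.sum_add_distrib]
    · intro n c u hu
      simp only [map_smul, hu, smul_mul_assoc, mul_smul_comm, Finset.smul_sum]
    · intro n p u hu
      simp only [g_X, mul_assoc, hu, Finset.mul_sum, Φ_X, map_sum, map_smul]
      simp only [← mul_assoc, hR.YX, Finset.sum_mul, smul_mul_assoc, mul_smul_comm]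
      exact sum_swap₁
  let θ : ∀ k l, N.K.T k ⊗[ℂ] N.K'.T l →ₗ[ℂ] E := fun k l => mulMap (f k) (g l)
  have θ_tmul : ∀ k l u v, θ k l (u ⊗ₜ v) = f k u * g l v := fun k l u v => by simp [θ, mulMap]
  have θ_ins : ∀ k l, LinearMap.range (N.ins k l) ≤ LinearMap.ker (θ (k + 1) (l + 1)) := by
    rintro k l _ ⟨z, rfl⟩
    rw [LinearMap.mem_ker, ← LinearMap.comp_apply]
    suffices h : θ (k + 1) (l + 1) ∘ₗ N.ins k l = 0 by rw [h]; rfl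
    refine TensorProduct.ext' fun u v => ?_
    simp only [LinearMap.comp_apply, ins_tmul, map_sum, map_smul, θ_tmul, f_X, g_X,
      LinearMap.zero_apply]
    have : ∀ i p, N.K.c i p • (f k u * X i * (Y p * g l v)) =
        f k u * (N.K.c i p • (X i * Y p)) * g l v := fun i p => by
      rw [mul_smul_comm, smul_mul_assoc]
      simp only [mul_assoc]
    simp only [this, ← Finset.sum_mul, ← Finset.mul_sum, hR.XY, mul_zero, zero_mul]
  let S : ∀ k l, N.Q k l →ₗ[ℂ] E := fun k l => Submodule.liftQ _ (θ (k + 1) (l + 1)) (θ_ins k l)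
  have S_mk : ∀ k l z, S k l (N.mkQ k l z) = θ (k + 1) (l + 1) z := fun k l z => rfl
  have mem : ∀ k l (P : Submodule ℂ E), (∀ u v, f (k + 1) u * g (l + 1) v ∈ P) →
      ∀ z ∈ LinearMap.range (S k l), z ∈ P := by
    rintro k l P hP _ ⟨w, rfl⟩
    obtain ⟨w, rfl⟩ := Submodule.mkQ_surjective _ w
    change θ (k + 1) (l + 1) w ∈ P
    induction w using TensorProduct.induction_on with
    | zero => rw [map_zero]; exact P.zero_mem
    | tmul u v => rw [θ_tmul]; exact hP u v
    | add a b ha hb => rw [map_add]; exact P.add_mem ha hb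
  have mem' : ∀ k l u v, f (k + 1) u * g (l + 1) v ∈ LinearMap.range (S k l) :=
    fun k l u v => ⟨N.mkQ k l (u ⊗ₜ v), by rw [S_mk, θ_tmul]⟩
  refine ⟨S, ?_, fun k l j => ?_, fun k l p => ?_⟩
  · have := mem' 0 0 (N.K.one 1) (N.K'.one 1)
    rwa [f_one, g_one, mul_one] at this
  · refine mem k l ((LinearMap.range (S (k + 1) l)).comap (LinearMap.mulRight ℂ (X j)))
      fun u v => ?_
    change f (k + 1) u * g (l + 1) v * X j ∈ LinearMap.range (S (k + 1) l)
    rw [mul_assoc, g_Φ, Finset.mul_sum]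
    refine Submodule.sum_mem _ fun i _ => ?_
    rw [← mul_assoc, ← f_X]
    exact mem' _ _ _ _
  · refine mem k l ((LinearMap.range (S k (l + 1))).comap (LinearMap.mulRight ℂ (Y p)))
      fun u v => ?_
    change f (k + 1) u * g (l + 1) v * Y p ∈ LinearMap.range (S k (l + 1))
    rw [mul_assoc, ← g_R]
    exact mem' _ _ _ _

end Upper

/-- The product of all the spaces `Q k l`. -/
abbrev Tot : Type := ∀ k l, N.Q k l

/-- The components of the action of `x_j`. -/
def shiftX (j : ι) : ∀ k l, N.Tot →ₗ[ℂ] N.Q k l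
  | 0, _ => 0
  | k + 1, l => N.opX k l j ∘ₗ LinearMap.proj l ∘ₗ LinearMap.proj k

/-- The components of the action of `y_p`. -/
def shiftY (p : ι) : ∀ k l, N.Tot →ₗ[ℂ] N.Q k l
  | _, 0 => 0
  | k, l + 1 => N.opY k l p ∘ₗ LinearMap.proj l ∘ₗ LinearMap.proj k

/-- The right action of `x_j` on `Tot`. -/
def totX (j : ι) : Module.End ℂ N.Tot := LinearMap.pi fun k => LinearMap.pi fun l => N.shiftX j k l

/-- The right action of `y_p` on `Tot`. -/
def totY (p : ι) : Module.End ℂ N.Tot := LinearMap.pi fun k => LinearMap.pi fun l => N.shiftY p k l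

lemma totX_zero (j : ι) (f : N.Tot) (l : ℕ) : N.totX j f 0 l = 0 := rfl

lemma totX_succ (j : ι) (f : N.Tot) (k l : ℕ) : N.totX j f (k + 1) l = N.opX k l j (f k l) := rfl

lemma totY_zero (p : ι) (f : N.Tot) (k : ℕ) : N.totY p f k 0 = 0 := rfl

lemma totY_succ (p : ι) (f : N.Tot) (k l : ℕ) : N.totY p f k (l + 1) = N.opY k l p (f k l) := rfl

/-- The action is from the right, so the relations hold in the opposite endomorphism algebra. Low
degrees are separate because the shift operators vanish at the boundary. -/
lemma rels_op : N.Rels (fun i => MulOpposite.op (N.totX i)) (fun p => MulOpposite.op (N.totY p)) where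
  XX r := by
    simp only [← MulOpposite.op_mul, ← MulOpposite.op_smul, ← Finset.op_sum,
      MulOpposite.op_eq_zero_iff]
    ext1 f
    funext k l
    simp only [LinearMap.sum_apply, LinearMap.smul_apply, Module.End.mul_apply, Finset.sum_apply,
      Pi.smul_apply, LinearMap.zero_apply, Pi.zero_apply]
    match k with
    | 0 => simp [totX_zero]
    | 1 => simp [totX_succ, totX_zero]
    | k + 2 => simpa only [totX_succ] using N.sum_a_opX_opX k l r (f k l)
  YY r := by
    simp only [← MulOpposite.op_mul, ← MulOpposite.op_smul, ← Finset.op_sum,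
      MulOpposite.op_eq_zero_iff]
    ext1 f
    funext k l
    simp only [LinearMap.sum_apply, LinearMap.smul_apply, Module.End.mul_apply, Finset.sum_apply,
      Pi.smul_apply, LinearMap.zero_apply, Pi.zero_apply]
    match l with
    | 0 => simp [totY_zero]
    | 1 => simp [totY_succ, totY_zero]
    | l + 2 => simpa only [totY_succ] using N.sum_b_opY_opY k l r (f k l)
  XY := by
    simp only [← MulOpposite.op_mul, ← MulOpposite.op_smul, ← Finset.op_sum,
      MulOpposite.op_eq_zero_iff]
    ext1 f
    funext k l
    simp only [LinearMap.sum_apply, LinearMap.smul_apply, Module.End.mul_apply, Finset.sum_apply,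
      Pi.smul_apply, LinearMap.zero_apply, Pi.zero_apply]
    match k, l with
    | _, 0 => simp [totY_zero]
    | 0, l + 1 => simp [totY_succ, totX_zero]
    | k + 1, l + 1 => simpa only [totX_succ, totY_succ] using N.sum_c_opY_opX k l (f k l)
  YX p j := by
    simp only [← MulOpposite.op_mul, ← MulOpposite.op_smul, ← Finset.op_sum]
    congr 1
    ext1 f
    funext k l
    simp only [LinearMap.sum_apply, LinearMap.smul_apply, Module.End.mul_apply, Finset.sum_apply,
      Pi.smul_apply]
    match k, l with
    | 0, 0 => simp [totY_zero, totX_zero]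
    | 0, l + 1 => simp [totY_succ, totX_zero]
    | k + 1, 0 => simp [totY_zero, totX_succ]
    | k + 1, l + 1 => simpa only [totX_succ, totY_succ] using N.opX_opY k l p j (f k l)

/-- The vacuum vector. -/
def vac : N.Tot := Pi.single 0 (Pi.single 0 (N.mkQ 0 0 (N.K.one 1 ⊗ₜ N.K'.one 1)))

end BraidedPair

/-! ### Generators and relations in the tensor algebra. -/

section Generators

variable {V W : Type*} [AddCommGroup V] [Module ℂ V] [AddCommGroup W] [Module ℂ W]

lemma mulMap_tmul {X Y T : Type*} [AddCommGroup X] [Module ℂ X] [AddCommGroup Y] [Module ℂ Y]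
    [Ring T] [Algebra ℂ T] (f : X →ₗ[ℂ] T) (g : Y →ₗ[ℂ] T) (x : X) (y : Y) :
    mulMap f g (x ⊗ₜ y) = f x * g y := by
  simp [mulMap]

lemma image_subset_ker_iff {R E X : Type*} [Ring R] [Algebra ℂ R] [Ring E] [Algebra ℂ E]
    [AddCommGroup X] [Module ℂ X] (φ : R →ₐ[ℂ] E) (S : Submodule ℂ X) (m : X →ₗ[ℂ] R) :
    m '' S ⊆ (TwoSidedIdeal.ker φ : Set R) ↔ S ≤ LinearMap.ker (φ.toLinearMap ∘ₗ m) := by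
  rw [Set.image_subset_iff]
  exact forall₂_congr fun z _ => TwoSidedIdeal.mem_ker φ

lemma quadraticIdeal_le_ker_iff {E : Type*} [Ring E] [Algebra ℂ E]
    (φ : TensorAlgebra ℂ (V × W) →ₐ[ℂ] E)
    (RVV : Submodule ℂ (V ⊗[ℂ] V)) (RWW : Submodule ℂ (W ⊗[ℂ] W))
    (RVW : Submodule ℂ (V ⊗[ℂ] W)) (T : W ⊗[ℂ] V →ₗ[ℂ] V ⊗[ℂ] W) :
    quadraticIdeal RVV RWW RVW T ≤ TwoSidedIdeal.ker φ ↔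
      (RVV ≤ LinearMap.ker (φ.toLinearMap ∘ₗ mulMap (genV V W) (genV V W)) ∧
        RWW ≤ LinearMap.ker (φ.toLinearMap ∘ₗ mulMap (genW V W) (genW V W)) ∧
        RVW ≤ LinearMap.ker (φ.toLinearMap ∘ₗ mulMap (genV V W) (genW V W))) ∧
        φ.toLinearMap ∘ₗ (mulMap (genW V W) (genV V W) + mulMap (genV V W) (genW V W) ∘ₗ T) = 0 := by
  rw [quadraticIdeal, TwoSidedIdeal.span_le, Set.union_subset_iff, Set.union_subset_iff,
    Set.union_subset_iff, image_subset_ker_iff, image_subset_ker_iff, image_subset_ker_iff,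
    and_assoc (a := RVV ≤ _)]
  refine and_congr_right fun _ => ⟨fun h => TensorProduct.ext' fun w v => ?_, ?_⟩
  · have := (TwoSidedIdeal.mem_ker φ).1 (h ⟨w, v, rfl⟩)
    simpa [mulMap_tmul] using this
  · rintro h _ ⟨w, v, rfl⟩
    refine (TwoSidedIdeal.mem_ker φ).2 ?_
    have := LinearMap.congr_fun h (w ⊗ₜ v)
    simpa [mulMap_tmul] using this

lemma tensorPiece_one : (1 : TensorAlgebra ℂ (V × W)) ∈ tensorPiece V W 0 0 :=
  Submodule.subset_span ⟨[], rfl, rfl, rfl⟩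

lemma tensorPiece_mul_genV {k l : ℕ} (v : V) {t : TensorAlgebra ℂ (V × W)}
    (ht : t ∈ tensorPiece V W k l) : t * genV V W v ∈ tensorPiece V W (k + 1) l := by
  suffices h : tensorPiece V W k l ≤
      (tensorPiece V W (k + 1) l).comap (LinearMap.mulRight ℂ (genV V W v)) from h ht
  refine Submodule.span_le.2 ?_
  rintro _ ⟨L, rfl, rfl, rfl⟩
  exact Submodule.subset_span ⟨L ++ [Sum.inl v], by simp, by simp, by simp⟩

lemma tensorPiece_mul_genW {k l : ℕ} (w : W) {t : TensorAlgebra ℂ (V × W)}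
    (ht : t ∈ tensorPiece V W k l) : t * genW V W w ∈ tensorPiece V W k (l + 1) := by
  suffices h : tensorPiece V W k l ≤
      (tensorPiece V W k (l + 1)).comap (LinearMap.mulRight ℂ (genW V W w)) from h ht
  refine Submodule.span_le.2 ?_
  rintro _ ⟨L, rfl, rfl, rfl⟩
  exact Submodule.subset_span ⟨L ++ [Sum.inr w], by simp, by simp, by simp⟩

end Generators

/-! ### Quotient algebras presented by a braided pair. -/

namespace BraidedPair

variable {ι : Type} [Fintype ι] [DecidableEq ι] {s : ℂ} (N : BraidedPair ι s)

section Presentation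

variable {V W : Type*} [AddCommGroup V] [Module ℂ V] [AddCommGroup W] [Module ℂ W]
  (x : Module.Basis ι ℂ V) (y : Module.Basis ι ℂ W)
  (RVV : Submodule ℂ (V ⊗[ℂ] V)) (RWW : Submodule ℂ (W ⊗[ℂ] W))
  (RVW : Submodule ℂ (V ⊗[ℂ] W)) (T : W ⊗[ℂ] V →ₗ[ℂ] V ⊗[ℂ] W)

/-- The coefficients of the quadratic relations are those of the braided pair. -/
structure Presents : Prop where
  RVV_eq : RVV = Submodule.span ℂ
    (Set.range fun r => ∑ i, ∑ j, N.K.a r i j • (x i ⊗ₜ[ℂ] x j))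
  RWW_eq : RWW = Submodule.span ℂ
    (Set.range fun r => ∑ p, ∑ q, N.K'.a r q p • (y p ⊗ₜ[ℂ] y q))
  RVW_eq : RVW = Submodule.span ℂ {∑ i, ∑ p, N.K.c i p • (x i ⊗ₜ[ℂ] y p)}
  -- Only the class of `T` modulo the copairing matters, since the copairing is itself a relation;
  -- this freedom allows `G` to be replaced by an exchange map respecting the quadratic relations.
  T_eq : ∃ e : ι → ι → ℂ, ∀ p j, T (y p ⊗ₜ x j) =
    -∑ h, ∑ q, (N.τ p j h q + e p j * N.K.c h q) • (x h ⊗ₜ[ℂ] y q)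

variable {x y RVV RWW RVW T}

lemma Presents.le_ker_iff (h : N.Presents x y RVV RWW RVW T) {E : Type*} [Ring E] [Algebra ℂ E]
    (φ : TensorAlgebra ℂ (V × W) →ₐ[ℂ] E) :
    quadraticIdeal RVV RWW RVW T ≤ TwoSidedIdeal.ker φ ↔
      N.Rels (fun i => φ (genV V W (x i))) (fun p => φ (genW V W (y p))) := by
  obtain ⟨e, he⟩ := h.T_eq
  have hT : (∑ i, ∑ p, N.K.c i p • (φ (genV V W (x i)) * φ (genW V W (y p))) = 0) →
      ((φ.toLinearMap ∘ₗ (mulMap (genW V W) (genV V W) + mulMap (genV V W) (genW V W) ∘ₗ T) = 0) ↔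
        ∀ p j, φ (genW V W (y p)) * φ (genV V W (x j)) =
          ∑ h, ∑ q, N.τ p j h q • (φ (genV V W (x h)) * φ (genW V W (y q)))) := by
    intro h0
    have key : ∀ p j, (φ.toLinearMap ∘ₗ (mulMap (genW V W) (genV V W) +
        mulMap (genV V W) (genW V W) ∘ₗ T)) (y p ⊗ₜ x j) =
        φ (genW V W (y p)) * φ (genV V W (x j)) -
          ∑ h, ∑ q, N.τ p j h q • (φ (genV V W (x h)) * φ (genW V W (y q))) := by
      intro p j
      simp only [LinearMap.comp_apply, LinearMap.add_apply, he, map_add, map_neg, map_sum,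
        map_smul, mulMap_tmul, AlgHom.toLinearMap_apply, map_mul, add_smul, mul_smul,
        Finset.sum_add_distrib, ← Finset.smul_sum, h0, smul_zero, add_zero, sub_eq_add_neg]
    constructor
    · intro h1 p j
      have := key p j
      rw [h1] at this
      exact (sub_eq_zero.1 this.symm)
    · intro h1
      refine (y.tensorProduct x).ext fun i => ?_
      rw [Module.Basis.tensorProduct_apply, key, h1, sub_self]
      rfl
  rw [quadraticIdeal_le_ker_iff, h.RVV_eq, h.RWW_eq, h.RVW_eq, Submodule.span_le,
    Submodule.span_le, Submodule.span_le, Set.range_subset_iff, Set.range_subset_iff,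
    Set.singleton_subset_iff]
  simp only [SetLike.mem_coe, LinearMap.mem_ker, LinearMap.comp_apply,
    map_sum, map_smul, mulMap_tmul, AlgHom.toLinearMap_apply, map_mul]
  constructor
  · rintro ⟨⟨h1, h2, h3⟩, h4⟩
    exact ⟨h1, h2, h3, (hT h3).1 h4⟩
  · rintro ⟨h1, h2, h3, h4⟩
    exact ⟨⟨h1, h2, h3⟩, (hT h3).2 h4⟩

/-- The bidegree components of the quotient algebra have the dimensions of the spaces `Q k l`. -/
lemma Presents.finrank_quotientPiece (h : N.Presents x y RVV RWW RVW T) (k l : ℕ) :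
    Module.finrank ℂ (quotientPiece (quadraticIdeal RVV RWW RVW T) k l) =
      Module.finrank ℂ (N.Q k l) := by
  set I := quadraticIdeal RVV RWW RVW T with hI
  let φ := RingCon.mkₐ ℂ I.ringCon
  have hφ : I ≤ TwoSidedIdeal.ker φ := (TwoSidedIdeal.ker_ringCon_mk' I).ge
  have hR := (h.le_ker_iff N φ).1 hφ
  obtain ⟨S, S_one, S_X, S_Y⟩ := N.exists_monomials hR
  have S_V : ∀ k l v z, z ∈ LinearMap.range (S k l) →
      z * φ (genV V W v) ∈ LinearMap.range (S (k + 1) l) := by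
    intro k l v z hz
    rw [← x.sum_repr v]
    simp only [map_sum, map_smul, Finset.mul_sum, mul_smul_comm]
    exact Submodule.sum_mem _ fun i _ => Submodule.smul_mem _ _ (S_X k l i z hz)
  have S_W : ∀ k l w z, z ∈ LinearMap.range (S k l) →
      z * φ (genW V W w) ∈ LinearMap.range (S k (l + 1)) := by
    intro k l w z hz
    rw [← y.sum_repr w]
    simp only [map_sum, map_smul, Finset.mul_sum, mul_smul_comm]
    exact Submodule.sum_mem _ fun i _ => Submodule.smul_mem _ _ (S_Y k l i z hz)
  -- Upper bound: words, read from the left, stay in the span of ordered monomials.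
  have le_S : ∀ k l, quotientPiece I k l ≤ LinearMap.range (S k l) := by
    intro k l
    rw [quotientPiece, tensorPiece, Submodule.map_span_le]
    rintro _ ⟨L, rfl, rfl, rfl⟩
    induction L using List.reverseRecOn with
    | nil =>
      change φ 1 ∈ LinearMap.range (S 0 0)
      rwa [map_one]
    | append_singleton L g ih =>
      rw [List.map_append, List.prod_append, List.map_singleton, List.prod_singleton]
      rw [AlgHom.toLinearMap_apply] at ih ⊢
      rw [map_mul]
      cases g with
      | inl v =>
        rw [List.countP_append, List.countP_append]
        exact S_V _ _ v _ ih
      | inr w =>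
        rw [List.countP_append, List.countP_append]
        exact S_W _ _ w _ ih
  -- Lower bound: the quotient algebra acts on `Tot`, and applying it to the vacuum maps the `(k,
  -- l)` piece onto `Q k l`.
  let ψ : TensorAlgebra ℂ (V × W) →ₐ[ℂ] (Module.End ℂ N.Tot)ᵐᵒᵖ :=
    TensorAlgebra.lift ℂ ((MulOpposite.opLinearEquiv ℂ).toLinearMap ∘ₗ
      LinearMap.coprod (x.constr ℂ N.totX) (y.constr ℂ N.totY))
  have ψ_V : ∀ i, ψ (genV V W (x i)) = MulOpposite.op (N.totX i) := by
    intro i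
    simp [ψ, genV]
  have ψ_W : ∀ p, ψ (genW V W (y p)) = MulOpposite.op (N.totY p) := by
    intro p
    simp [ψ, genW]
  have hψ : I ≤ TwoSidedIdeal.ker ψ := by
    refine (h.le_ker_iff N (E := (Module.End ℂ N.Tot)ᵐᵒᵖ) ψ).2 ?_
    simp only [ψ_V, ψ_W]
    exact N.rels_op
  let ψ' : I.ringCon.Quotient →ₐ[ℂ] (Module.End ℂ N.Tot)ᵐᵒᵖ :=
    RingCon.liftₐ I.ringCon ψ fun a b hab => by
      have := (TwoSidedIdeal.mem_ker ψ).1 (hψ ((TwoSidedIdeal.rel_iff _ _ _).1 hab))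
      rw [map_sub, sub_eq_zero] at this
      exact this
  have ψ'_mk : ∀ t, ψ' (φ t) = ψ t := fun t => rfl
  let ev : I.ringCon.Quotient →ₗ[ℂ] N.Tot :=
    LinearMap.applyₗ N.vac ∘ₗ (MulOpposite.opLinearEquiv ℂ).symm.toLinearMap ∘ₗ ψ'.toLinearMap
  have ev_mk : ∀ t, ev (φ t) = (ψ t).unop N.vac := fun t => rfl
  let P : ∀ k l, Submodule ℂ (N.Q k l) := fun k l =>
    (quotientPiece I k l).map (LinearMap.proj l ∘ₗ LinearMap.proj k ∘ₗ ev)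
  have P_X : ∀ k l i z, z ∈ P k l → N.opX k l i z ∈ P (k + 1) l := by
    rintro k l i _ ⟨_, ⟨t, ht, rfl⟩, rfl⟩
    refine ⟨_, ⟨t * genV V W (x i), tensorPiece_mul_genV _ ht, rfl⟩, ?_⟩
    change ev (φ (t * genV V W (x i))) (k + 1) l = N.opX k l i (ev (φ t) k l)
    rw [ev_mk, ev_mk, map_mul, ψ_V]
    rfl
  have P_Y : ∀ k l p z, z ∈ P k l → N.opY k l p z ∈ P k (l + 1) := by
    rintro k l p _ ⟨_, ⟨t, ht, rfl⟩, rfl⟩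
    refine ⟨_, ⟨t * genW V W (y p), tensorPiece_mul_genW _ ht, rfl⟩, ?_⟩
    change ev (φ (t * genW V W (y p))) k (l + 1) = N.opY k l p (ev (φ t) k l)
    rw [ev_mk, ev_mk, map_mul, ψ_W]
    rfl
  -- On `u ⊗ 1` nothing has to be crossed, so `x_i` simply multiplies `u`.
  have P_one : ∀ k (u : N.K.T (k + 1)), N.mkQ k 0 (u ⊗ₜ N.K'.one 1) ∈ P k 0 := by
    intro k u
    refine N.K.T_induction (C := fun k u => N.mkQ k 0 (u ⊗ₜ N.K'.one 1) ∈ P k 0)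
      ?_ ?_ ?_ ?_ ?_ k u
    · refine ⟨_, ⟨1, tensorPiece_one, rfl⟩, ?_⟩
      change ev (φ 1) 0 0 = _
      rw [ev_mk, map_one]
      simp [vac]
    · intro n
      rw [TensorProduct.zero_tmul, map_zero]
      exact Submodule.zero_mem _
    · intro n u v hu hv
      rw [TensorProduct.add_tmul, map_add]
      exact Submodule.add_mem _ hu hv
    · intro n c u hu
      rw [← TensorProduct.smul_tmul', map_smul]
      exact Submodule.smul_mem _ _ hu
    · intro n i u hu
      have := P_X _ _ i _ hu
      rw [opX_mk, preX_tmul, Finset.sum_eq_single i] at this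
      · simpa [Φ_one] using this
      · intro b _ hb
        simp [Φ_one, hb.symm]
      · simp
  -- The left factor is built first and `v` is then reached by right multiplications, using
  -- `R_surj`.
  have P_tmul : ∀ l k u v, N.mkQ k l (u ⊗ₜ v) ∈ P k l := by
    intro l
    induction l with
    | zero =>
      intro k u v
      obtain ⟨c, rfl⟩ := N.K'.one.surjective v
      rw [← mul_one c, ← smul_eq_mul, map_smul, TensorProduct.tmul_smul, map_smul]
      exact Submodule.smul_mem _ _ (P_one k u)
    | succ l ih =>
      intro k u v
      obtain ⟨w, rfl⟩ := N.R_surj l v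
      rw [TensorProduct.tmul_sum, map_sum]
      exact Submodule.sum_mem _ fun p _ => P_Y _ _ p _ (ih k u (w p))
  have P_top : ∀ k l, P k l = ⊤ := by
    intro k l
    rw [eq_top_iff]
    rintro z -
    obtain ⟨w, rfl⟩ := Submodule.mkQ_surjective _ z
    induction w using TensorProduct.induction_on with
    | zero => rw [map_zero]; exact Submodule.zero_mem _
    | tmul u v => exact P_tmul l k u v
    | add a b ha hb => rw [map_add]; exact Submodule.add_mem _ ha hb
  have fin : Module.Finite ℂ (LinearMap.range (S k l)) := inferInstance
  have fin' : Module.Finite ℂ (quotientPiece I k l) :=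
    Submodule.finiteDimensional_of_le (le_S k l)
  refine le_antisymm ((Submodule.finrank_mono (le_S k l)).trans (LinearMap.finrank_range_le _)) ?_
  have := Submodule.finrank_map_le (LinearMap.proj l ∘ₗ LinearMap.proj k ∘ₗ ev) (quotientPiece I k l)
  change Module.finrank ℂ (P k l) ≤ _ at this
  rwa [P_top, finrank_top] at this

end Presentation

end BraidedPair

/-! ### Structure constants and their rotation identities. -/

/-- The structure constants of a basic quantum `SL(3)` datum in bases for which `c` and `C` are
the standard copairing and pairing; `M` is the matrix of `D` and `d` its inverse. -/
structure SpiderCoeffs (ι : Type) [Fintype ι] [DecidableEq ι] where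
  q : ℂ
  ω : ℂ
  A : ι → ι → ι → ℂ
  a : ι → ι → ι → ℂ
  M : ι → ι → ℂ
  d : ι → ι → ℂ
  q_ne_zero : q ≠ 0
  q_sq_ne : q ^ 2 ≠ -1
  q_sq : q ^ 2 = 1 ∨ ∀ n : ℕ, 1 ≤ n → (q ^ 2) ^ n ≠ 1
  ω_cube : ω ^ 3 = 1
  M_d : ∀ i j, ∑ p, M i p * d p j = if i = j then 1 else 0
  a_A : ∀ p p', ∑ i, ∑ j, a p i j * A i j p' = if p = p' then 1 else 0
  A_rot : ∀ i j k, A i j k = ω * ∑ p, M i p * A j k p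
  a_rot : ∀ i j k, a i j k = ω * ∑ p, d p k * a p i j
  trace_M : ∑ i, M i i = (q ^ 2)⁻¹ + 1 + q ^ 2
  G_F : ∀ i p i' p', ∑ r, ∑ j, (∑ h, A i h r * a p h j) * (∑ k, a r i' k * A k j p') =
    ((q + q⁻¹) ^ 2)⁻¹ * ((if i = i' ∧ p = p' then 1 else 0) +
      M i p * (if i' = p' then 1 else 0))

namespace SpiderCoeffs

variable {ι : Type} [Fintype ι] [DecidableEq ι] (S : SpiderCoeffs ι)

lemma d_M (p p' : ι) : ∑ i, S.d p i * S.M i p' = if p = p' then 1 else 0 := by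
  have h : (Matrix.of S.M) * (Matrix.of S.d) = 1 := by
    ext i j
    rw [Matrix.mul_apply, Matrix.one_apply]
    exact S.M_d i j
  have h' := mul_eq_one_comm.1 h
  have := congrFun (congrFun h' p) p'
  rwa [Matrix.mul_apply, Matrix.one_apply] at this

lemma M_A (i j k : ι) : ∑ p, S.M i p * S.A j k p = S.ω ^ 2 * S.A i j k := by
  rw [S.A_rot i j k, ← mul_assoc, ← pow_succ, S.ω_cube, one_mul]

lemma d_A (p j k : ι) : ∑ i, S.d p i * S.A i j k = S.ω * S.A j k p := by
  simp only [S.A_rot _ j k, Finset.mul_sum]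
  rw [Finset.sum_comm]
  have : ∀ r, ∑ i, S.d p i * (S.ω * (S.M i r * S.A j k r)) =
      S.ω * S.A j k r * if p = r then 1 else 0 := by
    intro r
    rw [← S.d_M, Finset.mul_sum]
    exact Finset.sum_congr rfl fun i _ => by ring
  simp [this]

lemma M_a (p i j : ι) : ∑ k, S.M k p * S.a i j k = S.ω * S.a p i j := by
  simp only [S.a_rot i j, Finset.mul_sum]
  rw [Finset.sum_comm]
  have : ∀ r, ∑ k, S.M k p * (S.ω * (S.d r k * S.a r i j)) =
      S.ω * S.a r i j * if r = p then 1 else 0 := by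
    intro r
    rw [← S.d_M, Finset.mul_sum]
    exact Finset.sum_congr rfl fun i _ => by ring
  simp [this]

/-- Rotate both `A` and `a`: the legs turned by `M` and `d` cancel after the other two contract by
`A a = 1`, and the two rotations leave `ω²`. -/
lemma A_a_right (p p' : ι) :
    ∑ i, ∑ j, S.A p i j * S.a i j p' = S.ω ^ 2 * if p = p' then 1 else 0 := by
  have h : ∀ i j, S.A p i j * S.a i j p' =
      ∑ r, ∑ s, (S.ω ^ 2 * (S.M p r * S.d s p')) * (S.a s i j * S.A i j r) := by
    intro i j
    rw [S.A_rot p i j, S.a_rot i j p', Finset.mul_sum, Finset.mul_sum, Finset.sum_mul_sum]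
    exact sum_congr₂ fun r s => by ring
  simp only [h]
  refine sum_block₂.trans ?_
  simp only [← Finset.mul_sum, S.a_A]
  rw [← S.M_d, Finset.mul_sum]
  refine Finset.sum_congr rfl fun r _ => ?_
  simp

/-- The matrix of `G`. -/
def G (p j i r : ι) : ℂ := ∑ k, S.a p i k * S.A k j r

/-- Rotation exhibits `G`, in the indices `h` and `i`, as a combination of the relations `a t`; this
gives `c_τ` and brings `F` next to `G` in `exch_b`. -/
lemma G_eq (h k i r : ι) : S.G h k i r = S.ω ^ 2 * ∑ t, S.a t h i * S.A k r t := by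
  have e : ∀ l, S.a h i l * S.A l k r = ∑ t, (S.ω * S.a t h i) * (S.d t l * S.A l k r) := by
    intro l
    rw [S.a_rot, Finset.mul_sum, Finset.sum_mul]
    exact Finset.sum_congr rfl fun t _ => by ring
  simp only [G, e]
  rw [Finset.sum_comm]
  simp only [← Finset.mul_sum, S.d_A]
  rw [Finset.mul_sum]
  exact Finset.sum_congr rfl fun t _ => by ring

lemma A_a_flip (p j i r : ι) : ∑ k, S.A p i k * S.a k j r = S.ω * S.G j p r i := by
  have e : ∀ k, S.A p i k * S.a k j r = ∑ l, (S.ω ^ 2 * S.a j r l) * (S.M l k * S.A p i k) := by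
    intro k
    have := S.M_a k j r
    have h : S.a k j r = S.ω ^ 2 * ∑ l, S.M l k * S.a j r l := by
      rw [this, ← mul_assoc, ← pow_succ, S.ω_cube, one_mul]
    rw [h, Finset.mul_sum, Finset.mul_sum]
    exact Finset.sum_congr rfl fun t _ => by ring
  simp only [e]
  rw [Finset.sum_comm]
  simp only [← Finset.mul_sum, S.M_A]
  rw [G, Finset.mul_sum]
  refine Finset.sum_congr rfl fun t _ => ?_
  linear_combination (S.ω * S.a j r t * S.A t p i) * S.ω_cube

lemma scalar : (S.q + S.q⁻¹) ^ 2 ≠ 0 := by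
  have h0 := S.q_ne_zero
  have : S.q + S.q⁻¹ ≠ 0 := by
    intro h
    apply S.q_sq_ne
    field_simp at h
    linear_combination h
  exact pow_ne_zero _ this

/-- The dual structure constants. -/
def dual : SpiderCoeffs ι where
  q := S.q
  ω := S.ω ^ 2
  -- The factors `ω²` restore `A a = 1`: contracting `A` with `a` on the other side gives `ω²` by
  -- `A_a_right`, and `ω⁶ = 1`.
  A i j k := S.ω ^ 2 * S.a i j k
  a i j k := S.ω ^ 2 * S.A i j k
  M i p := S.M p i
  d i p := S.d p i
  q_ne_zero := S.q_ne_zero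
  q_sq_ne := S.q_sq_ne
  q_sq := S.q_sq
  ω_cube := by rw [← pow_mul, mul_comm, pow_mul, S.ω_cube, one_pow]
  M_d i j := by
    simp only [mul_comm (S.M _ _), S.d_M, eq_comm]
  a_A p p' := by
    have : ∀ i j, S.ω ^ 2 * S.A p i j * (S.ω ^ 2 * S.a i j p') =
        S.ω ^ 4 * (S.A p i j * S.a i j p') := fun i j => by ring
    simp only [this, ← Finset.mul_sum, S.A_a_right]
    linear_combination ((S.ω ^ 3 + 1) * if p = p' then 1 else 0) * S.ω_cube
  A_rot i j k := by
    have : ∀ p, S.M p i * (S.ω ^ 2 * S.a j k p) = S.ω ^ 2 * (S.M p i * S.a j k p) :=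
      fun p => by ring
    simp only [this, ← Finset.mul_sum, S.M_a]
    linear_combination (-S.ω ^ 2 * S.a i j k) * S.ω_cube
  a_rot i j k := by
    have : ∀ p, S.d k p * (S.ω ^ 2 * S.A p i j) = S.ω ^ 2 * (S.d k p * S.A p i j) :=
      fun p => by ring
    simp only [this, ← Finset.mul_sum, S.d_A]
    linear_combination (-S.ω ^ 2 * S.A i j k) * S.ω_cube
  trace_M := S.trace_M
  -- After rotation this is the original relation with the index pairs interchanged.
  G_F i p i' p' := by
    have e1 : ∀ r j, ∑ h, S.ω ^ 2 * S.a i h r * (S.ω ^ 2 * S.A p h j) =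
        S.ω * ∑ h, S.A p h j * S.a i h r := by
      intro r j
      rw [Finset.mul_sum]
      refine Finset.sum_congr rfl fun h _ => ?_
      linear_combination (S.ω * S.A p h j * S.a i h r) * S.ω_cube
    have e2 : ∀ r j, ∑ k, S.ω ^ 2 * S.A r i' k * (S.ω ^ 2 * S.a k j p') =
        S.ω ^ 2 * S.G j r p' i' := by
      intro r j
      have : ∀ k, S.ω ^ 2 * S.A r i' k * (S.ω ^ 2 * S.a k j p') =
        S.ω ^ 4 * (S.A r i' k * S.a k j p') := fun k => by ring
      simp only [this, ← Finset.mul_sum, S.A_a_flip]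
      linear_combination (S.ω ^ 2 * S.G j r p' i') * S.ω_cube
    simp only [e1, e2]
    rw [Finset.sum_comm]
    have e3 : ∀ r j, (S.ω * ∑ h, S.A p h r * S.a i h j) * (S.ω ^ 2 * S.G r j p' i') =
        (∑ h, S.A p h r * S.a i h j) * ∑ k, S.a r p' k * S.A k j i' := by
      intro r j
      rw [G]
      linear_combination ((∑ h, S.A p h r * S.a i h j) * ∑ k, S.a r p' k * S.A k j i') * S.ω_cube
    simp only [e3, S.G_F, and_comm, eq_comm]

lemma q_scalar : ((S.q + S.q⁻¹) ^ 2)⁻¹ = S.q ^ 2 / (1 + S.q ^ 2) ^ 2 := by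
  have h0 := S.q_ne_zero
  have h1 : 1 + S.q ^ 2 ≠ 0 := fun h => S.q_sq_ne (by linear_combination h)
  have h2 : S.q + S.q⁻¹ = (1 + S.q ^ 2) / S.q := by
    field_simp
    ring
  rw [h2, div_pow, inv_div]

/-- The quadratic algebra of `V` given by the structure constants. -/
def koszul : KoszulData ι (S.q ^ 2) where
  A := S.A
  a := S.a
  c i p := if i = p then 1 else 0
  D := S.M
  -- The root of unity in `(1, a) c = ω (a, 1) d` is absorbed into the auxiliary tensor.
  d p k := S.ω * S.d p k
  s_ne_zero := pow_ne_zero _ S.q_ne_zero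
  one_add_s := fun h => S.q_sq_ne (by linear_combination h)
  sNat_ne_zero := sNat_ne_zero S.q_sq
  A_a p p' := by
    rw [Finset.sum_comm]
    simp only [mul_comm (S.A _ _ _), S.a_A]
  G_F i p i' p' := by
    rw [Finset.sum_comm, S.G_F, S.q_scalar]
    simp only [and_comm]
  D_c := by
    simp only [mul_ite, mul_one, mul_zero]
    simp only [Finset.sum_ite_eq', Finset.mem_univ, if_true, S.trace_M]
    have h0 := S.q_ne_zero
    field_simp
  B_b i i' := by
    simp only [mul_ite, mul_one, mul_zero, Finset.sum_ite_eq, Finset.sum_ite_eq', Finset.mem_univ,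
      if_true, mul_comm (S.a _ _ _), S.M_a]
    have : ∀ k p, S.A i k p * (S.ω * S.a k p i') = S.ω * (S.A i k p * S.a k p i') :=
      fun k p => by ring
    simp only [this, ← Finset.mul_sum, S.A_a_right]
    linear_combination (if i = i' then 1 else 0) * S.ω_cube
  a_c i j k := by
    simp only [ite_mul, one_mul, zero_mul, Finset.sum_ite_eq, Finset.sum_ite_eq', Finset.mem_univ,
      if_true, mul_assoc, ← Finset.mul_sum]
    exact S.a_rot i j k

/-- The quadratic algebra of `W` given by the structure constants. -/
def koszulDual : KoszulData ι (S.q ^ 2) := S.dual.koszul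

/-- The pair of quadratic algebras of `V` and `W`. -/
def koszulPair : KoszulPair ι (S.q ^ 2) where
  K := S.koszul
  K' := S.koszulDual
  c_eq p i := by simp [koszul, koszulDual, eq_comm]
  D_eq p i := rfl
  -- Using `M` to rotate the last `A` turns the contraction into the composite `G F`.
  contract l h l' h' := by
    have e1 : ∀ i p j, S.koszul.P l j h i * S.koszulDual.P l' j h' p =
        ∑ r, ∑ s, (S.A l j r * S.a l' j s) * (S.ω * (S.a r h i * S.A s h' p)) := by
      intro i p j
      rw [KoszulData.P, KoszulData.P, Finset.sum_mul_sum]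
      refine sum_congr₂ fun r s => ?_
      change S.A l j r * S.a r h i * ((S.ω ^ 2 * S.a l' j s) * (S.ω ^ 2 * S.A s h' p)) = _
      linear_combination (S.ω * (S.A l j r * S.a l' j s * S.a r h i * S.A s h' p)) * S.ω_cube
    have e2 : ∀ i p, ∑ j, ∑ r, S.koszul.D i p * S.koszul.c j r *
        (S.koszul.P l j h i * S.koszulDual.P l' r h' p) =
        ∑ j, S.M i p * (S.koszul.P l j h i * S.koszulDual.P l' j h' p) := by
      intro i p
      simp [koszul]
    simp only [e2, e1, Finset.mul_sum]
    refine (sum_front₃ (f := fun i p j r => ∑ s, S.M i p *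
      ((S.A l j r * S.a l' j s) * (S.ω * (S.a r h i * S.A s h' p))))).trans ?_
    have e3 : ∀ r s, ∑ i, ∑ p, ∑ j, S.M i p *
        ((S.A l j r * S.a l' j s) * (S.ω * (S.a r h i * S.A s h' p))) =
        (∑ j, S.A l j r * S.a l' j s) * ∑ i, S.a r h i * S.A i s h' := by
      intro r s
      have : ∀ i p j, S.M i p * ((S.A l j r * S.a l' j s) * (S.ω * (S.a r h i * S.A s h' p))) =
          (S.A l j r * S.a l' j s) * ((S.ω * S.a r h i) * (S.M i p * S.A s h' p)) :=
        fun i p j => by ring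
      simp only [this, ← Finset.sum_mul, ← Finset.mul_sum, S.M_A]
      congr 1
      refine Finset.sum_congr rfl fun i _ => ?_
      linear_combination (S.a r h i * S.A i s h') * S.ω_cube
    refine (Finset.sum_congr rfl fun r _ => sum_front₃.trans
      (Finset.sum_congr rfl fun s _ => e3 r s)).trans ?_
    rw [S.G_F, S.q_scalar]
    rfl

/-! ### The exchange map and its compatibility with the relations. -/

/-- The parameter of the exchange map. -/
def x₀ : ℂ := S.ω ^ 2 * S.q

/-- The exchange map. -/
def exch (p j h r : ι) : ℂ :=
  -- The product of Kronecker symbols is the matrix of `c C`.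
  -(S.q + S.q⁻¹) * S.G p j h r + S.x₀ * ((if p = j then 1 else 0) * if h = r then 1 else 0)

/-- The roots of this quadratic are `ω² q` and `ω² q⁻¹`. Its left side is the coefficient of the
term that must disappear in `exch_b` and `exch_a`. -/
lemma x₀_relation : S.x₀ ^ 2 - (S.q + S.q⁻¹) * S.x₀ * S.ω ^ 2 + S.ω = 0 := by
  have h0 : S.q⁻¹ * S.q = 1 := inv_mul_cancel₀ S.q_ne_zero
  rw [x₀]
  linear_combination (-S.ω) * S.ω_cube - S.ω ^ 4 * h0

lemma sum_F_G (i p i' p' : ι) :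
    ∑ r, ∑ j, (∑ h, S.A i h r * S.a p h j) * S.G r j i' p' =
    ((S.q + S.q⁻¹) ^ 2)⁻¹ * ((if i = i' ∧ p = p' then 1 else 0) +
      S.M i p * (if i' = p' then 1 else 0)) := S.G_F i p i' p'

/-- Among the four products, the one with two `G`'s reduces by `G F = ρ (1 + c D)`, and `ρ` cancels
`(q + q⁻¹)²`. All terms then factor through `A k q' t` except those proportional to `A r j q'` with
`i = t`, whose total coefficient vanishes by `x₀_relation`. -/
lemma exch_b (r j i q' t : ι) :
    ∑ p, ∑ p', ∑ h, S.A r p p' * (S.exch p' h i t * S.exch p j h q') =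
    ∑ k, (S.ω ^ 2 * ((if r = i then 1 else 0) * if j = k then 1 else 0) -
      (S.q + S.q⁻¹) * S.x₀ * ∑ p', S.A r j p' * S.a p' i k) * S.A k q' t := by
  have h1 : ∑ p, ∑ p', S.A r p p' * S.G p j p' q' = S.ω ^ 2 * S.A r j q' := by
    simp only [G, Finset.mul_sum, ← mul_assoc]
    refine sum_swap₂.trans (sum_swap₁.trans ?_)
    simp only [← Finset.sum_mul, S.A_a_right]
    simp
  have h2 : ∑ p, ∑ p', ∑ h, S.A r p p' * (S.G p' h i t * S.G p j h q') =
      ((S.q + S.q⁻¹) ^ 2)⁻¹ * (S.ω ^ 2 * (if r = i then 1 else 0) * S.A j q' t +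
        S.ω * (if i = t then 1 else 0) * S.A r j q') := by
    have e : ∀ p' h, ∑ p, S.A r p p' * (S.G p' h i t * S.G p j h q') =
        ∑ s, (S.ω ^ 2 * S.A j q' s) *
          ((∑ p, S.A r p p' * S.a s p h) * S.G p' h i t) := by
      intro p' h
      simp only [S.G_eq _ _ h q', Finset.mul_sum, Finset.sum_mul]
      rw [Finset.sum_comm]
      exact sum_congr₂ fun s p => by ring
    refine sum_swap₁.trans ((sum_swap₂.trans (sum_congr₂ e)).trans ?_)
    refine sum_swap₂.trans (sum_swap₁.trans ?_)
    simp only [← Finset.mul_sum, S.sum_F_G]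
    have e' : ∀ s, S.ω ^ 2 * S.A j q' s * (((S.q + S.q⁻¹) ^ 2)⁻¹ *
        ((if r = i ∧ s = t then 1 else 0) + S.M r s * if i = t then 1 else 0)) =
        (((S.q + S.q⁻¹) ^ 2)⁻¹ * S.ω ^ 2 * (if r = i then 1 else 0)) *
          (S.A j q' s * if s = t then 1 else 0) +
        (((S.q + S.q⁻¹) ^ 2)⁻¹ * S.ω ^ 2 * (if i = t then 1 else 0)) *
          (S.M r s * S.A j q' s) := by
      intro s
      rw [ite_and, ← mul_one (ite (s = t) _ _)]
      split_ifs <;> ring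
    simp only [e', Finset.sum_add_distrib, ← Finset.mul_sum, S.M_A]
    simp only [mul_ite, mul_one, mul_zero, Finset.sum_ite_eq', Finset.mem_univ, if_true]
    split_ifs
    · linear_combination (((S.q + S.q⁻¹) ^ 2)⁻¹ * S.ω * S.A r j q') * S.ω_cube
    · ring
    · linear_combination (((S.q + S.q⁻¹) ^ 2)⁻¹ * S.ω * S.A r j q') * S.ω_cube
    · ring
  have h3 : ∑ p', S.A r j p' * S.G p' q' i t =
      ∑ k, (∑ p', S.A r j p' * S.a p' i k) * S.A k q' t := by
    simp only [G, Finset.mul_sum, Finset.sum_mul, mul_assoc]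
    exact Finset.sum_comm
  have e : ∀ p p' h, S.A r p p' * (S.exch p' h i t * S.exch p j h q') =
      (S.q + S.q⁻¹) ^ 2 * (S.A r p p' * (S.G p' h i t * S.G p j h q')) -
      (S.q + S.q⁻¹) * S.x₀ * (if i = t then 1 else 0) *
        (if h = p' then S.A r p p' * S.G p j h q' else 0) -
      (S.q + S.q⁻¹) * S.x₀ *
        (if p = j then if h = q' then S.A r p p' * S.G p' h i t else 0 else 0) +
      S.x₀ ^ 2 * (if i = t then 1 else 0) *
        (if p = j then if h = q' then if p' = h then S.A r p p' else 0 else 0 else 0) := by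
    intro p p' h
    simp only [exch, eq_comm (a := p') (b := h)]
    split_ifs <;> ring
  simp only [← Finset.mul_sum] at h2
  simp only [e, Finset.sum_add_distrib, Finset.sum_sub_distrib, ← Finset.mul_sum, h2]
  simp only [Finset.sum_ite_irrel, Finset.sum_const_zero, Finset.sum_ite_eq, Finset.sum_ite_eq',
    Finset.mem_univ, if_true, h1, h3]
  simp only [sub_mul, Finset.sum_sub_distrib, mul_assoc, ← Finset.mul_sum, ite_mul, one_mul,
    zero_mul, Finset.sum_ite_irrel, Finset.sum_const_zero, Finset.sum_ite_eq, Finset.mem_univ,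
    if_true]
  have hx := S.x₀_relation
  simp only [mul_inv_cancel_left₀ S.scalar]
  split_ifs
  · linear_combination S.A r j q' * hx
  · ring
  · linear_combination S.A r j q' * hx
  · ring

/-- As for `exch_b`: the terms not of the form `a r h k` times a coefficient are multiples of `a t p
h` with `k = q'`, and `x₀_relation` removes them. -/
lemma exch_a (p t h k q' : ι) :
    ∑ h', ∑ k', ∑ r, S.a t h' k' * (S.exch p h' h r * S.exch r k' k q') =
    ∑ r, S.a r h k * ((if p = r then 1 else 0) * (if t = q' then 1 else 0) -
      (S.q + S.q⁻¹) * S.x₀ * S.ω ^ 2 * S.G t q' p r) := by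
  have h1 : ∑ h', ∑ k', S.a t h' k' * S.G p h' h k' = S.ω ^ 2 * S.a t p h := by
    have e : ∀ h' k', S.a t h' k' * S.G p h' h k' =
        ∑ s, ∑ u, (S.ω * S.a p h s * S.M s u) * (S.a t h' k' * S.A h' k' u) := by
      intro h' k'
      simp only [G, S.A_rot _ h' k', Finset.mul_sum]
      exact sum_congr₂ fun s u => by ring
    refine (sum_congr₂ e).trans (sum_block₂.trans ?_)
    simp only [← Finset.mul_sum, S.a_A]
    have e' : ∀ s, ∑ u, S.ω * S.a p h s * S.M s u * (if t = u then 1 else 0) =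
        S.ω * (S.M s t * S.a p h s) := by
      intro s
      simp only [mul_ite, mul_one, mul_zero, Finset.sum_ite_eq, Finset.mem_univ, if_true]
      ring
    simp only [e', ← Finset.mul_sum, S.M_a]
    ring
  have h2 : ∑ h', ∑ k', ∑ r, S.a t h' k' * (S.G p h' h r * S.G r k' k q') =
      ((S.q + S.q⁻¹) ^ 2)⁻¹ * ((if t = q' then 1 else 0) * S.a p h k +
        S.ω * (if k = q' then 1 else 0) * S.a t p h) := by
    have e : ∀ k' r, ∑ h', S.a t h' k' * (S.G p h' h r * S.G r k' k q') =
        ∑ s, S.a p h s * ((∑ h', S.A s h' r * S.a t h' k') * S.G r k' k q') := by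
      intro k' r
      have hG : ∀ h', S.G p h' h r = ∑ s, S.a p h s * S.A s h' r := fun _ => rfl
      simp only [hG, Finset.mul_sum, Finset.sum_mul]
      rw [Finset.sum_comm]
      exact sum_congr₂ fun s h' => by ring
    refine sum_swap₁.trans ((sum_swap₂.trans (sum_congr₂ e)).trans ?_)
    refine sum_swap₂.trans (sum_swap₁.trans ?_)
    rw [Finset.sum_congr rfl fun s _ => sum_swap₁]
    simp only [← Finset.mul_sum, S.sum_F_G]
    have e' : ∀ s, S.a p h s * (((S.q + S.q⁻¹) ^ 2)⁻¹ *
        ((if s = k ∧ t = q' then 1 else 0) + S.M s t * if k = q' then 1 else 0)) =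
        (((S.q + S.q⁻¹) ^ 2)⁻¹ * (if t = q' then 1 else 0)) *
          (S.a p h s * if s = k then 1 else 0) +
        (((S.q + S.q⁻¹) ^ 2)⁻¹ * (if k = q' then 1 else 0)) *
          (S.M s t * S.a p h s) := by
      intro s
      rw [ite_and, ← mul_one (ite (s = k) _ _)]
      split_ifs <;> ring
    simp only [e', Finset.sum_add_distrib, ← Finset.mul_sum, S.M_a]
    simp only [mul_ite, mul_one, mul_zero, Finset.sum_ite_eq', Finset.mem_univ, if_true]
    split_ifs <;> ring
  have h3 : ∑ k', S.a t p k' * S.G h k' k q' =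
      S.ω ^ 2 * ∑ r, S.a r h k * S.G t q' p r := by
    simp only [S.G_eq h, Finset.mul_sum]
    rw [Finset.sum_comm]
    refine Finset.sum_congr rfl fun r _ => ?_
    rw [G, Finset.mul_sum, Finset.mul_sum]
    exact Finset.sum_congr rfl fun k' _ => by ring
  have e : ∀ h' k' r, S.a t h' k' * (S.exch p h' h r * S.exch r k' k q') =
      (S.q + S.q⁻¹) ^ 2 * (S.a t h' k' * (S.G p h' h r * S.G r k' k q')) -
      (S.q + S.q⁻¹) * S.x₀ *
        (if p = h' then if h = r then S.a t h' k' * S.G r k' k q' else 0 else 0) -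
      (S.q + S.q⁻¹) * S.x₀ * (if k = q' then 1 else 0) *
        (if r = k' then S.a t h' k' * S.G p h' h r else 0) +
      S.x₀ ^ 2 * (if k = q' then 1 else 0) *
        (if p = h' then if h = r then if r = k' then S.a t h' k' else 0 else 0 else 0) := by
    intro h' k' r
    simp only [exch]
    split_ifs <;> ring
  simp only [← Finset.mul_sum] at h2
  simp only [e, Finset.sum_add_distrib, Finset.sum_sub_distrib, ← Finset.mul_sum, h2]
  simp only [Finset.sum_ite_irrel, Finset.sum_const_zero, Finset.sum_ite_eq, Finset.sum_ite_eq',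
    Finset.mem_univ, if_true, h1, h3]
  have e2 : ∀ r, S.a r h k * ((if p = r then 1 else 0) * (if t = q' then 1 else 0) -
      (S.q + S.q⁻¹) * S.x₀ * S.ω ^ 2 * S.G t q' p r) =
      (if t = q' then 1 else 0) * (if p = r then S.a r h k else 0) -
      ((S.q + S.q⁻¹) * S.x₀ * S.ω ^ 2) * (S.a r h k * S.G t q' p r) := by
    intro r
    split_ifs <;> ring
  simp only [e2, Finset.sum_sub_distrib, ← Finset.mul_sum, Finset.sum_ite_eq, Finset.mem_univ,
    if_true]
  have hx := S.x₀_relation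
  simp only [mul_inv_cancel_left₀ S.scalar]
  split_ifs
  · linear_combination S.a t p h * hx
  · ring
  · linear_combination S.a t p h * hx
  · ring

/-- The braided pair given by the structure constants. -/
def braidedPair : BraidedPair ι (S.q ^ 2) where
  toKoszulPair := S.koszulPair
  τ := S.exch
  x := S.x₀
  M₁ r j i k := S.ω ^ 2 * ((if r = i then 1 else 0) * if j = k then 1 else 0) -
      (S.q + S.q⁻¹) * S.x₀ * ∑ p', S.A r j p' * S.a p' i k
  M₂ p t r q' := (if p = r then 1 else 0) * (if t = q' then 1 else 0) -
      (S.q + S.q⁻¹) * S.x₀ * S.ω ^ 2 * S.G t q' p r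
  M₃ k r t := -(S.q + S.q⁻¹) * S.ω ^ 2 * S.A k r t
  M₄ r h t := -(S.q + S.q⁻¹) * S.ω * S.a r h t
  τ_b r j i q' t := by
    change ∑ p, ∑ p', ∑ h, S.ω ^ 2 * S.A r p p' * (S.exch p' h i t * S.exch p j h q') =
      ∑ k, _ * (S.ω ^ 2 * S.A k q' t)
    have e : ∑ p, ∑ p', ∑ h, S.ω ^ 2 * S.A r p p' * (S.exch p' h i t * S.exch p j h q') =
        S.ω ^ 2 * ∑ p, ∑ p', ∑ h, S.A r p p' * (S.exch p' h i t * S.exch p j h q') := by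
      simp only [Finset.mul_sum, mul_assoc]
    rw [e, S.exch_b, Finset.mul_sum]
    exact Finset.sum_congr rfl fun k _ => by ring
  τ_a := S.exch_a
  c_τ h k i r := by
    change ∑ p, (if h = p then 1 else 0) * S.exch p k i r = (if h = k then S.x₀ *
      (if i = r then 1 else 0) else 0) + ∑ t, S.a t h i * (-(S.q + S.q⁻¹) * S.ω ^ 2 * S.A k r t)
    simp only [ite_mul, one_mul, zero_mul, Finset.sum_ite_eq, Finset.mem_univ, if_true]
    have : ∀ t, S.a t h i * (-(S.q + S.q⁻¹) * S.ω ^ 2 * S.A k r t) =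
      (-(S.q + S.q⁻¹)) * (S.ω ^ 2 * (S.a t h i * S.A k r t)) := fun t => by ring
    simp only [this, ← Finset.mul_sum]
    rw [exch, S.G_eq]
    split_ifs <;> ring
  τ_c r h t p := by
    change ∑ i, (if i = p then 1 else 0) * S.exch r i h t = (if p = r then S.x₀ *
      (if h = t then 1 else 0) else 0) +
        ∑ k, -(S.q + S.q⁻¹) * S.ω * S.a r h k * (S.ω ^ 2 * S.A k p t)
    simp only [ite_mul, one_mul, zero_mul, Finset.sum_ite_eq', Finset.mem_univ, if_true]
    have : ∀ k, -(S.q + S.q⁻¹) * S.ω * S.a r h k * (S.ω ^ 2 * S.A k p t) =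
      (-(S.q + S.q⁻¹)) * (S.a r h k * S.A k p t) := fun k => by
        linear_combination (-(S.q + S.q⁻¹) * (S.a r h k * S.A k p t)) * S.ω_cube
    simp only [this, ← Finset.mul_sum]
    have hp : (p = r) = (r = p) := propext eq_comm
    simp only [exch, G, hp]
    split_ifs <;> ring

end SpiderCoeffs

/-! ### From linear maps to structure constants. -/

lemma linearIndependent_of_pairing {ι E : Type*} [Fintype ι] [DecidableEq ι] [AddCommGroup E]
    [Module ℂ E] (u : ι → E) (φ : ι → E →ₗ[ℂ] ℂ)
    (h : ∀ i j, φ j (u i) = if i = j then 1 else 0) : LinearIndependent ℂ u := by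
  rw [Fintype.linearIndependent_iff]
  intro g hg j
  have := congrArg (φ j) hg
  simpa [h] using this

lemma exists_eq_sum_tmul {ι V W : Type*} [Fintype ι] [AddCommGroup V] [Module ℂ V]
    [AddCommGroup W] [Module ℂ W] (x : Module.Basis ι ℂ V) (t : V ⊗[ℂ] W) :
    ∃ y : ι → W, t = ∑ i, x i ⊗ₜ y i := by
  induction t using TensorProduct.induction_on with
  | zero => exact ⟨0, by simp⟩
  | tmul v w =>
    refine ⟨fun i => x.repr v i • w, ?_⟩
    conv_lhs => rw [← x.sum_repr v]
    simp only [TensorProduct.sum_tmul, TensorProduct.smul_tmul]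
  | add a b ha hb =>
    obtain ⟨u, rfl⟩ := ha
    obtain ⟨v, rfl⟩ := hb
    exact ⟨u + v, by simp only [Pi.add_apply, TensorProduct.tmul_add, Finset.sum_add_distrib]⟩

lemma _root_.Module.Basis.tensorProduct_expand {ι κ V W : Type*} [Fintype ι] [Fintype κ]
    [AddCommGroup V] [Module ℂ V] [AddCommGroup W] [Module ℂ W] (x : Module.Basis ι ℂ V)
    (y : Module.Basis κ ℂ W) (t : V ⊗[ℂ] W) :
    t = ∑ i, ∑ j, (x.tensorProduct y).repr t (i, j) • (x i ⊗ₜ[ℂ] y j) := by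
  conv_lhs => rw [← (x.tensorProduct y).sum_repr t, Fintype.sum_prod_type]
  simp only [Module.Basis.tensorProduct_apply]

lemma _root_.Module.Basis.range_eq_span {ι X Y : Type*} [AddCommGroup X] [Module ℂ X]
    [AddCommGroup Y] [Module ℂ Y] (w : Module.Basis ι ℂ X) (f : X →ₗ[ℂ] Y) :
    LinearMap.range f = Submodule.span ℂ (Set.range fun i => f (w i)) := by
  rw [LinearMap.range_eq_map, ← w.span_eq, Submodule.map_span, ← Set.range_comp]
  rfl

lemma transposeTo_eq {ι κ X Y Z : Type*} [AddCommGroup X] [Module ℂ X]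
    [AddCommGroup Y] [Module ℂ Y] [AddCommGroup Z] [Module ℂ Z] [FiniteDimensional ℂ X]
    [FiniteDimensional ℂ Y] (x : Module.Basis ι ℂ X) (y : Module.Basis κ ℂ Y)
    (f : X ⊗[ℂ] Y →ₗ[ℂ] Z) (ξ : Module.Dual ℂ Z) (t : Module.Dual ℂ X ⊗[ℂ] Module.Dual ℂ Y)
    (h : ∀ i j, TensorProduct.dualDistrib ℂ X Y t (x i ⊗ₜ y j) = ξ (f (x i ⊗ₜ y j))) :
    transposeTo f ξ = t := by
  rw [transposeTo, LinearMap.comp_apply, LinearEquiv.coe_coe, LinearEquiv.symm_apply_eq]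
  refine (x.tensorProduct y).ext fun ij => ?_
  rw [Module.Basis.tensorProduct_apply]
  exact (h _ _).symm

/-- The factor `ω` on the `W` relations is a unit, so it does not change their span. The reordering
map differs from `-exch` by a multiple of `c C`, which `T_eq` permits. -/
lemma SpiderCoeffs.presents {ι : Type} [Fintype ι] [DecidableEq ι] (S : SpiderCoeffs ι)
    {V W X Y Z : Type*} [AddCommGroup V] [Module ℂ V] [AddCommGroup W] [Module ℂ W]
    [AddCommGroup X] [Module ℂ X] [AddCommGroup Y] [Module ℂ Y] [AddCommGroup Z] [Module ℂ Z]
    (x : Module.Basis ι ℂ V) (y : Module.Basis ι ℂ W)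
    (f : X →ₗ[ℂ] V ⊗[ℂ] V) (w : Module.Basis ι ℂ X)
    (hf : ∀ r, f (w r) = ∑ i, ∑ j, S.a r i j • (x i ⊗ₜ x j))
    (g : Y →ₗ[ℂ] W ⊗[ℂ] W) (v : Module.Basis ι ℂ Y)
    (hg : ∀ r, g (v r) = ∑ p, ∑ q, (S.ω * S.dual.a r q p) • (y p ⊗ₜ y q))
    (h : Z →ₗ[ℂ] V ⊗[ℂ] W) (z : Module.Basis Unit ℂ Z) (hh : h (z ()) = ∑ i, x i ⊗ₜ y i)
    (T : W ⊗[ℂ] V →ₗ[ℂ] V ⊗[ℂ] W)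
    (hT : ∀ p j, T (y p ⊗ₜ x j) = ∑ i, ∑ r, S.G p j i r • (x i ⊗ₜ y r)) :
    S.braidedPair.Presents x y (LinearMap.range f) (LinearMap.range g) (LinearMap.range h)
      ((S.q + S.q⁻¹) • T) where
  RVV_eq := by
    rw [w.range_eq_span]
    simp only [hf]
    rfl
  RWW_eq := by
    have hω : IsUnit S.ω := by
      refine isUnit_iff_ne_zero.2 fun h0 => ?_
      have := S.ω_cube
      simp [h0] at this
    rw [v.range_eq_span]
    refine Eq.trans ?_ (Submodule.span_smul_eq_of_isUnit (Set.range _) S.ω hω)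
    rw [Set.smul_set_range]
    simp only [hg, mul_smul, Finset.smul_sum]
    rfl
  RVW_eq := by
    rw [z.range_eq_span, Set.range_unique]
    change Submodule.span ℂ {h (z ())} = _
    rw [hh]
    congr 2
    change _ = ∑ i, ∑ p, (if i = p then (1 : ℂ) else 0) • (x i ⊗ₜ[ℂ] y p)
    simp
  T_eq := by
    refine ⟨fun p j => -S.x₀ * if p = j then 1 else 0, fun p j => ?_⟩
    rw [LinearMap.smul_apply, hT, Finset.smul_sum, ← Finset.sum_neg_distrib]
    refine Finset.sum_congr rfl fun i _ => ?_
    rw [Finset.smul_sum, ← Finset.sum_neg_distrib]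
    refine Finset.sum_congr rfl fun r _ => ?_
    rw [smul_smul, ← neg_smul]
    congr 1
    change _ = -(S.exch p j i r + (-S.x₀ * if p = j then 1 else 0) * (if i = r then 1 else 0))
    rw [SpiderCoeffs.exch]
    ring

/-! ### Frames of a datum and the two shape algebras. -/

namespace BQD

variable {V W : Type*} [AddCommGroup V] [Module ℂ V] [AddCommGroup W] [Module ℂ W]
  (L : BQD V W)

/-- Bases of `V` and `W` in which `c` and `C` are the standard copairing and pairing. -/
structure Frame where
  x : Module.Basis (Fin 3) ℂ V
  y : Module.Basis (Fin 3) ℂ W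
  c_one : L.c 1 = ∑ i, x i ⊗ₜ y i
  C_tmul : ∀ i j, L.C (y i ⊗ₜ x j) = if i = j then 1 else 0

/-- Any basis `x` of `V` will do: write `c 1 = ∑ x_i ⊗ y_i`. The zigzag identity forces `C (y_i ⊗
x_j) = δ_ij`, so the `y_i` are independent, and there are three of them. -/
lemma exists_frame : Nonempty L.Frame := by
  have := Module.finite_of_finrank_eq_succ L.finrank_V
  let x := Module.finBasisOfFinrankEq ℂ V L.finrank_V
  obtain ⟨y, hy⟩ := exists_eq_sum_tmul x (L.c 1)
  have hC : ∀ i j, L.C (y i ⊗ₜ x j) = if i = j then 1 else 0 := by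
    intro i j
    have := LinearMap.congr_fun L.zigzag_cC (x j)
    simp only [LinearMap.comp_apply, LinearEquiv.coe_coe, TensorProduct.lid_symm_apply,
      LinearMap.rTensor_tmul, hy, TensorProduct.sum_tmul, map_sum, TensorProduct.assoc_tmul,
      LinearMap.lTensor_tmul, TensorProduct.rid_tmul, LinearMap.id_apply] at this
    have h2 := congrArg (fun v => x.repr v i) this
    simpa [Finsupp.single_apply, eq_comm] using h2
  have hli : LinearIndependent ℂ y := by
    refine linearIndependent_of_pairing y (fun j => L.C ∘ₗ (TensorProduct.mk ℂ W V).flip (x j))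
      fun i j => hC i j
  let y' := basisOfLinearIndependentOfCardEqFinrank hli (by simp [L.finrank_W])
  have hy' : ∀ i, y' i = y i := fun i => by simp [y']
  exact ⟨⟨x, y', by simp only [hy, hy'], by simp only [hy', hC, implies_true]⟩⟩

namespace Frame

variable {L} (R : L.Frame)

/-- The coefficients of `A` in the frame. -/
def A (i j p : Fin 3) : ℂ := R.y.repr (L.A (R.x i ⊗ₜ R.x j)) p

/-- The coefficients of `a` in the frame. -/
def a (p i j : Fin 3) : ℂ := (R.x.tensorProduct R.x).repr (L.a (R.y p)) (i, j)

/-- The matrix of `D` in the frame. -/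
def M (i p : Fin 3) : ℂ := L.D (R.x i ⊗ₜ R.y p)

/-- The coefficients of `d` in the frame. -/
def d (p i : Fin 3) : ℂ := (R.y.tensorProduct R.x).repr (L.d 1) (p, i)

lemma A_tmul (i j : Fin 3) : L.A (R.x i ⊗ₜ R.x j) = ∑ p, R.A i j p • R.y p :=
  (R.y.sum_repr _).symm

lemma a_apply (p : Fin 3) : L.a (R.y p) = ∑ i, ∑ j, R.a p i j • (R.x i ⊗ₜ R.x j) :=
  R.x.tensorProduct_expand R.x _

lemma d_one : L.d 1 = ∑ p, ∑ i, R.d p i • (R.y p ⊗ₜ R.x i) :=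
  R.y.tensorProduct_expand R.x _

lemma D_tmul (i p : Fin 3) : L.D (R.x i ⊗ₜ R.y p) = R.M i p := rfl

lemma F_tmul (i p : Fin 3) : mapF L.A L.a (R.x i ⊗ₜ R.y p) =
    ∑ r, ∑ j, (∑ h, R.A i h r * R.a p h j) • (R.y r ⊗ₜ R.x j) := by
  simp only [mapF, LinearMap.comp_apply, LinearEquiv.coe_coe, LinearMap.lTensor_tmul, a_apply,
    TensorProduct.tmul_sum, TensorProduct.tmul_smul, map_sum, map_smul,
    TensorProduct.assoc_symm_tmul, LinearMap.rTensor_tmul, A_tmul, TensorProduct.sum_tmul,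
    ← TensorProduct.smul_tmul', Finset.smul_sum, smul_smul, Finset.sum_smul]
  exact sum_swap₁.trans (sum_swap₂.trans (sum_swap₁.trans (sum_congr₃ fun r j h => by
    rw [mul_comm])))

lemma G_tmul (p j : Fin 3) : mapG L.A L.a (R.y p ⊗ₜ R.x j) =
    ∑ i, ∑ r, (∑ k, R.a p i k * R.A k j r) • (R.x i ⊗ₜ R.y r) := by
  simp only [mapG, LinearMap.comp_apply, LinearEquiv.coe_coe, LinearMap.rTensor_tmul, a_apply,
    TensorProduct.tmul_sum, TensorProduct.tmul_smul, map_sum, map_smul,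
    TensorProduct.assoc_tmul, LinearMap.lTensor_tmul, A_tmul, TensorProduct.sum_tmul,
    ← TensorProduct.smul_tmul', Finset.smul_sum, smul_smul, Finset.sum_smul]
  exact sum_swap₂

lemma B_tmul (p r : Fin 3) : L.B (R.y p ⊗ₜ R.y r) = ∑ i, (L.ω * R.a r p i) • R.x i := by
  rw [← L.C_a]
  simp only [LinearMap.smul_apply, LinearMap.comp_apply, LinearEquiv.coe_coe,
    LinearMap.lTensor_tmul, a_apply, TensorProduct.tmul_sum, TensorProduct.tmul_smul, map_sum,
    map_smul, TensorProduct.assoc_symm_tmul, LinearMap.rTensor_tmul, R.C_tmul,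
    TensorProduct.lid_tmul, ite_smul, one_smul, zero_smul, smul_ite, smul_zero]
  rw [Finset.sum_comm, Finset.smul_sum]
  simp only [Finset.sum_ite_eq, Finset.mem_univ, if_true, smul_smul]

lemma b_apply (i : Fin 3) : L.b (R.x i) = ∑ p, ∑ r, R.A i r p • (R.y p ⊗ₜ R.y r) := by
  rw [← L.A_c]
  simp only [LinearMap.comp_apply, LinearEquiv.coe_coe, TensorProduct.rid_symm_apply,
    LinearMap.lTensor_tmul, R.c_one, TensorProduct.tmul_sum, map_sum,
    TensorProduct.assoc_symm_tmul, LinearMap.rTensor_tmul, A_tmul, TensorProduct.sum_tmul,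
    ← TensorProduct.smul_tmul']
  exact Finset.sum_comm

/-- The structure constants in the given bases. -/
def coeffs : SpiderCoeffs (Fin 3) where
  q := L.q
  ω := L.ω
  A := R.A
  a := R.a
  M := R.M
  d := R.d
  q_ne_zero := L.q_ne_zero
  q_sq_ne := L.q_sq_ne
  q_sq := L.q_sq
  ω_cube := L.ω_cube
  M_d i j := by
    have := LinearMap.congr_fun L.zigzag_dD (R.x i)
    simp only [LinearMap.comp_apply, LinearEquiv.coe_coe, TensorProduct.rid_symm_apply,
      LinearMap.lTensor_tmul, R.d_one, TensorProduct.tmul_sum, TensorProduct.tmul_smul, map_sum,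
      map_smul, TensorProduct.assoc_symm_tmul, LinearMap.rTensor_tmul, TensorProduct.lid_tmul,
      LinearMap.id_apply, R.D_tmul] at this
    have h2 := congrArg (fun v => R.x.repr v j) this
    simpa [Finsupp.single_apply, mul_comm] using h2
  a_A p p' := by
    have := LinearMap.congr_fun L.A_comp_a (R.y p)
    simp only [LinearMap.comp_apply, R.a_apply, map_sum, map_smul, R.A_tmul,
      LinearMap.id_apply] at this
    have h2 := congrArg (fun v => R.y.repr v p') this
    simpa [Finsupp.single_apply] using h2
  A_rot i j k := by
    have := LinearMap.congr_fun L.C_A ((R.x i ⊗ₜ R.x j) ⊗ₜ R.x k)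
    simpa [R.A_tmul, TensorProduct.sum_tmul, TensorProduct.tmul_sum, ← TensorProduct.smul_tmul',
      R.C_tmul, R.D_tmul, mul_comm] using this
  a_rot i j k := by
    have := LinearMap.congr_fun L.a_c 1
    simp only [LinearMap.comp_apply, LinearMap.smul_apply, LinearEquiv.coe_coe, R.c_one, R.d_one,
      map_sum, map_smul, LinearMap.lTensor_tmul, LinearMap.rTensor_tmul, R.a_apply,
      TensorProduct.tmul_sum, TensorProduct.sum_tmul, TensorProduct.tmul_smul,
      ← TensorProduct.smul_tmul', TensorProduct.assoc_tmul] at this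
    have h2 := congrArg
      (fun v => (R.x.tensorProduct (R.x.tensorProduct R.x)).repr v (i, (j, k))) this
    simpa [Finsupp.single_apply] using h2
  trace_M := by
    have := LinearMap.congr_fun L.D_comp_c 1
    simpa [R.c_one, R.D_tmul] using this
  G_F i p i' p' := by
    have := LinearMap.congr_fun L.G_comp_F (R.x i ⊗ₜ R.y p)
    simp only [LinearMap.comp_apply, R.F_tmul, R.G_tmul, map_sum, map_smul, LinearMap.smul_apply,
      LinearMap.add_apply, LinearMap.id_apply, R.D_tmul] at this
    rw [← mul_one (R.M i p), ← smul_eq_mul, map_smul, R.c_one] at this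
    have h2 := congrArg (fun v => (R.x.tensorProduct R.y).repr v (i', p')) this
    simp only [map_sum, map_smul, map_add, Finsupp.coe_finsetSum, Finset.sum_apply,
      Finsupp.smul_apply, Finsupp.add_apply, Module.Basis.tensorProduct_repr_tmul_apply,
      Module.Basis.repr_self, Finsupp.single_apply, smul_eq_mul, mul_ite, ite_mul, mul_one, one_mul,
      mul_zero, zero_mul, Finset.sum_ite_irrel, Finset.sum_const_zero, Finset.sum_ite_eq',
      Finset.mem_univ, if_true] at h2
    rw [h2, ite_and]
    split_ifs <;> simp_all

lemma presents_shape : R.coeffs.braidedPair.Presents R.x R.y (LinearMap.range L.a)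
    (LinearMap.range L.b) (LinearMap.range L.c) ((L.q + L.q⁻¹) • L.G) :=
  R.coeffs.presents R.x R.y L.a R.y R.a_apply L.b R.x
    (fun i => by
      rw [R.b_apply]
      refine sum_congr₂ fun p r => ?_
      congr 1
      change R.A i r p = L.ω * (L.ω ^ 2 * R.A i r p)
      linear_combination (-R.A i r p) * L.ω_cube)
    L.c (Module.Basis.singleton Unit ℂ) (by simpa using R.c_one) L.G R.G_tmul

/-- The functionals `D (x_i ⊗ ·)` form a basis of the dual of `W`. -/
lemma exists_dual_basis : ∃ η : Module.Basis (Fin 3) ℂ (Module.Dual ℂ W),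
    ∀ i p, η i (R.y p) = R.M i p := by
  let u : Fin 3 → Module.Dual ℂ W := fun i => L.D ∘ₗ TensorProduct.mk ℂ V W (R.x i)
  have hu : ∀ i p, u i (R.y p) = R.M i p := fun i p => rfl
  have hli : LinearIndependent ℂ u := by
    refine linearIndependent_of_pairing u
      (fun j => LinearMap.applyₗ (∑ p, R.d p j • R.y p)) fun i j => ?_
    rw [LinearMap.applyₗ_apply_apply, map_sum, ← R.coeffs.M_d]
    refine Finset.sum_congr rfl fun p _ => ?_
    rw [map_smul, hu, smul_eq_mul, mul_comm]
    rfl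
  have := Module.finite_of_finrank_eq_succ L.finrank_W
  refine ⟨basisOfLinearIndependentOfCardEqFinrank hli
    (by simp [Subspace.dual_finrank_eq, L.finrank_W]), fun i p => ?_⟩
  rw [coe_basisOfLinearIndependentOfCardEqFinrank, hu]

/-- In `W*` the basis is `η_i = D (x_i ⊗ ·)` rather than the dual of `y`, so that the transpose of
`D` yields the standard copairing `∑ x^i ⊗ η_i`. The other transposes then become the constants of
`coeffs.dual` through the rotation identities `M_A` and `M_a`. -/
lemma exists_presents_dualShape [FiniteDimensional ℂ V] [FiniteDimensional ℂ W] :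
    ∃ η : Module.Basis (Fin 3) ℂ (Module.Dual ℂ W),
      R.coeffs.dual.braidedPair.Presents R.x.dualBasis η (LinearMap.range (transposeTo L.A))
        (LinearMap.range (transposeTo L.B)) (LinearMap.range (transposeTo L.D))
        ((L.q + L.q⁻¹) • L.transposeF) := by
  obtain ⟨η, hη⟩ := R.exists_dual_basis
  have hξ : ∀ i j, R.x.dualBasis i (R.x j) = if j = i then 1 else 0 := fun i j => by
    rw [R.x.dualBasis_apply_self]
  have hω := L.ω_cube
  refine ⟨η, R.coeffs.dual.presents R.x.dualBasis η (transposeTo L.A) η (fun r => ?_)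
    (transposeTo L.B) R.x.dualBasis (fun r => ?_) (transposeTo L.D)
    (Module.Basis.singleton Unit ℂ).dualBasis ?_ L.transposeF fun p j => ?_⟩
  · refine transposeTo_eq R.x R.x _ _ _ fun i j => ?_
    simp only [map_sum, map_smul, LinearMap.sum_apply, LinearMap.smul_apply,
      TensorProduct.dualDistrib_apply, hξ, smul_eq_mul, R.A_tmul, hη]
    have h1 : ∑ k, R.A i j k * R.M r k = R.coeffs.dual.a r i j :=
      (Finset.sum_congr rfl fun k _ => mul_comm _ _).trans (R.coeffs.M_A r i j)
    simp [h1]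
  · refine transposeTo_eq R.y R.y _ _ _ fun p q => ?_
    simp only [map_sum, map_smul, LinearMap.sum_apply, LinearMap.smul_apply,
      TensorProduct.dualDistrib_apply, hξ, smul_eq_mul, R.B_tmul, hη]
    have h1 : ∀ h k, R.coeffs.dual.ω * R.coeffs.dual.dual.a r k h * (R.M h p * R.M k q) =
        L.ω ^ 2 * (R.M k q * (R.M h p * R.a r k h)) := by
      intro h k
      change L.ω ^ 2 * ((L.ω ^ 2) ^ 2 * (L.ω ^ 2 * R.a r k h)) * (R.M h p * R.M k q) = _
      linear_combination (L.ω ^ 2 * (L.ω ^ 3 + 1) * R.a r k h * (R.M h p * R.M k q)) * hω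
    have h2 : ∀ k, ∑ h, R.M h p * R.a r k h = L.ω * R.a p r k := fun k => R.coeffs.M_a p r k
    have h3 : ∑ k, R.M k q * R.a p r k = L.ω * R.a q p r := R.coeffs.M_a q p r
    have h4 : ∀ k, R.M k q * (L.ω * R.a p r k) = L.ω * (R.M k q * R.a p r k) := fun k => by ring
    simp only [h1]
    rw [Finset.sum_comm]
    simp only [← Finset.mul_sum, h2, h4, h3]
    simp only [mul_ite, mul_one, mul_zero, Finset.sum_ite_eq', Finset.mem_univ, if_true]
    linear_combination (L.ω * R.a q p r) * hω
  · refine transposeTo_eq R.x R.y _ _ _ fun i p => ?_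
    simp only [map_sum, LinearMap.sum_apply, TensorProduct.dualDistrib_apply, hξ, R.D_tmul, hη]
    simp
  · rw [transposeF, LinearMap.comp_apply]
    refine transposeTo_eq R.x R.y _ _ _ fun i r => ?_
    simp only [map_sum, map_smul, LinearMap.sum_apply, LinearMap.smul_apply, LinearEquiv.coe_coe,
      TensorProduct.dualDistrib_apply, hξ, smul_eq_mul, hη, F, R.F_tmul]
    have hd : ∀ s k, TensorProduct.dualDistribEquiv ℂ W V (η p ⊗ₜ[ℂ] R.x.dualBasis j)
        (R.y s ⊗ₜ[ℂ] R.x k) = R.M p s * if k = j then 1 else 0 := fun s k => by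
      rw [← hη, ← hξ]
      rfl
    have h1 : ∑ k, R.coeffs.dual.G p j i k * R.M k r =
        ∑ h, (L.ω ^ 2 * R.A p i h) * R.a r h j := by
      simp only [SpiderCoeffs.G, Finset.sum_mul]
      rw [Finset.sum_comm]
      refine Finset.sum_congr rfl fun h _ => ?_
      have e : ∀ k, R.coeffs.dual.a p i h * R.coeffs.dual.A h j k * R.M k r =
          (L.ω * R.A p i h) * (R.M k r * R.a h j k) := by
        intro k
        change L.ω ^ 2 * R.A p i h * (L.ω ^ 2 * R.a h j k) * R.M k r = _
        linear_combination (L.ω * R.A p i h * R.a h j k * R.M k r) * hω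
      have e' : ∑ k, R.M k r * R.a h j k = L.ω * R.a r h j := R.coeffs.M_a r h j
      simp only [e, ← Finset.mul_sum, e']
      ring
    have h2 : ∑ s, (∑ h, R.A i h s * R.a r h j) * R.M p s =
        ∑ h, (L.ω ^ 2 * R.A p i h) * R.a r h j := by
      simp only [Finset.sum_mul]
      rw [Finset.sum_comm]
      refine Finset.sum_congr rfl fun h _ => ?_
      have e' : ∑ s, R.M p s * R.A i h s = L.ω ^ 2 * R.A p i h := R.coeffs.M_A p i h
      rw [← e', Finset.sum_mul]
      exact Finset.sum_congr rfl fun s _ => by ring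
    simp only [hd]
    simp [h1, h2]

end Frame

lemma finrank_shapePiece (k l : ℕ) :
    2 * Module.finrank ℂ (L.shapePiece k l) = (k + 1) * (l + 1) * (k + l + 2) := by
  obtain ⟨R⟩ := L.exists_frame
  refine (congrArg (2 * ·) (R.presents_shape.finrank_quotientPiece _ k l)).trans ?_
  exact R.coeffs.braidedPair.finrank_Q (by simp) k l

lemma finrank_dualShapePiece [FiniteDimensional ℂ V] [FiniteDimensional ℂ W] (k l : ℕ) :
    2 * Module.finrank ℂ (L.dualShapePiece k l) = (k + 1) * (l + 1) * (k + l + 2) := by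
  obtain ⟨R⟩ := L.exists_frame
  obtain ⟨η, h⟩ := R.exists_presents_dualShape
  refine (congrArg (2 * ·) (h.finrank_quotientPiece _ k l)).trans ?_
  exact R.coeffs.dual.braidedPair.finrank_Q (by simp) k l

end BQD

end QuantumSL3

end

theorem mainTheorem7 {V W : Type*} [AddCommGroup V] [Module ℂ V] [FiniteDimensional ℂ V]
    [AddCommGroup W] [Module ℂ W] [FiniteDimensional ℂ W]
    (L : QuantumSL3.BQD V W) (hL : ¬ L.IsElliptic) (k ℓ : ℕ) :
    (Module.finrank ℂ (L.shapePiece k ℓ) : ℚ) =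
        ((k : ℚ) + 1) * ((ℓ : ℚ) + 1) * ((k : ℚ) + ℓ + 2) / 2 ∧
      (Module.finrank ℂ (L.dualShapePiece k ℓ) : ℚ) =
        ((k : ℚ) + 1) * ((ℓ : ℚ) + 1) * ((k : ℚ) + ℓ + 2) / 2 := by
  rw [eq_div_iff two_ne_zero, eq_div_iff two_ne_zero, mul_comm _ (2 : ℚ), mul_comm _ (2 : ℚ)]
  exact ⟨by exact_mod_cast L.finrank_shapePiece k ℓ, by exact_mod_cast L.finrank_dualShapePiece k ℓ⟩
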